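/- Let $d\in\mathbb{N}$, let $\mathbb{D}$ be the open unit disk and $\mathbb{T}$ the unit circle with normalized Lebesgue measure $m$, and let $W$ be a (full rank) matrix weight on $\mathbb{T}$, i.e. an integrable function on $\mathbb{T}$ whose values are $d\times d$ complex matrices that are Hermitian and positive definite almost everywhere. For a function $F\in L^1(\mathbb{T})$, write $$F(\lambda)=\int_{\mathbb{T}}\frac{1-|\lambda|^2}{|\zeta-\lambda|^2}\,F(\zeta)\,dm(\zeta),\qquad \lambda\in\mathbb{D},$$ for its harmonic extension. A measure $\mu$ on $\mathbb{D}$ is called a vanishing Carleson measure if $\limsup_{|I|\to0}\mu(Q(I))/|I|=0$, where $I$ runs over all subarcs of $\mathbb{T}$, $|I|=m(I)$ and $Q(I)=\{z\in\mathbb{D}: z/|z|\in I,\ 1-|I|\le|z|<1\}$. Then $\log\det W\in L^1(\mathbb{T})$ (so that its harmonic extension $[\log\det W](\lambda)$ is defined) and $$\limsup_{|\lambda|\to1}\Bigl\{\det\bigl(W(\lambda)\bigr)\exp\bigl(-[\log\det W](\lambda)\bigr)\Bigr\}=1$$ if and only if both measures $$\Bigl\|W(z)^{-1/2}\Bigl(\frac{\partial}{\partial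 x}W(z)\Bigr)W(z)^{-1/2}\Bigr\|^2(1-|z|^2)\,dx\,dy \quad\text{and}\quad \Bigl\|W(z)^{-1/2}\Bigl(\frac{\partial}{\partial y}W(z)\Bigr)W(z)^{-1/2}\Bigr\|^2(1-|z|^2)\,dx\,dy$$ on $\mathbb{D}$ are vanishing Carleson measures, where $W(z)$, $z=x+iy\in\mathbb{D}$, is the harmonic extension of $W$ and $\|\cdot\|$ is the operator norm on $\mathbb{C}^d$. -/

import Mathlib

open Filter MeasureTheory Metric Real
open scoped Topology ENNReal ComplexOrder MatrixOrder Matrix.Norms.L2Operator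

noncomputable section

/-- The Poisson integral (harmonic extension) at the point `z` of the unit disk of a function `f`
on the unit circle: the average of `ζ ↦ (1 - |z|²) / |ζ - z|² • f ζ` over `|ζ| = 1` with respect
to normalized arc length. Only the values of `f` on the unit circle matter. -/
def harmonicExt {E : Type*} [NormedAddCommGroup E] [NormedSpace ℝ E] (f : ℂ → E) (z : ℂ) : E :=
  circleAverage (fun ζ => poissonKernel 0 z ζ • f ζ) 0 1

/-- A `d × d` (full rank) matrix weight on the unit circle: an integrable function whose values
are positive definite Hermitian matrices almost everywhere on the circle. -/
structure IsMatrixWeight {d : ℕ} (W : ℂ → Matrix (Fin d) (Fin d) ℂ) : Prop where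
  integrable : CircleIntegrable W 0 1
  posDef : ∀ᵐ θ : ℝ, (W (circleMap 0 1 θ)).PosDef

/-- The function `log det W`; the determinant of a positive definite matrix is a positive real. -/
def logDet {d : ℕ} (W : ℂ → Matrix (Fin d) (Fin d) ℂ) (ζ : ℂ) : ℝ :=
  Real.log (W ζ).det.re

/-- The closed arc of the unit circle starting at `exp (2 π i a)`, of normalized length `h`
(the whole circle has length one). -/
def arc (a h : ℝ) : Set ℂ :=
  (fun t : ℝ => circleMap 0 1 (2 * π * t)) '' Set.Icc a (a + h)

/-- The Carleson square over the arc `arc a h`. -/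
def carlesonSquare (a h : ℝ) : Set ℂ :=
  {z : ℂ | z / (‖z‖ : ℂ) ∈ arc a h ∧ 1 - h ≤ ‖z‖ ∧ ‖z‖ < 1}

/-- `μ` is a vanishing Carleson measure: `limsup μ (Q I) / |I| = 0` as `|I| → 0`, over all arcs
`I` (no restriction on the starting point, length tending to zero from above). -/
def IsVanishingCarleson (μ : Measure ℂ) : Prop :=
  limsup (fun p : ℝ × ℝ => μ (carlesonSquare p.1 p.2) / ENNReal.ofReal p.2)
    ((⊤ : Filter ℝ) ×ˢ 𝓝[>] (0 : ℝ)) = 0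

/-- `A ^ (-1/2)` for a positive definite matrix `A`. -/
def invSqrt {d : ℕ} (A : Matrix (Fin d) (Fin d) ℂ) : Matrix (Fin d) (Fin d) ℂ :=
  (CFC.sqrt A)⁻¹

/-- The measure `‖W(z)^(-1/2) (∂_v W(z)) W(z)^(-1/2)‖² (1 - |z|²) dx dy` on the unit disk, where
`W(z)` is the harmonic extension, `∂_v` is the derivative in the direction `v` (`v = 1` gives
`∂/∂x` and `v = I` gives `∂/∂y`) and the norm is the operator norm on the Euclidean space `ℂ^d`. -/
def gradMeasure {d : ℕ} (W : ℂ → Matrix (Fin d) (Fin d) ℂ) (v : ℂ) : Measure ℂ :=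
  (volume.restrict (ball (0 : ℂ) 1)).withDensity fun z =>
    ENNReal.ofReal
      (‖invSqrt (harmonicExt W z) * lineDeriv ℝ (harmonicExt W) z v * invSqrt (harmonicExt W z)‖ ^ 2
        * (1 - ‖z‖ ^ 2))

end

/-!
Let `V` be the harmonic extension of `W`. It is `H + H*` for a holomorphic matrix function `H`,
and a computation with Wirtinger derivatives gives `-Δ log det V = 4 tr (V⁻¹ H' V⁻¹ H'*)`. This
function is called the energy density; it is, up to constants depending on `d` only, the sum of
the two densities `‖V^(-1/2) (∂V) V^(-1/2)‖²` (`gradMeasure_le`, `le_gradMeasure`), so the two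
measures of the theorem are vanishing Carleson measures if and only if the measure with density
`1 - |z|²` times the energy density is one.

The function `exp` is applied to the Jensen gap `u = log det V - (harmonic extension of log det W)`,
which is nonnegative because `log det` is concave. The theorem therefore says that `u` tends to
zero at the boundary if and only if the energy measure is a vanishing Carleson measure. The bridge
between the two is the energy `K a = ∫ (1 - |φ_a|²) (energy density)` seen from a point `a` of the
disk, where `φ_a` is the automorphism of the disk that exchanges `0` and `a`.

* `K a` is comparable with `u a` (`energyAt_le_jensenGap`, `jensenGap_le_energyAt`). Both are
  invariant under automorphisms, so `a = 0` may be assumed. There Green's formula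
  (`logDetRe_sub_circleAverage`) expresses the gap as the integral of the energy density against
  `log (1 / |z|)`, and this weight is comparable with `1 - |z|²` away from the origin; Harnack's
  inequality for `V` controls the energy density near the origin
  (`IsDiscPositive.energy_le_circleAverage`). Green's formula is used on disks of radius `R < 1`;
  the passage `R → 1` rests on Fatou's lemma (`le_circleAverage_logDet`) and on the monotonicity of
  the circle averages of `log det V`. The same passage yields the integrability of `log det W`
  when `K 0` is finite.
* `K a` is the integral of `(1 - |a|²) / |1 - ā w|²` against the energy measure. This kernel is at
  least a constant over `h` on the Carleson square of an arc of length `h` for a suitable `a` with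
  `1 - |a| = h` (`measure_carlesonSquare_le`), and a dyadic decomposition bounds the integral by the
  masses of Carleson squares (`lintegral_le_of_carleson`).
-/

/-! ### Positive definite matrices and the invariant form -/

section

variable {d : ℕ}

open Matrix in
lemma invSqrt_isHermitian (A : Matrix (Fin d) (Fin d) ℂ) : (invSqrt A)ᴴ = invSqrt A := by
  have h : (CFC.sqrt A).IsHermitian := (Matrix.nonneg_iff_posSemidef.1 (CFC.sqrt_nonneg A)).1
  exact h.inv

open Matrix in
lemma invSqrt_mul_self {A : Matrix (Fin d) (Fin d) ℂ} (hA : A.PosDef) :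
    invSqrt A * invSqrt A = A⁻¹ := by
  rw [invSqrt, ← Matrix.mul_inv_rev, CFC.sqrt_mul_sqrt_self A hA.posSemidef.nonneg]

open Matrix in
lemma isUnit_invSqrt {A : Matrix (Fin d) (Fin d) ℂ} (hA : A.PosDef) : IsUnit (invSqrt A) := by
  have h : IsUnit (invSqrt A * invSqrt A) := by
    rw [invSqrt_mul_self hA]
    exact (Matrix.isUnit_nonsing_inv_iff).2 hA.isUnit
  exact isUnit_of_mul_isUnit_left h

/-- The real number `tr (A⁻¹ B A⁻¹ B*)`, the squared norm of `B` in the invariant metric of the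
cone of positive definite matrices at the point `A`. -/
noncomputable def invForm (A B : Matrix (Fin d) (Fin d) ℂ) : ℝ :=
  (Matrix.trace (A⁻¹ * B * A⁻¹ * B.conjTranspose)).re

open Matrix in
lemma re_trace_mul_conjTranspose (M : Matrix (Fin d) (Fin d) ℂ) :
    (trace (M * Mᴴ)).re = ∑ i, ∑ j, ‖M i j‖ ^ 2 := by
  simp only [trace, diag, mul_apply, conjTranspose_apply, Complex.re_sum]
  refine Finset.sum_congr rfl fun i _ => Finset.sum_congr rfl fun j _ => ?_
  rw [Complex.star_def, Complex.mul_conj, Complex.ofReal_re, Complex.normSq_eq_norm_sq]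

open Matrix in
/-- The form `invForm A` is the squared Frobenius norm of `A^(-1/2) B A^(-1/2)`. -/
lemma invForm_eq_sum {A : Matrix (Fin d) (Fin d) ℂ} (hA : A.PosDef) (B : Matrix (Fin d) (Fin d) ℂ) :
    invForm A B = ∑ i, ∑ j, ‖(invSqrt A * B * invSqrt A) i j‖ ^ 2 := by
  rw [← re_trace_mul_conjTranspose, invForm, ← invSqrt_mul_self hA]
  simp only [conjTranspose_mul, invSqrt_isHermitian]
  congr 1
  rw [show invSqrt A * invSqrt A * B * (invSqrt A * invSqrt A) * Bᴴ
    = invSqrt A * (invSqrt A * B * (invSqrt A * invSqrt A) * Bᴴ) by noncomm_ring, trace_mul_comm]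
  congr 1
  noncomm_ring

lemma invForm_nonneg {A : Matrix (Fin d) (Fin d) ℂ} (hA : A.PosDef)
    (B : Matrix (Fin d) (Fin d) ℂ) : 0 ≤ invForm A B := by
  rw [invForm_eq_sum hA]; positivity

open Matrix in
lemma norm_apply_le_l2_opNorm (M : Matrix (Fin d) (Fin d) ℂ) (i j : Fin d) : ‖M i j‖ ≤ ‖M‖ := by
  have h := l2_opNorm_mulVec M (EuclideanSpace.single j (1 : ℂ))
  rw [show ‖EuclideanSpace.single j (1 : ℂ)‖ = 1 by simp, mul_one] at h
  refine le_trans ?_ h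
  refine le_trans ?_ (PiLp.norm_apply_le _ i)
  simp

open Matrix in
lemma sum_norm_sq_le (M : Matrix (Fin d) (Fin d) ℂ) :
    ∑ i, ∑ j, ‖M i j‖ ^ 2 ≤ d ^ 2 * ‖M‖ ^ 2 := by
  calc ∑ i, ∑ j, ‖M i j‖ ^ 2 ≤ ∑ i : Fin d, ∑ j : Fin d, ‖M‖ ^ 2 := by
        gcongr with i _ j _
        exact norm_apply_le_l2_opNorm M i j
    _ = d ^ 2 * ‖M‖ ^ 2 := by simp; ring

open Matrix in
lemma l2_opNorm_sq_le_sum (M : Matrix (Fin d) (Fin d) ℂ) :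
    ‖M‖ ^ 2 ≤ ∑ i, ∑ j, ‖M i j‖ ^ 2 := by
  have h0 : 0 ≤ ∑ i, ∑ j, ‖M i j‖ ^ 2 := by positivity
  suffices h : ‖M‖ ≤ √(∑ i, ∑ j, ‖M i j‖ ^ 2) by
    calc ‖M‖ ^ 2 ≤ √(∑ i, ∑ j, ‖M i j‖ ^ 2) ^ 2 := by gcongr
      _ = _ := Real.sq_sqrt h0
  rw [l2_opNorm_def]
  refine ContinuousLinearMap.opNorm_le_bound _ (Real.sqrt_nonneg _) fun x => ?_
  rw [EuclideanSpace.norm_eq, EuclideanSpace.norm_eq, ← Real.sqrt_mul h0]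
  apply Real.sqrt_le_sqrt
  rw [Finset.sum_mul]
  refine Finset.sum_le_sum fun i _ => ?_
  have hx : ∀ i, ‖(toEuclideanLin M x) i‖ ≤ ∑ j, ‖M i j‖ * ‖x j‖ := fun i => by
    rw [toLpLin_apply]
    simp only [mulVec, dotProduct]
    refine (norm_sum_le _ _).trans (le_of_eq ?_)
    simp
  calc _ ≤ (∑ j, ‖M i j‖ * ‖x j‖) ^ 2 := by
        gcongr
        exact hx i
    _ ≤ _ := Finset.sum_mul_sq_le_sq_mul_sq _ _ _

/-- The squared operator norm in `gradMeasure` is comparable with the invariant form. -/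
lemma norm_invSqrt_mul_sq_le_invForm {A : Matrix (Fin d) (Fin d) ℂ} (hA : A.PosDef)
    (B : Matrix (Fin d) (Fin d) ℂ) : ‖invSqrt A * B * invSqrt A‖ ^ 2 ≤ invForm A B := by
  rw [invForm_eq_sum hA]; exact l2_opNorm_sq_le_sum _

lemma invForm_le_norm_invSqrt_mul_sq {A : Matrix (Fin d) (Fin d) ℂ} (hA : A.PosDef)
    (B : Matrix (Fin d) (Fin d) ℂ) :
    invForm A B ≤ d ^ 2 * ‖invSqrt A * B * invSqrt A‖ ^ 2 := by
  rw [invForm_eq_sum hA]; exact sum_norm_sq_le _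

open Matrix in
/-- For `V = H + H*` this expresses the energy `invForm V V_x + invForm V V_y` through the
complex derivative of `H`. -/
lemma invForm_add_conjTranspose (A B : Matrix (Fin d) (Fin d) ℂ) :
    invForm A (B + Bᴴ) + invForm A (Complex.I • B + (Complex.I • B)ᴴ) = 4 * invForm A B := by
  have hI : (Complex.I • B)ᴴ = -(Complex.I • Bᴴ) := by
    rw [conjTranspose_smul, Complex.star_def, Complex.conj_I, neg_smul]
  have hsym : trace (A⁻¹ * Bᴴ * A⁻¹ * B) = trace (A⁻¹ * B * A⁻¹ * Bᴴ) := by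
    rw [show A⁻¹ * Bᴴ * A⁻¹ * B = (A⁻¹ * Bᴴ) * (A⁻¹ * B) by noncomm_ring, trace_mul_comm]
    congr 1; noncomm_ring
  simp only [invForm, ← Complex.add_re]
  rw [show (4 : ℝ) * (trace (A⁻¹ * B * A⁻¹ * Bᴴ)).re
    = (trace (A⁻¹ * B * A⁻¹ * Bᴴ) + trace (A⁻¹ * B * A⁻¹ * Bᴴ) +
      trace (A⁻¹ * Bᴴ * A⁻¹ * B) + trace (A⁻¹ * Bᴴ * A⁻¹ * B)).re by
    rw [hsym]; simp only [Complex.add_re]; ring]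
  congr 1
  rw [hI]
  simp only [conjTranspose_add, conjTranspose_conjTranspose, conjTranspose_smul,
    conjTranspose_neg, ← trace_add, Complex.star_def, Complex.conj_I]
  congr 1
  simp only [mul_add, add_mul, mul_neg, neg_mul, Matrix.mul_smul, Matrix.smul_mul, smul_smul,
    Complex.I_mul_I, neg_smul, one_smul, neg_neg]
  abel

open Matrix in
lemma trace_mul_nonneg_of_posSemidef {X Y : Matrix (Fin d) (Fin d) ℂ} (hX : X.PosSemidef)
    (hY : Y.PosSemidef) : 0 ≤ (trace (X * Y)).re := by
  obtain ⟨C, rfl⟩ := CStarAlgebra.nonneg_iff_eq_star_mul_self.1 hX.nonneg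
  rw [star_eq_conjTranspose]
  rw [mul_assoc, trace_mul_comm]
  exact (Complex.le_def.1 (hY.mul_mul_conjTranspose_same C).trace_nonneg).1

open Matrix in
lemma inv_le_smul_inv {A₁ A₂ : Matrix (Fin d) (Fin d) ℂ} (h₁ : A₁.PosDef)
    {c : ℝ} (hc : 0 < c) (h : A₁ ≤ (c : ℂ) • A₂) : A₂⁻¹ ≤ (c : ℂ) • A₁⁻¹ := by
  have hc' : (0 : ℂ) < (c : ℂ) := by exact_mod_cast hc
  have hcc : ((c : ℂ)) ≠ 0 := hc'.ne'
  have h3 := CStarAlgebra.ringInverse_le_ringInverse h (isStrictlyPositive_iff_posDef.2 h₁)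
  rw [← nonsing_inv_eq_ringInverse, ← nonsing_inv_eq_ringInverse] at h3
  have h4 : ((c : ℂ) • A₂)⁻¹ = (c : ℂ)⁻¹ • A₂⁻¹ := by
    rcases Nat.eq_zero_or_pos d with rfl | hd
    · exact Subsingleton.elim _ _
    by_cases hu : IsUnit A₂.det
    · exact inv_smul' (A := A₂) (Units.mk0 _ hcc) hu
    · rw [nonsing_inv_apply_not_isUnit _ hu, nonsing_inv_apply_not_isUnit, smul_zero]
      rw [det_smul]
      intro h; exact hu (isUnit_of_mul_isUnit_right h)
  rw [h4] at h3
  have h5 := smul_le_smul_of_nonneg_left h3 hc'.le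
  rwa [smul_smul, mul_inv_cancel₀ hcc, one_smul] at h5

open Matrix in
/-- Comparable points carry comparable invariant norms. -/
lemma invForm_le_of_le_smul {A₁ A₂ : Matrix (Fin d) (Fin d) ℂ} (h₁ : A₁.PosDef) (h₂ : A₂.PosDef)
    {c : ℝ} (hc : 0 < c) (h : A₁ ≤ (c : ℂ) • A₂) (B : Matrix (Fin d) (Fin d) ℂ) :
    invForm A₂ B ≤ c ^ 2 * invForm A₁ B := by
  have hi := inv_le_smul_inv h₁ hc h
  set X := A₂⁻¹
  set Y := A₁⁻¹
  have hX : X.PosSemidef := h₂.inv.posSemidef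
  have hY : Y.PosSemidef := h₁.inv.posSemidef
  have hD : ((c : ℂ) • Y - X).PosSemidef := le_iff.1 hi
  -- replace the two factors `A₂⁻¹` by `c A₁⁻¹` one at a time
  have s1 : 0 ≤ (trace (((c : ℂ) • Y - X) * (B * X * Bᴴ))).re :=
    trace_mul_nonneg_of_posSemidef hD (hX.mul_mul_conjTranspose_same B)
  have s2 : 0 ≤ (trace (((c : ℂ) • Y - X) * (Bᴴ * Y * B))).re :=
    trace_mul_nonneg_of_posSemidef hD (hY.conjTranspose_mul_mul_same B)
  have e1 : trace (X * (B * X * Bᴴ)) = trace (X * B * X * Bᴴ) := by congr 1; noncomm_ring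
  have e2 : trace (Y * (B * X * Bᴴ)) = trace (Y * B * X * Bᴴ) := by congr 1; noncomm_ring
  have e3 : trace (X * (Bᴴ * Y * B)) = trace (Y * B * X * Bᴴ) := by
    rw [show X * (Bᴴ * Y * B) = (X * Bᴴ) * (Y * B) by noncomm_ring, trace_mul_comm]
    congr 1; noncomm_ring
  have e4 : trace (Y * (Bᴴ * Y * B)) = trace (Y * B * Y * Bᴴ) := by
    rw [show Y * (Bᴴ * Y * B) = (Y * Bᴴ) * (Y * B) by noncomm_ring, trace_mul_comm]
    congr 1; noncomm_ring
  rw [sub_mul, smul_mul, trace_sub, trace_smul, e1, e2, smul_eq_mul, Complex.sub_re,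
    Complex.re_ofReal_mul] at s1
  rw [sub_mul, smul_mul, trace_sub, trace_smul, e3, e4, smul_eq_mul, Complex.sub_re,
    Complex.re_ofReal_mul] at s2
  have e5 : invForm A₂ B = (trace (X * B * X * Bᴴ)).re := rfl
  have e6 : invForm A₁ B = (trace (Y * B * Y * Bᴴ)).re := rfl
  rw [e5, e6]
  nlinarith

open Matrix in
lemma Matrix.PosDef.det_re_pos {A : Matrix (Fin d) (Fin d) ℂ} (hA : A.PosDef) : 0 < A.det.re :=
  (Complex.lt_def.1 hA.det_pos).1

open Matrix in
lemma Matrix.PosDef.ofReal_det_re {A : Matrix (Fin d) (Fin d) ℂ} (hA : A.PosDef) :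
    ((A.det.re : ℝ) : ℂ) = A.det :=
  Complex.ext (by simp) (by simpa using (Complex.lt_def.1 hA.det_pos).2)

open Matrix in
lemma log_det_le_trace_sub {M : Matrix (Fin d) (Fin d) ℂ} (hM : M.PosDef) :
    Real.log M.det.re ≤ M.trace.re - d := by
  rw [hM.isHermitian.det_eq_prod_eigenvalues, hM.isHermitian.trace_eq_sum_eigenvalues]
  have e1 : (∏ i, ((hM.isHermitian.eigenvalues i : ℝ) : ℂ)).re
      = ∏ i, hM.isHermitian.eigenvalues i := by
    rw [← Complex.ofReal_prod, Complex.ofReal_re]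
  have e2 : (∑ i, ((hM.isHermitian.eigenvalues i : ℝ) : ℂ)).re
      = ∑ i, hM.isHermitian.eigenvalues i := by
    rw [← Complex.ofReal_sum, Complex.ofReal_re]
  have e3 : ∑ i : Fin d, (1 : ℝ) = d := by simp
  refine (congrArg Real.log e1).le.trans (le_trans ?_ (congrArg (· - (d : ℝ)) e2).ge)
  rw [Real.log_prod fun i _ => (hM.eigenvalues_pos i).ne', ← e3, ← Finset.sum_sub_distrib]
  exact Finset.sum_le_sum fun i _ => Real.log_le_sub_one_of_pos (hM.eigenvalues_pos i)

open Matrix in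
/-- Concavity of `log det`, in the form of the tangent inequality at `A`. -/
lemma log_det_le_add_trace {A B : Matrix (Fin d) (Fin d) ℂ} (hA : A.PosDef) (hB : B.PosDef) :
    Real.log B.det.re ≤ Real.log A.det.re + (trace (A⁻¹ * B)).re - d := by
  set S := invSqrt A
  have hS : Sᴴ = S := invSqrt_isHermitian A
  have hM : (S * B * S).PosDef := by
    have := hB.conjTranspose_mul_mul_same (B := S)
      ((Matrix.mulVec_injective_iff_isUnit).2 (isUnit_invSqrt hA))
    rwa [hS] at this
  have h := log_det_le_trace_sub hM
  have e1 : trace (S * B * S) = trace (A⁻¹ * B) := by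
    rw [trace_mul_comm, ← mul_assoc, invSqrt_mul_self hA]
  have e2 : A.det.re * (S * B * S).det.re = B.det.re := by
    have : A.det * (S * B * S).det = B.det := by
      rw [det_mul, det_mul, mul_right_comm, ← det_mul S S, invSqrt_mul_self hA, ← mul_assoc,
        ← det_mul, mul_nonsing_inv _ ((Matrix.isUnit_iff_isUnit_det _).1 hA.isUnit), det_one, one_mul]
    rw [← PosDef.ofReal_det_re hA, ← PosDef.ofReal_det_re hM, ← PosDef.ofReal_det_re hB] at this
    exact_mod_cast this
  rw [e1] at h
  rw [← e2, Real.log_mul (PosDef.det_re_pos hA).ne' (PosDef.det_re_pos hM).ne']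
  linarith

end

/-! ### Circle averages and Wirtinger derivatives -/

section

/-- The real linear map `v ↦ P v + Q v̄`; a function with this derivative has the Wirtinger
derivatives `∂F/∂z = P` and `∂F/∂z̄ = Q`. -/
noncomputable def wirtinger (P Q : ℂ) : ℂ →L[ℝ] ℂ :=
  ContinuousLinearMap.mul ℝ ℂ P + (ContinuousLinearMap.mul ℝ ℂ Q).comp
    (Complex.conjCLE : ℂ →L[ℝ] ℂ)

@[simp] lemma wirtinger_apply (P Q v : ℂ) :
    wirtinger P Q v = P * v + Q * (starRingEnd ℂ) v := rfl

lemma circleMap_zero_eq_mul (s θ : ℝ) : circleMap 0 s θ = s * circleMap 0 1 θ := by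
  simp [circleMap]

lemma circleMap_mem_ball_one {s : ℝ} (hs0 : 0 ≤ s) (hs : s < 1) (θ : ℝ) :
    circleMap 0 s θ ∈ ball (0 : ℂ) 1 := by
  simp [abs_of_nonneg hs0, hs]

lemma continuous_comp_circleMap {E : Type*} [TopologicalSpace E] {G : ℂ → E}
    (hG : ContinuousOn G (ball 0 1)) {s : ℝ} (hs0 : 0 ≤ s) (hs : s < 1) :
    Continuous fun θ => G (circleMap 0 s θ) :=
  hG.comp_continuous (continuous_circleMap 0 s) fun θ => circleMap_mem_ball_one hs0 hs θ

lemma circleIntegrable_of_continuousOn_ball {E : Type*} [NormedAddCommGroup E] {G : ℂ → E}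
    (hG : ContinuousOn G (ball 0 1)) {s : ℝ} (hs0 : 0 ≤ s) (hs : s < 1) :
    CircleIntegrable G 0 s :=
  (continuous_comp_circleMap hG hs0 hs).intervalIntegrable _ _

lemma continuousOn_circleAverage {f : ℂ → ℝ} (hf : ContinuousOn f (ball 0 1)) {R : ℝ}
    (hR : R < 1) : ContinuousOn (circleAverage f 0) (Set.Icc 0 R) :=
  ContinuousOn.circleAverage (hf.mono fun z hz => by
    simp only [sub_zero, Set.mem_Icc] at hz
    rw [mem_ball_zero_iff]; exact hz.2.trans_lt hR) fun r hr => hr.1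

/-- The tangential derivative integrates to zero over a circle. -/
lemma circleAverage_mul_eq_circleAverage_conj_mul {F P Q : ℂ → ℂ}
    (hF : ∀ z ∈ ball (0 : ℂ) 1, HasFDerivAt F (wirtinger (P z) (Q z)) z)
    (hP : ContinuousOn P (ball 0 1)) (hQ : ContinuousOn Q (ball 0 1))
    {s : ℝ} (hs0 : 0 ≤ s) (hs : s < 1) :
    circleAverage (fun z => z * P z) 0 s = circleAverage (fun z => (starRingEnd ℂ) z * Q z) 0 s := by
  have hc1 : ContinuousOn (fun z => z * P z) (ball 0 1) := by fun_prop
  have hc2 : ContinuousOn (fun z => (starRingEnd ℂ) z * Q z) (ball 0 1) :=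
    Complex.continuous_conj.continuousOn.mul hQ
  have hd : ∀ θ : ℝ, HasDerivAt (fun θ : ℝ => F (circleMap 0 s θ))
      (Complex.I * (circleMap 0 s θ * P (circleMap 0 s θ)
        - (starRingEnd ℂ) (circleMap 0 s θ) * Q (circleMap 0 s θ))) θ := fun θ => by
    have h := (hF _ (circleMap_mem_ball_one hs0 hs θ)).comp_hasDerivAt θ (hasDerivAt_circleMap 0 s θ)
    refine h.congr_deriv ?_
    simp only [wirtinger_apply, map_mul, Complex.conj_I]
    ring
  have h0 := intervalIntegral.integral_eq_sub_of_hasDerivAt (a := 0) (b := 2 * π)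
    (fun θ _ => hd θ) (Continuous.intervalIntegrable (continuous_const.mul
      ((continuous_comp_circleMap hc1 hs0 hs).sub (continuous_comp_circleMap hc2 hs0 hs))) _ _)
  have hper : circleMap 0 s (2 * π) = circleMap 0 s 0 := (periodic_circleMap 0 s).eq
  rw [hper, sub_self, intervalIntegral.integral_const_mul] at h0
  have h1 := (mul_eq_zero.1 h0).resolve_left Complex.I_ne_zero
  rw [intervalIntegral.integral_sub (circleIntegrable_of_continuousOn_ball hc1 hs0 hs)
    (circleIntegrable_of_continuousOn_ball hc2 hs0 hs), sub_eq_zero] at h1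
  rw [circleAverage_def, circleAverage_def, h1]

/-- Integrating the radial derivative and removing the tangential one expresses the deviation of
the circle averages from the value at the centre through `∂F/∂z̄`. -/
lemma circleAverage_sub_eq_integral_conj_mul {F P Q : ℂ → ℂ}
    (hF : ∀ z ∈ ball (0 : ℂ) 1, HasFDerivAt F (wirtinger (P z) (Q z)) z)
    (hP : ContinuousOn P (ball 0 1)) (hQ : ContinuousOn Q (ball 0 1))
    {R : ℝ} (hR0 : 0 ≤ R) (hR : R < 1) :
    circleAverage F 0 R - F 0 =
      ∫ s in 0..R, ((2 / s : ℝ) : ℂ) * circleAverage (fun z => (starRingEnd ℂ) z * Q z) 0 s := by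
  set D : ℝ → ℝ → ℂ := fun s θ => P (circleMap 0 s θ) * circleMap 0 1 θ +
    Q (circleMap 0 s θ) * (starRingEnd ℂ) (circleMap 0 1 θ) with hD
  have hFc : ContinuousOn F (ball 0 1) := fun z hz => (hF z hz).continuousAt.continuousWithinAt
  have hcont : ContinuousOn (Function.uncurry D) (Set.Icc 0 R ×ˢ Set.univ) := by
    have hmap : Set.MapsTo (fun p : ℝ × ℝ => circleMap 0 p.1 p.2) (Set.Icc 0 R ×ˢ Set.univ)
        (ball (0 : ℂ) 1) := fun p hp =>
      circleMap_mem_ball_one hp.1.1 (hp.1.2.trans_lt hR) _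
    have hcm : ContinuousOn (fun p : ℝ × ℝ => circleMap 0 p.1 p.2)
        (Set.Icc 0 R ×ˢ Set.univ) := by fun_prop
    have he : Continuous fun p : ℝ × ℝ => circleMap 0 1 p.2 :=
      (continuous_circleMap 0 1).comp continuous_snd
    exact ((hP.comp hcm hmap).mul he.continuousOn).add
      ((hQ.comp hcm hmap).mul (Complex.continuous_conj.comp he).continuousOn)
  have hrad : ∀ θ, F (circleMap 0 R θ) - F 0 = ∫ s in 0..R, D s θ := fun θ => by
    have hd : ∀ s ∈ Set.uIcc 0 R, HasDerivAt (fun s : ℝ => F (circleMap 0 s θ)) (D s θ) s := by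
      intro s hs
      rw [Set.uIcc_of_le hR0] at hs
      have hl : HasDerivAt (fun s : ℝ => circleMap 0 s θ) (circleMap 0 1 θ) s := by
        have h := (Complex.ofRealCLM.hasDerivAt (x := s)).mul_const (circleMap 0 1 θ)
        rw [show (fun s : ℝ => circleMap 0 s θ) = fun s : ℝ => Complex.ofRealCLM s * circleMap 0 1 θ
          from funext fun s => circleMap_zero_eq_mul s θ]
        simpa using h
      exact (hF _ (circleMap_mem_ball_one hs.1 (hs.2.trans_lt hR) θ)).comp_hasDerivAt s hl
    have hi : IntervalIntegrable (fun s => D s θ) volume 0 R := by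
      apply ContinuousOn.intervalIntegrable
      rw [Set.uIcc_of_le hR0]
      exact hcont.comp (f := fun s : ℝ => (s, θ)) (by fun_prop) fun s hs => ⟨hs, trivial⟩
    rw [intervalIntegral.integral_eq_sub_of_hasDerivAt hd hi]
    simp
  have hswap : ∫ θ in 0..2 * π, ∫ s in 0..R, D s θ = ∫ s in 0..R, ∫ θ in 0..2 * π, D s θ := by
    refine (intervalIntegral_intervalIntegral_swap (F := D) ?_).symm
    have hk : IntegrableOn (Function.uncurry D) (Set.Icc 0 R ×ˢ Set.Icc 0 (2 * π)) :=
      (hcont.mono (Set.prod_mono le_rfl (Set.subset_univ _))).integrableOn_compact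
        (isCompact_Icc.prod isCompact_Icc)
    refine hk.mono_set (Set.prod_mono ?_ ?_)
    · rw [Set.uIoc_of_le hR0]; exact Set.Ioc_subset_Icc_self
    · rw [Set.uIoc_of_le two_pi_pos.le]; exact Set.Ioc_subset_Icc_self
  have hinner : ∀ s ∈ Set.Ioc 0 R, (2 * π)⁻¹ • ∫ θ in 0..2 * π, D s θ =
      ((2 / s : ℝ) : ℂ) * circleAverage (fun z => (starRingEnd ℂ) z * Q z) 0 s := by
    intro s hs
    have hs1 : s < 1 := hs.2.trans_lt hR
    have hs0 : (s : ℂ) ≠ 0 := by exact_mod_cast hs.1.ne'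
    have hc1 : ContinuousOn (fun z => z * P z) (ball 0 1) := by fun_prop
    have hc2 : ContinuousOn (fun z => (starRingEnd ℂ) z * Q z) (ball 0 1) :=
      Complex.continuous_conj.continuousOn.mul hQ
    have e1 : (fun θ => D s θ) = fun θ => (s : ℂ)⁻¹ * (circleMap 0 s θ * P (circleMap 0 s θ) +
        (starRingEnd ℂ) (circleMap 0 s θ) * Q (circleMap 0 s θ)) := by
      funext θ
      simp only [hD, circleMap_zero_eq_mul s θ, map_mul, Complex.conj_ofReal]
      field_simp
    have e2 := circleAverage_mul_eq_circleAverage_conj_mul hF hP hQ hs.1.le hs1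
    rw [e1, intervalIntegral.integral_const_mul, intervalIntegral.integral_add
      (circleIntegrable_of_continuousOn_ball hc1 hs.1.le hs1)
      (circleIntegrable_of_continuousOn_ball hc2 hs.1.le hs1), ← mul_smul_comm, smul_add]
    simp only [circleAverage_def] at e2 ⊢
    rw [e2]
    push_cast
    ring
  have hL : circleAverage F 0 R - F 0 = (2 * π)⁻¹ • ∫ θ in 0..2 * π, (F (circleMap 0 R θ) - F 0) := by
    have : circleAverage (fun z => F z - F 0) 0 R = circleAverage F 0 R - F 0 := by
      rw [circleAverage_fun_sub (circleIntegrable_of_continuousOn_ball hFc hR0 hR)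
        (circleIntegrable_const _ _ _), circleAverage_const]
    rw [← this, circleAverage_def]
  rw [hL]
  simp_rw [hrad]
  rw [hswap, ← intervalIntegral.integral_smul]
  refine intervalIntegral.integral_congr_ae (Eventually.of_forall fun s hs => ?_)
  rw [Set.uIoc_of_le hR0] at hs
  exact hinner s hs

lemma circleAverage_ofReal (f : ℂ → ℝ) (s : ℝ) :
    circleAverage (fun z => (f z : ℂ)) 0 s = (circleAverage f 0 s : ℝ) := by
  rw [circleAverage_def, circleAverage_def, intervalIntegral.integral_ofReal]
  simp

lemma circleAverage_conj (f : ℂ → ℂ) (s : ℝ) :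
    circleAverage (fun z => (starRingEnd ℂ) (f z)) 0 s = (starRingEnd ℂ) (circleAverage f 0 s) := by
  rw [circleAverage_def, circleAverage_def, intervalIntegral.intervalIntegral_eq_integral_uIoc,
    intervalIntegral.intervalIntegral_eq_integral_uIoc, integral_conj]
  simp only [Complex.real_smul, map_mul, Complex.conj_ofReal]

lemma circleAverage_nonneg_of_ae {E : Type*} [NormedAddCommGroup E] [NormedSpace ℝ E]
    [PartialOrder E] [IsOrderedAddMonoid E] [IsOrderedModule ℝ E] [ClosedIciTopology E]
    {f : ℂ → E} {c : ℂ} {R : ℝ} (h : ∀ᵐ θ : ℝ, 0 ≤ f (circleMap c R θ)) :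
    0 ≤ circleAverage f c R := by
  rw [circleAverage_def, intervalIntegral.integral_of_le two_pi_pos.le]
  exact smul_nonneg (by positivity) (integral_nonneg_of_ae (ae_restrict_of_ae h))

lemma circleAverage_mono_of_ae {E : Type*} [NormedAddCommGroup E] [NormedSpace ℝ E]
    [PartialOrder E] [IsOrderedAddMonoid E] [IsOrderedModule ℝ E] [ClosedIciTopology E]
    {f g : ℂ → E} {c : ℂ} {R : ℝ} (hf : CircleIntegrable f c R) (hg : CircleIntegrable g c R)
    (h : ∀ᵐ θ : ℝ, f (circleMap c R θ) ≤ g (circleMap c R θ)) :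
    circleAverage f c R ≤ circleAverage g c R := by
  rw [← sub_nonneg, ← circleAverage_fun_sub hg hf]
  exact circleAverage_nonneg_of_ae (h.mono fun θ hθ => sub_nonneg.2 hθ)

end

/-! ### Green's formula for `log det` -/

section

variable {d : ℕ}

open Matrix in
/-- Jacobi's formula at an invertible matrix. -/
lemma hasFDerivAt_det {A : Matrix (Fin d) (Fin d) ℂ} (hA : IsUnit A.det) :
    HasFDerivAt (fun M : Matrix (Fin d) (Fin d) ℂ => M.det)
      (LinearMap.toContinuousLinearMap
        (A.det • (traceLinearMap (Fin d) ℂ ℂ).comp (LinearMap.mulLeft ℂ A⁻¹))) A := by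
  have hent : ∀ i j, DifferentiableAt ℂ (fun M : Matrix (Fin d) (Fin d) ℂ => M i j) A := fun i j =>
    (LinearMap.toContinuousLinearMap (entryLinearMap ℂ ℂ i j)).differentiableAt
  have hdiff : DifferentiableAt ℂ (fun M : Matrix (Fin d) (Fin d) ℂ => M.det) A := by
    simp only [det_apply]
    refine DifferentiableAt.fun_sum fun σ _ => ?_
    refine DifferentiableAt.const_smul (c := (Equiv.Perm.sign σ)) ?_
    exact (HasFDerivAt.finsetProd (u := Finset.univ)
      (g := fun i (M : Matrix (Fin d) (Fin d) ℂ) => M (σ i) i)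
      fun i _ => (hent (σ i) i).hasFDerivAt).differentiableAt
  refine hdiff.hasFDerivAt.congr_fderiv (ContinuousLinearMap.ext fun B => ?_)
  have h1 : HasDerivAt (fun t : ℂ => (A + t • B).det)
      (fderiv ℂ (fun M : Matrix (Fin d) (Fin d) ℂ => M.det) A B) 0 :=
    hdiff.hasFDerivAt.hasLineDerivAt B
  have h2 : HasDerivAt (fun t : ℂ => (A + t • B).det) (A.det * trace (A⁻¹ * B)) 0 := by
    set p := (det (1 + (Polynomial.X : Polynomial ℂ) • (A⁻¹ * B).map Polynomial.C)).divX.divX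
    have e : (fun t : ℂ => (A + t • B).det) =
        fun t => A.det * (1 + trace (A⁻¹ * B) * t + p.eval t * t ^ 2) := by
      funext t
      rw [← det_one_add_smul, ← det_mul, mul_add, mul_one, Matrix.mul_smul, ← mul_assoc,
        mul_nonsing_inv _ hA, one_mul]
    rw [e]
    have h := ((((hasDerivAt_id (0 : ℂ)).const_mul (trace (A⁻¹ * B))).const_add 1).add
      ((p.hasDerivAt 0).mul ((hasDerivAt_id (0 : ℂ)).pow 2))).const_mul A.det
    refine h.congr_deriv ?_
    simp
  rw [h1.unique h2]
  simp

/-- A holomorphic matrix function on the unit disk with positive definite (twice the) real part. -/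
structure IsDiscPositive (H : ℂ → Matrix (Fin d) (Fin d) ℂ) : Prop where
  differentiableOn : DifferentiableOn ℂ H (ball 0 1)
  posDef : ∀ z ∈ ball (0 : ℂ) 1, (H z + (H z).conjTranspose).PosDef

/-- Twice the real part of a matrix function. -/
def twoRe (H : ℂ → Matrix (Fin d) (Fin d) ℂ) (z : ℂ) : Matrix (Fin d) (Fin d) ℂ :=
  H z + (H z).conjTranspose

/-- The function `log det (H + H*)`. -/
noncomputable def logDetRe (H : ℂ → Matrix (Fin d) (Fin d) ℂ) (z : ℂ) : ℝ :=
  Real.log (twoRe H z).det.re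

/-- The energy density `4 tr (V⁻¹ H' V⁻¹ H'*)` with `V = H + H*`, equal to `-Δ log det V`. -/
noncomputable def energy (H : ℂ → Matrix (Fin d) (Fin d) ℂ) (z : ℂ) : ℝ :=
  4 * invForm (twoRe H z) (deriv H z)

open Matrix in
lemma ofReal_invForm {A : Matrix (Fin d) (Fin d) ℂ} (hA : A.IsHermitian)
    (B : Matrix (Fin d) (Fin d) ℂ) :
    ((invForm A B : ℝ) : ℂ) = trace (A⁻¹ * B * A⁻¹ * Bᴴ) := by
  apply Complex.conj_eq_iff_re.1
  rw [← Complex.star_def, ← trace_conjTranspose]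
  simp only [conjTranspose_mul, conjTranspose_conjTranspose, hA.inv.eq]
  rw [show B * (A⁻¹ * (Bᴴ * A⁻¹)) = (B * A⁻¹ * Bᴴ) * A⁻¹ by noncomm_ring, trace_mul_comm]
  congr 1; noncomm_ring

open Matrix in
lemma continuous_matrix_trace :
    Continuous fun M : Matrix (Fin d) (Fin d) ℂ => trace M :=
  (LinearMap.toContinuousLinearMap (traceLinearMap (Fin d) ℂ ℂ)).continuous

namespace IsDiscPositive

variable {H : ℂ → Matrix (Fin d) (Fin d) ℂ}

lemma twoRe_posDef (hH : IsDiscPositive H) {z : ℂ} (hz : z ∈ ball (0 : ℂ) 1) :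
    (twoRe H z).PosDef := hH.posDef z hz

lemma hasDerivAt (hH : IsDiscPositive H) {z : ℂ} (hz : z ∈ ball (0 : ℂ) 1) :
    HasDerivAt H (deriv H z) z :=
  (hH.differentiableOn.differentiableAt (isOpen_ball.mem_nhds hz)).hasDerivAt

lemma differentiableOn_deriv (hH : IsDiscPositive H) :
    DifferentiableOn ℂ (deriv H) (ball 0 1) := hH.differentiableOn.deriv isOpen_ball

open Matrix in
lemma hasFDerivAt_twoRe (hH : IsDiscPositive H) {z : ℂ} (hz : z ∈ ball (0 : ℂ) 1) :
    ∃ V' : ℂ →L[ℝ] Matrix (Fin d) (Fin d) ℂ, HasFDerivAt (twoRe H) V' z ∧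
      ∀ v, V' v = v • deriv H z + (v • deriv H z)ᴴ := by
  have h := (hH.hasDerivAt hz).hasFDerivAt.restrictScalars ℝ
  refine ⟨_, h.add h.star, fun v => ?_⟩
  simp [star_eq_conjTranspose]

lemma continuousOn_twoRe (hH : IsDiscPositive H) : ContinuousOn (twoRe H) (ball 0 1) := by
  intro z hz
  obtain ⟨V', h, -⟩ := hH.hasFDerivAt_twoRe hz
  exact h.continuousAt.continuousWithinAt

lemma isUnit_twoRe (hH : IsDiscPositive H) {z : ℂ} (hz : z ∈ ball (0 : ℂ) 1) :
    IsUnit (twoRe H z) := (hH.twoRe_posDef hz).isUnit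

open Matrix in
lemma hasFDerivAt_inv_twoRe (hH : IsDiscPositive H) {z : ℂ} (hz : z ∈ ball (0 : ℂ) 1) :
    ∃ V' : ℂ →L[ℝ] Matrix (Fin d) (Fin d) ℂ, HasFDerivAt (fun z => (twoRe H z)⁻¹) V' z ∧
      ∀ v, V' v = -((twoRe H z)⁻¹ * (v • deriv H z + (v • deriv H z)ᴴ) * (twoRe H z)⁻¹) := by
  obtain ⟨V', h, hv⟩ := hH.hasFDerivAt_twoRe hz
  obtain ⟨u, hu⟩ := hH.isUnit_twoRe hz
  have hi := hasFDerivAt_ringInverse (𝕜 := ℝ) u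
  rw [hu] at hi
  have e : (fun z => (twoRe H z)⁻¹) = Ring.inverse ∘ twoRe H := by
    funext z; simp [nonsing_inv_eq_ringInverse]
  have eu : (↑u⁻¹ : Matrix (Fin d) (Fin d) ℂ) = (twoRe H z)⁻¹ := by
    rw [nonsing_inv_eq_ringInverse, ← hu, Ring.inverse_unit]
  rw [e]
  refine ⟨_, hi.comp z h, fun v => ?_⟩
  simp [eu, hv]

lemma continuousOn_inv_twoRe (hH : IsDiscPositive H) :
    ContinuousOn (fun z => (twoRe H z)⁻¹) (ball 0 1) := by
  intro z hz
  obtain ⟨V', h, -⟩ := hH.hasFDerivAt_inv_twoRe hz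
  exact h.continuousAt.continuousWithinAt

open Matrix in
lemma continuousOn_trace_inv_mul (hH : IsDiscPositive H) :
    ContinuousOn (fun z => trace ((twoRe H z)⁻¹ * deriv H z)) (ball 0 1) :=
  continuous_matrix_trace.comp_continuousOn
    (hH.continuousOn_inv_twoRe.mul hH.differentiableOn_deriv.continuousOn)

open Matrix in
lemma continuousOn_energy (hH : IsDiscPositive H) : ContinuousOn (energy H) (ball 0 1) := by
  have h1 := hH.continuousOn_inv_twoRe
  have h2 := hH.differentiableOn_deriv.continuousOn
  exact continuousOn_const.mul (Complex.continuous_re.comp_continuousOn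
    (continuous_matrix_trace.comp_continuousOn (((h1.mul h2).mul h1).mul h2.star)))

lemma energy_nonneg (hH : IsDiscPositive H) {z : ℂ} (hz : z ∈ ball (0 : ℂ) 1) : 0 ≤ energy H z :=
  mul_nonneg (by norm_num) (invForm_nonneg (hH.twoRe_posDef hz) _)

open Matrix in
/-- `∂/∂z log det V = tr (V⁻¹ H')`. -/
lemma hasFDerivAt_logDetRe (hH : IsDiscPositive H) {z : ℂ} (hz : z ∈ ball (0 : ℂ) 1) :
    HasFDerivAt (fun z => (logDetRe H z : ℂ))
      (wirtinger (trace ((twoRe H z)⁻¹ * deriv H z))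
        ((starRingEnd ℂ) (trace ((twoRe H z)⁻¹ * deriv H z)))) z := by
  have hp := hH.twoRe_posDef hz
  obtain ⟨V', h, hv⟩ := hH.hasFDerivAt_twoRe hz
  have hdet := ((hasFDerivAt_det ((isUnit_iff_isUnit_det _).1 hp.isUnit)).restrictScalars ℝ).comp z h
  have hre := (Complex.reCLM.hasFDerivAt.comp z hdet).log hp.det_re_pos.ne'
  have hc := Complex.ofRealCLM.hasFDerivAt.comp z hre
  refine hc.congr_fderiv (ContinuousLinearMap.ext fun v => ?_)
  set A := twoRe H z
  set B := deriv H z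
  have hAinv : (A⁻¹)ᴴ = A⁻¹ := hp.isHermitian.inv
  have ht : trace (A⁻¹ * (v • B + (v • B)ᴴ)) = trace (A⁻¹ * B) * v +
      (starRingEnd ℂ) (trace (A⁻¹ * B)) * (starRingEnd ℂ) v := by
    have e2 : trace (A⁻¹ * Bᴴ) = (starRingEnd ℂ) (trace (A⁻¹ * B)) := by
      rw [← Complex.star_def, ← trace_conjTranspose, conjTranspose_mul, hAinv, trace_mul_comm]
    rw [mul_add, trace_add, Matrix.mul_smul, trace_smul, conjTranspose_smul, Matrix.mul_smul, trace_smul, e2]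
    simp only [smul_eq_mul, Complex.star_def]
    ring
  have hreal : ((trace (A⁻¹ * B) * v + (starRingEnd ℂ) (trace (A⁻¹ * B)) * (starRingEnd ℂ) v).re : ℂ)
      = trace (A⁻¹ * B) * v + (starRingEnd ℂ) (trace (A⁻¹ * B)) * (starRingEnd ℂ) v := by
    rw [← map_mul, Complex.add_conj, Complex.ofReal_re]
  have hd0 : (A.det : ℂ) ≠ 0 := hp.det_pos.ne'
  simp only [ContinuousLinearMap.comp_apply, _root_.smul_apply, hv,
    ContinuousLinearMap.coe_restrictScalars', LinearMap.coe_toContinuousLinearMap',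
    LinearMap.smul_apply, LinearMap.comp_apply, LinearMap.mulLeft_apply, traceLinearMap_apply,
    Complex.reCLM_apply, Complex.ofRealCLM_apply, wirtinger_apply, smul_eq_mul, Function.comp]
  rw [ht, ← hp.ofReal_det_re, Complex.ofReal_re, Complex.re_ofReal_mul, ← mul_assoc,
    inv_mul_cancel₀ hp.det_re_pos.ne', one_mul, hreal]

lemma continuousOn_logDetRe (hH : IsDiscPositive H) : ContinuousOn (logDetRe H) (ball 0 1) := by
  intro z hz
  have h := Complex.continuous_re.continuousAt.comp (hH.hasFDerivAt_logDetRe hz).continuousAt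
  exact h.continuousWithinAt

open Matrix in
/-- The second Wirtinger derivative: `∂/∂z̄ (z tr (V⁻¹ H')) = - z energy / 4`. -/
lemma hasFDerivAt_mul_trace (hH : IsDiscPositive H) {z : ℂ} (hz : z ∈ ball (0 : ℂ) 1) :
    HasFDerivAt (fun z => z * trace ((twoRe H z)⁻¹ * deriv H z))
      (wirtinger (trace ((twoRe H z)⁻¹ * deriv H z) + z * (trace ((twoRe H z)⁻¹ * deriv (deriv H) z)
        - trace ((twoRe H z)⁻¹ * deriv H z * (twoRe H z)⁻¹ * deriv H z)))
        (-z * ((energy H z / 4 : ℝ) : ℂ))) z := by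
  have hp := hH.twoRe_posDef hz
  obtain ⟨V', h, hv⟩ := hH.hasFDerivAt_inv_twoRe hz
  have hH2 := ((hH.differentiableOn_deriv.differentiableAt
    (isOpen_ball.mem_nhds hz)).hasDerivAt.hasFDerivAt).restrictScalars ℝ
  have ht := ((LinearMap.toContinuousLinearMap
    (traceLinearMap (Fin d) ℂ ℂ)).restrictScalars ℝ).hasFDerivAt.comp z (h.mul' hH2)
  have hc := (hasFDerivAt_id z).mul ht
  refine hc.congr_fderiv (ContinuousLinearMap.ext fun v => ?_)
  have he : energy H z / 4 = invForm (twoRe H z) (deriv H z) := by rw [energy]; ring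
  rw [he, ofReal_invForm hp.isHermitian]
  set A := twoRe H z
  set B := deriv H z
  have e1 : trace (A⁻¹ * Bᴴ * A⁻¹ * B) = trace (A⁻¹ * B * A⁻¹ * Bᴴ) := by
    rw [show A⁻¹ * Bᴴ * A⁻¹ * B = (A⁻¹ * Bᴴ) * (A⁻¹ * B) by noncomm_ring, trace_mul_comm]
    congr 1; noncomm_ring
  rw [← e1]
  simp [hv, mul_add, add_mul, trace_add, trace_neg, trace_smul, conjTranspose_smul, mul_assoc]
  ring

/-- Continuity of the derivative `∂/∂z` that occurs in `hasFDerivAt_mul_trace`. -/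
lemma continuousOn_second (hH : IsDiscPositive H) : ContinuousOn (fun z =>
    Matrix.trace ((twoRe H z)⁻¹ * deriv H z) + z * (Matrix.trace ((twoRe H z)⁻¹ * deriv (deriv H) z)
        - Matrix.trace ((twoRe H z)⁻¹ * deriv H z * (twoRe H z)⁻¹ * deriv H z))) (ball 0 1) := by
  have h1 := hH.continuousOn_inv_twoRe
  have h2 := hH.differentiableOn_deriv.continuousOn
  have h3 := (hH.differentiableOn_deriv.deriv isOpen_ball).continuousOn
  have ht := continuous_matrix_trace (d := d)
  exact (hH.continuousOn_trace_inv_mul).add (continuousOn_id.mul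
    ((ht.comp_continuousOn (h1.mul h3)).sub (ht.comp_continuousOn (((h1.mul h2).mul h1).mul h2))))

/-- **Green's formula** for `log det V`: the gap between the value at the centre and the average
over a circle is the logarithmic potential of the energy density, written as an iterated integral. -/
lemma logDetRe_sub_circleAverage (hH : IsDiscPositive H) {R : ℝ} (hR0 : 0 ≤ R) (hR : R < 1) :
    logDetRe H 0 - circleAverage (logDetRe H) 0 R =
      ∫ ρ in 0..R, (∫ s in 0..ρ, s * circleAverage (energy H) 0 s) / ρ := by
  have hq : ∀ ρ, 0 ≤ ρ → ρ < 1 →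
      circleAverage (fun z => z * Matrix.trace ((twoRe H z)⁻¹ * deriv H z)) 0 ρ =
        ((-(1 / 2) * ∫ s in 0..ρ, s * circleAverage (energy H) 0 s : ℝ) : ℂ) := by
    intro ρ h0 h1
    have h := circleAverage_sub_eq_integral_conj_mul (fun z hz => hH.hasFDerivAt_mul_trace hz)
      hH.continuousOn_second (continuousOn_id.neg.mul
        (Complex.continuous_ofReal.comp_continuousOn (hH.continuousOn_energy.div_const 4))) h0 h1
    rw [zero_mul, sub_zero] at h
    rw [h, ← intervalIntegral.integral_const_mul, ← intervalIntegral.integral_ofReal]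
    refine intervalIntegral.integral_congr fun s _ => ?_
    rcases eq_or_ne s 0 with rfl | hs
    · simp
    have e : circleAverage (fun z => (starRingEnd ℂ) z * (-z * ((energy H z / 4 : ℝ) : ℂ))) 0 s =
        circleAverage (fun z => (((-(s ^ 2) / 4 : ℝ) • energy H z : ℝ) : ℂ)) 0 s := by
      refine circleAverage_congr_sphere fun z hz => ?_
      have hz' : ‖z‖ ^ 2 = s ^ 2 := by
        rw [mem_sphere_zero_iff_norm] at hz; rw [hz, sq_abs]
      have hzz : (starRingEnd ℂ) z * z = ((s ^ 2 : ℝ) : ℂ) := by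
        rw [mul_comm, Complex.mul_conj, Complex.normSq_eq_norm_sq, hz']
      calc _ = -((starRingEnd ℂ) z * z) * ((energy H z / 4 : ℝ) : ℂ) := by ring
        _ = _ := by rw [hzz]; push_cast; simp; ring
    rw [e, circleAverage_ofReal, circleAverage_fun_smul]
    push_cast
    have : (s : ℂ) ≠ 0 := by exact_mod_cast hs
    simp
    field_simp
    norm_num
  have h := circleAverage_sub_eq_integral_conj_mul (fun z hz => hH.hasFDerivAt_logDetRe hz)
    hH.continuousOn_trace_inv_mul
    (Complex.continuous_conj.comp_continuousOn hH.continuousOn_trace_inv_mul) hR0 hR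
  rw [circleAverage_ofReal, ← Complex.ofReal_sub] at h
  have h2 : (∫ s in 0..R, ((2 / s : ℝ) : ℂ) * circleAverage (fun z => (starRingEnd ℂ) z *
      (starRingEnd ℂ) (Matrix.trace ((twoRe H z)⁻¹ * deriv H z))) 0 s) =
      ((-∫ ρ in 0..R, (∫ s in 0..ρ, s * circleAverage (energy H) 0 s) / ρ : ℝ) : ℂ) := by
    rw [← intervalIntegral.integral_neg, ← intervalIntegral.integral_ofReal]
    refine intervalIntegral.integral_congr fun s hs => ?_
    rw [Set.uIcc_of_le hR0] at hs
    simp only [← map_mul]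
    rw [circleAverage_conj, hq s hs.1 (hs.2.trans_lt hR), Complex.conj_ofReal, ← Complex.ofReal_mul]
    congr 1
    ring
  have h3 := Complex.ofReal_injective (h.trans h2)
  linarith

end IsDiscPositive

end

/-! ### Radial integrals -/

section

lemma integral_mul_sq_sub_sq_of_continuous {b : ℝ → ℝ} (hb : Continuous b) (R : ℝ) :
    ∫ s in 0..R, b s * (R ^ 2 - s ^ 2) = ∫ ρ in 0..R, 2 * ρ * ∫ s in 0..ρ, b s := by
  have hn : ∀ ρ, HasDerivAt (fun ρ => ∫ s in 0..ρ, b s) (b ρ) ρ := fun ρ =>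
    hb.integral_hasStrictDerivAt 0 ρ |>.hasDerivAt
  have hk : ∀ ρ : ℝ, HasDerivAt (fun ρ : ℝ => R ^ 2 - ρ ^ 2) (-(2 * ρ)) ρ := fun ρ => by
    simpa using ((hasDerivAt_id ρ).pow 2).const_sub (R ^ 2)
  have h := intervalIntegral.integral_mul_deriv_eq_deriv_mul (a := 0) (b := R)
    (fun ρ _ => hk ρ) (fun ρ _ => hn ρ)
    (Continuous.intervalIntegrable (by fun_prop) _ _) (hb.intervalIntegrable _ _)
  simp only [sub_self, zero_mul, intervalIntegral.integral_same, mul_zero, zero_sub, neg_mul,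
    intervalIntegral.integral_neg, neg_neg] at h
  simpa [mul_comm] using h

lemma integral_mul_sq_sub_sq {b : ℝ → ℝ} {R : ℝ} (hR : 0 ≤ R) (hb : ContinuousOn b (Set.Icc 0 R)) :
    ∫ s in 0..R, b s * (R ^ 2 - s ^ 2) = ∫ ρ in 0..R, 2 * ρ * ∫ s in 0..ρ, b s := by
  have hc : Continuous (Set.IccExtend hR ((Set.Icc 0 R).domRestrict b)) :=
    (continuousOn_iff_continuous_domRestrict.1 hb).Icc_extend'
  have he : ∀ s ∈ Set.Icc 0 R, Set.IccExtend hR ((Set.Icc 0 R).domRestrict b) s = b s := fun s hs => by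
    rw [Set.IccExtend_of_mem _ _ hs]; rfl
  have h := integral_mul_sq_sub_sq_of_continuous hc R
  rw [intervalIntegral.integral_congr (g := fun s => b s * (R ^ 2 - s ^ 2))] at h
  · rw [h]
    refine intervalIntegral.integral_congr fun ρ hρ => ?_
    rw [Set.uIcc_of_le hR] at hρ
    congr 1
    refine intervalIntegral.integral_congr fun s hs => ?_
    rw [Set.uIcc_of_le hρ.1] at hs
    exact he s ⟨hs.1, hs.2.trans hρ.2⟩
  · intro s hs
    rw [Set.uIcc_of_le hR] at hs
    simp only [he s hs]

section Radial

variable {a : ℝ → ℝ} {R : ℝ}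

lemma continuousOn_mul_Icc (ha : ContinuousOn a (Set.Icc 0 R)) :
    ContinuousOn (fun s => s * a s) (Set.Icc 0 R) := continuousOn_id.mul ha

lemma integral_mul_nonneg (ha0 : ∀ s ∈ Set.Icc 0 R, 0 ≤ a s) {ρ : ℝ} (hρ : ρ ∈ Set.Icc 0 R) :
    0 ≤ ∫ s in 0..ρ, s * a s :=
  intervalIntegral.integral_nonneg hρ.1 fun s hs =>
    mul_nonneg hs.1 (ha0 s ⟨hs.1, hs.2.trans hρ.2⟩)

lemma intervalIntegrable_mul_of_mem (ha : ContinuousOn a (Set.Icc 0 R)) {ρ : ℝ}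
    (hρ : ρ ∈ Set.Icc 0 R) : IntervalIntegrable (fun s => s * a s) volume 0 ρ := by
  apply ContinuousOn.intervalIntegrable
  rw [Set.uIcc_of_le hρ.1]
  exact (continuousOn_mul_Icc ha).mono (Set.Icc_subset_Icc_right hρ.2)

lemma integral_mul_le_of_le (ha : ContinuousOn a (Set.Icc 0 R)) {ρ M : ℝ} (hρ : ρ ∈ Set.Icc 0 R)
    (hM : ∀ s ∈ Set.Icc 0 ρ, a s ≤ M) : ∫ s in 0..ρ, s * a s ≤ M / 2 * ρ ^ 2 := by
  calc ∫ s in 0..ρ, s * a s ≤ ∫ s in 0..ρ, s * M :=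
        intervalIntegral.integral_mono_on hρ.1 (intervalIntegrable_mul_of_mem ha hρ)
          (Continuous.intervalIntegrable (by fun_prop) _ _)
          fun s hs => mul_le_mul_of_nonneg_left (hM s hs) hs.1
    _ = M / 2 * ρ ^ 2 := by rw [intervalIntegral.integral_mul_const, integral_id]; ring

lemma continuousOn_primitive_mul (hR : 0 ≤ R) (ha : ContinuousOn a (Set.Icc 0 R)) :
    ContinuousOn (fun ρ => ∫ s in 0..ρ, s * a s) (Set.Icc 0 R) := by
  have h := intervalIntegral.continuousOn_primitive_interval (μ := volume) (a := 0) (b := R)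
    (f := fun s => s * a s) (by
      rw [Set.uIcc_of_le hR]
      exact (continuousOn_mul_Icc ha).integrableOn_compact isCompact_Icc)
  rwa [Set.uIcc_of_le hR] at h

/-- The radial logarithmic potential has an integrable integrand: near zero the inner integral is
quadratic. -/
lemma intervalIntegrable_primitive_div (hR : 0 ≤ R) (ha : ContinuousOn a (Set.Icc 0 R))
    (ha0 : ∀ s ∈ Set.Icc 0 R, 0 ≤ a s) :
    IntervalIntegrable (fun ρ => (∫ s in 0..ρ, s * a s) / ρ) volume 0 R := by
  obtain ⟨M, hM⟩ := (isCompact_Icc (a := (0 : ℝ)) (b := R)).exists_bound_of_continuousOn ha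
  have hM' : ∀ s ∈ Set.Icc 0 R, a s ≤ M := fun s hs => (le_abs_self _).trans (hM s hs)
  rw [intervalIntegrable_iff_integrableOn_Ioc_of_le hR]
  refine IntegrableOn.of_bound (by simp) ?_ (M / 2 * R) ?_
  · refine ContinuousOn.aestronglyMeasurable ?_ (measurableSet_Ioc)
    exact ((continuousOn_primitive_mul hR ha).mono Set.Ioc_subset_Icc_self).div continuousOn_id
      fun s hs => hs.1.ne'
  · refine (ae_restrict_iff' measurableSet_Ioc).2 (Eventually.of_forall fun ρ hρ => ?_)
    have hρ' : ρ ∈ Set.Icc 0 R := ⟨hρ.1.le, hρ.2⟩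
    have h0 := integral_mul_nonneg ha0 hρ'
    have h1 := integral_mul_le_of_le ha hρ' fun s hs => hM' s ⟨hs.1, hs.2.trans hρ.2⟩
    have hM0 : 0 ≤ M := (ha0 0 ⟨le_rfl, hR⟩).trans (hM' 0 ⟨le_rfl, hR⟩)
    rw [norm_div, Real.norm_of_nonneg h0, Real.norm_of_nonneg hρ.1.le, div_le_iff₀ hρ.1]
    calc _ ≤ M / 2 * ρ ^ 2 := h1
      _ = M / 2 * ρ * ρ := by ring
      _ ≤ M / 2 * R * ρ := by
        have := hρ.1; gcongr; exact hρ.2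

lemma integral_sq_sub_sq_le (hR : 0 ≤ R) (ha : ContinuousOn a (Set.Icc 0 R))
    (ha0 : ∀ s ∈ Set.Icc 0 R, 0 ≤ a s) :
    ∫ s in 0..R, s * a s * (R ^ 2 - s ^ 2) ≤
      2 * R ^ 2 * ∫ ρ in 0..R, (∫ s in 0..ρ, s * a s) / ρ := by
  rw [integral_mul_sq_sub_sq hR (continuousOn_mul_Icc ha), ← intervalIntegral.integral_const_mul]
  refine intervalIntegral.integral_mono_on hR ?_
    ((intervalIntegrable_primitive_div hR ha ha0).const_mul _) fun ρ hρ => ?_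
  · apply ContinuousOn.intervalIntegrable
    rw [Set.uIcc_of_le hR]
    exact ContinuousOn.mul (by fun_prop) (continuousOn_primitive_mul hR ha)
  · rcases hρ.1.eq_or_lt with h | h
    · simp [← h]
    have h0 := integral_mul_nonneg ha0 hρ
    have : 2 * ρ ≤ 2 * R ^ 2 / ρ := by
      rw [le_div_iff₀ h]; nlinarith [hρ.2]
    calc 2 * ρ * ∫ s in 0..ρ, s * a s ≤ 2 * R ^ 2 / ρ * ∫ s in 0..ρ, s * a s := by gcongr
      _ = _ := by ring

/-- The potential is controlled by the integral against `R² - s²` as soon as the values of `a`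
near zero are controlled by those on `[5/8, 3/4]`; this takes care of the singularity of the
logarithm. -/
lemma integral_primitive_div_le (hR : 7 / 8 ≤ R) (ha : ContinuousOn a (Set.Icc 0 R))
    (ha0 : ∀ s ∈ Set.Icc 0 R, 0 ≤ a s) {C : ℝ} (hC : 0 ≤ C)
    (hC' : ∀ s ∈ Set.Icc (0 : ℝ) (1 / 2), ∀ t ∈ Set.Icc (5 / 8 : ℝ) (3 / 4), a s ≤ C * a t) :
    ∫ ρ in 0..R, (∫ s in 0..ρ, s * a s) / ρ ≤
      (4 * C + 2) * ∫ s in 0..R, s * a s * (R ^ 2 - s ^ 2) := by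
  have hR0 : 0 ≤ R := by linarith
  set A := ∫ s in 0..R, s * a s * (R ^ 2 - s ^ 2) with hA
  have hcont : ContinuousOn (fun s => s * a s * (R ^ 2 - s ^ 2)) (Set.Icc 0 R) :=
    (continuousOn_mul_Icc ha).mul (by fun_prop)
  have hii : ∀ x ∈ Set.Icc 0 R, ∀ y ∈ Set.Icc 0 R,
      IntervalIntegrable (fun s => s * a s * (R ^ 2 - s ^ 2)) volume x y := fun x hx y hy =>
    (hcont.mono (Set.uIcc_subset_Icc hx hy)).intervalIntegrable
  have hnn : ∀ s ∈ Set.Icc 0 R, 0 ≤ s * a s * (R ^ 2 - s ^ 2) := fun s hs =>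
    mul_nonneg (mul_nonneg hs.1 (ha0 s hs)) (by nlinarith [hs.1, hs.2])
  have hsmall : ∀ s ∈ Set.Icc (0 : ℝ) (1 / 2), a s ≤ 64 * C * A := by
    intro s hs
    have has : 0 ≤ a s := ha0 s ⟨hs.1, hs.2.trans (by linarith)⟩
    have h1 : ∫ t in (5 / 8 : ℝ)..(3 / 4), a s / 8 ≤
        ∫ t in (5 / 8 : ℝ)..(3 / 4), C * (t * a t * (R ^ 2 - t ^ 2)) := by
      refine intervalIntegral.integral_mono_on (by norm_num)
        (Continuous.intervalIntegrable (by fun_prop) _ _)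
        ((hii _ ⟨by norm_num, by linarith⟩ _ ⟨by norm_num, by linarith⟩).const_mul _) fun t ht => ?_
      have h2 := hC' s hs t ht
      have hat : 0 ≤ a t := ha0 t ⟨by linarith [ht.1], by linarith [ht.2]⟩
      have h3 : 1 / 8 ≤ t * (R ^ 2 - t ^ 2) := by
        have h5 : 13 / 64 ≤ R ^ 2 - t ^ 2 := by nlinarith [ht.1, ht.2]
        nlinarith [ht.1]
      have h4 : 0 ≤ C * a t := mul_nonneg hC hat
      nlinarith
    have h2 : ∫ t in (5 / 8 : ℝ)..(3 / 4), t * a t * (R ^ 2 - t ^ 2) ≤ A := by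
      refine intervalIntegral.integral_mono_interval (by norm_num) (by norm_num) (by linarith)
        ?_ (hii 0 ⟨le_rfl, hR0⟩ R ⟨hR0, le_rfl⟩)
      exact (ae_restrict_iff' measurableSet_Ioc).2
        (Eventually.of_forall fun s hs => hnn s ⟨hs.1.le, hs.2⟩)
    rw [intervalIntegral.integral_const, intervalIntegral.integral_const_mul, smul_eq_mul] at h1
    have h3 := mul_le_mul_of_nonneg_left h2 hC
    linarith
  have hA0 : 0 ≤ A := intervalIntegral.integral_nonneg hR0 hnn
  have hint := intervalIntegrable_primitive_div hR0 ha ha0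
  have hmem : (1 / 2 : ℝ) ∈ Set.uIcc 0 R := by
    rw [Set.uIcc_of_le hR0]; exact ⟨by norm_num, by linarith⟩
  have hi1 := hint.mono_set (Set.uIcc_subset_uIcc_left hmem)
  have hi2 := hint.mono_set (Set.uIcc_subset_uIcc_right hmem)
  rw [← intervalIntegral.integral_add_adjacent_intervals hi1 hi2]
  have near : ∫ ρ in (0 : ℝ)..(1 / 2), (∫ s in 0..ρ, s * a s) / ρ ≤ 4 * C * A := by
    calc _ ≤ ∫ ρ in (0 : ℝ)..(1 / 2), 32 * C * A * ρ := by
          refine intervalIntegral.integral_mono_on (by norm_num) hi1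
            (Continuous.intervalIntegrable (by fun_prop) _ _) fun ρ hρ => ?_
          rcases hρ.1.eq_or_lt with h | h
          · simp [← h]
          have := integral_mul_le_of_le ha (ρ := ρ) (M := 64 * C * A)
            ⟨hρ.1, hρ.2.trans (by linarith)⟩ fun s hs => hsmall s ⟨hs.1, hs.2.trans hρ.2⟩
          rw [div_le_iff₀ h]
          linarith
      _ = 4 * C * A := by
          rw [intervalIntegral.integral_const_mul, integral_id]; ring
  have hprim : ContinuousOn (fun ρ => 2 * ρ * ∫ s in 0..ρ, s * a s) (Set.Icc 0 R) :=
    ContinuousOn.mul (by fun_prop) (continuousOn_primitive_mul hR0 ha)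
  have far : ∫ ρ in (1 / 2 : ℝ)..R, (∫ s in 0..ρ, s * a s) / ρ ≤ 2 * A := by
    calc _ ≤ ∫ ρ in (1 / 2 : ℝ)..R, 2 * (2 * ρ * ∫ s in 0..ρ, s * a s) := by
          refine intervalIntegral.integral_mono_on (by linarith) hi2
            (((hprim.mono (Set.uIcc_subset_Icc ⟨by norm_num, by linarith⟩
              ⟨hR0, le_rfl⟩)).intervalIntegrable).const_mul _) fun ρ hρ => ?_
          have h0 := integral_mul_nonneg ha0 (ρ := ρ) ⟨by linarith [hρ.1], hρ.2⟩
          have hp : 0 < ρ := by linarith [hρ.1]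
          rw [div_le_iff₀ hp]
          have : 1 ≤ 4 * ρ * ρ := by nlinarith [hρ.1]
          nlinarith
      _ = 2 * ∫ ρ in (1 / 2 : ℝ)..R, 2 * ρ * ∫ s in 0..ρ, s * a s :=
          intervalIntegral.integral_const_mul _ _
      _ ≤ 2 * ∫ ρ in (0 : ℝ)..R, 2 * ρ * ∫ s in 0..ρ, s * a s := by
          gcongr
          refine intervalIntegral.integral_mono_interval (by norm_num) (by linarith) le_rfl ?_ ?_
          · exact (ae_restrict_iff' measurableSet_Ioc).2 (Eventually.of_forall fun s hs =>
              mul_nonneg (by linarith [hs.1]) (integral_mul_nonneg ha0 ⟨hs.1.le, hs.2⟩))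
          · exact (hprim.mono (Set.uIcc_subset_Icc ⟨le_rfl, hR0⟩
              ⟨hR0, le_rfl⟩)).intervalIntegrable
      _ = 2 * A := by rw [hA, integral_mul_sq_sub_sq hR0 (continuousOn_mul_Icc ha)]
  linarith

end Radial

end

/-! ### Harnack's inequality and the Jensen gap -/

section

variable {d : ℕ}

lemma circleIntegrable_poissonKernel_smul {E : Type*} [NormedAddCommGroup E] [NormedSpace ℝ E]
    {f : ℂ → E} {R : ℝ} {z : ℂ} (hf : CircleIntegrable f 0 R) (hz : z ∈ ball (0 : ℂ) R) :
    CircleIntegrable (fun ζ => poissonKernel 0 z ζ • f ζ) 0 R := by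
  have h : ContinuousOn (poissonKernel 0 z) (sphere 0 |R|) := by
    rw [poissonKernel_eq_re_herglotzRieszKernel]
    exact Complex.continuous_re.comp_continuousOn (continuousOn_herglotzRieszKernel_sphere hz)
  exact hf.continuousOn_smul h

lemma poissonKernel_le {R : ℝ} {z ζ : ℂ} (hζ : ζ ∈ sphere (0 : ℂ) R) (hz : z ∈ ball (0 : ℂ) R) :
    poissonKernel 0 z ζ ≤ (R + ‖z‖) / (R - ‖z‖) := by
  have h := re_herglotzRieszKernel_le hζ hz
  rw [poissonKernel_eq_re_herglotzRieszKernel]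
  simpa [herglotzRieszKernel_def] using h

lemma le_poissonKernel {R : ℝ} {z ζ : ℂ} (hζ : ζ ∈ sphere (0 : ℂ) R) (hz : z ∈ ball (0 : ℂ) R) :
    (R - ‖z‖) / (R + ‖z‖) ≤ poissonKernel 0 z ζ := by
  have h := le_re_herglotzRieszKernel hζ hz
  rw [poissonKernel_eq_re_herglotzRieszKernel]
  simpa [herglotzRieszKernel_def] using h

namespace IsDiscPositive

variable {H : ℂ → Matrix (Fin d) (Fin d) ℂ}

lemma diffContOnCl (hH : IsDiscPositive H) {R : ℝ} (hR : R < 1) : DiffContOnCl ℂ H (ball 0 R) :=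
  (hH.differentiableOn.mono (closure_ball_subset_closedBall.trans
    (closedBall_subset_ball hR))).diffContOnCl

lemma circleAverage_poissonKernel_smul_twoRe (hH : IsDiscPositive H) {R : ℝ} (hR0 : 0 ≤ R)
    (hR : R < 1) {z : ℂ} (hz : z ∈ ball (0 : ℂ) R) :
    circleAverage (fun ζ => poissonKernel 0 z ζ • twoRe H ζ) 0 R = twoRe H z := by
  have h := (hH.diffContOnCl hR).circleAverage_poissonKernel_smul hz
  set T : Matrix (Fin d) (Fin d) ℂ →L[ℝ] Matrix (Fin d) (Fin d) ℂ :=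
    ContinuousLinearMap.id ℝ _ + (starL' ℝ : Matrix (Fin d) (Fin d) ℂ ≃L[ℝ] _).toContinuousLinearMap
  have hT : ∀ M, T M = M + M.conjTranspose := fun M => rfl
  have hi : CircleIntegrable (poissonKernel 0 z • H) 0 R :=
    circleIntegrable_poissonKernel_smul
      (circleIntegrable_of_continuousOn_ball hH.differentiableOn.continuousOn hR0 hR) hz
  have h2 := T.circleAverage_comp_comm hi
  rw [h, hT] at h2
  rw [twoRe, ← h2]
  congr 1
  funext ζ
  simp only [Function.comp, Pi.smul_apply', hT, twoRe]
  rw [Matrix.conjTranspose_smul, star_trivial, smul_add]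

/-- **Harnack's inequality** for the matrix-valued positive harmonic function `H + H*`. The
constant is `(7 / 8 + 3 / 4) / (7 / 8 - 3 / 4)`, the Poisson kernel bound on the circle of radius
`7 / 8`. -/
lemma harnack (hH : IsDiscPositive H) {z : ℂ} (hz : ‖z‖ ≤ 3 / 4) :
    twoRe H z ≤ ((13 : ℝ) : ℂ) • twoRe H 0 ∧ twoRe H 0 ≤ ((13 : ℝ) : ℂ) • twoRe H z := by
  have hR0 : (0 : ℝ) ≤ 7 / 8 := by norm_num
  have hR : (7 / 8 : ℝ) < 1 := by norm_num
  have hzR : z ∈ ball (0 : ℂ) (7 / 8) := by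
    rw [mem_ball_zero_iff]; exact hz.trans_lt (by norm_num)
  have h0R : (0 : ℂ) ∈ ball (0 : ℂ) (7 / 8) := by simp
  have hV := circleIntegrable_of_continuousOn_ball hH.continuousOn_twoRe hR0 hR
  have ez := hH.circleAverage_poissonKernel_smul_twoRe hR0 hR hzR
  have e0 : circleAverage (twoRe H) 0 (7 / 8) = twoRe H 0 := by
    rw [← hH.circleAverage_poissonKernel_smul_twoRe hR0 hR h0R]
    refine circleAverage_congr_sphere fun ζ hζ => ?_
    have : ζ ≠ 0 := by rintro rfl; norm_num [mem_sphere_zero_iff_norm] at hζ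
    simp [poissonKernel_def, this]
  have hpos : ∀ θ, (0 : Matrix (Fin d) (Fin d) ℂ) ≤ twoRe H (circleMap 0 (7 / 8) θ) := fun θ =>
    (hH.twoRe_posDef (circleMap_mem_ball_one hR0 hR θ)).posSemidef.nonneg
  have hs : ∀ θ, circleMap 0 (7 / 8) θ ∈ sphere (0 : ℂ) (7 / 8) := fun θ =>
    circleMap_mem_sphere 0 hR0 θ
  have hcs : ∀ M : Matrix (Fin d) (Fin d) ℂ, ((13 : ℝ) : ℂ) • M = (13 : ℝ) • M := fun M =>
    Complex.coe_smul _ _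
  constructor
  · rw [hcs, ← ez, ← e0, ← circleAverage_fun_smul]
    refine circleAverage_mono_of_ae (circleIntegrable_poissonKernel_smul hV hzR)
      (hV.continuousOn_smul (g := fun _ => (13 : ℝ)) continuousOn_const) (Eventually.of_forall fun θ => ?_)
    refine smul_le_smul_of_nonneg_right ((poissonKernel_le (hs θ) hzR).trans ?_) (hpos θ)
    rw [div_le_iff₀ (by linarith)]; linarith
  · rw [hcs, ← ez, ← e0, ← circleAverage_fun_smul]
    refine circleAverage_mono_of_ae hV
      ((circleIntegrable_poissonKernel_smul hV hzR).continuousOn_smul (g := fun _ => (13 : ℝ))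
        continuousOn_const)
      (Eventually.of_forall fun θ => ?_)
    rw [smul_smul]
    refine le_trans (le_of_eq (one_smul ℝ _).symm) (smul_le_smul_of_nonneg_right ?_ (hpos θ))
    have h := le_poissonKernel (hs θ) hzR
    have h2 : (1 : ℝ) / 13 ≤ (7 / 8 - ‖z‖) / (7 / 8 + ‖z‖) := by
      rw [div_le_div_iff₀ (by norm_num) (by positivity)]; linarith [norm_nonneg z]
    linarith

/-- The energy density in the middle of the disk is controlled by its circle averages: by Harnack
it is comparable with a sum of squared moduli of holomorphic functions, which are subharmonic. -/
lemma energy_le_circleAverage (hH : IsDiscPositive H) {z : ℂ} (hz : ‖z‖ ≤ 1 / 2) {t : ℝ}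
    (ht : t ∈ Set.Icc (5 / 8 : ℝ) (3 / 4)) :
    energy H z ≤ 10 * 13 ^ 4 * circleAverage (energy H) 0 t := by
  have ht0 : 0 ≤ t := by linarith [ht.1]
  have ht1 : t < 1 := by linarith [ht.2]
  have hzt : z ∈ ball (0 : ℂ) t := by rw [mem_ball_zero_iff]; linarith [ht.1]
  have hz1 : z ∈ ball (0 : ℂ) 1 := by rw [mem_ball_zero_iff]; linarith
  have h0 : (0 : ℂ) ∈ ball (0 : ℂ) 1 := by simp
  have hp0 := hH.twoRe_posDef h0
  set S := invSqrt (twoRe H 0)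
  -- freezing `V` at the origin turns the energy density into a sum of moduli of holomorphic functions
  set f : Fin d → Fin d → ℂ → ℂ := fun i j w => ((S * deriv H w * S) i j) ^ 2 with hf
  have hfd : ∀ i j, DifferentiableOn ℂ (f i j) (ball 0 1) := fun i j => by
    have h1 : DifferentiableOn ℂ (fun w => S * deriv H w * S) (ball 0 1) :=
      (hH.differentiableOn_deriv.const_mul S).mul_const S
    have h2 := (LinearMap.toContinuousLinearMap
      (Matrix.entryLinearMap ℂ ℂ i j)).differentiable.comp_differentiableOn h1
    exact h2.pow 2
  have hfi : ∀ i j, CircleIntegrable (fun w => ‖f i j w‖) 0 t := fun i j =>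
    circleIntegrable_of_continuousOn_ball (hfd i j).continuousOn.norm ht0 ht1
  have hsub : ∀ i j, ‖f i j z‖ ≤ 10 * circleAverage (fun w => ‖f i j w‖) 0 t := fun i j => by
    have hd : DiffContOnCl ℂ (f i j) (ball 0 t) := ((hfd i j).mono
      (closure_ball_subset_closedBall.trans (closedBall_subset_ball ht1))).diffContOnCl
    rw [← hd.circleAverage_poissonKernel_smul hzt, circleAverage_def, norm_smul,
      Real.norm_of_nonneg (by positivity), circleAverage_def, smul_eq_mul, mul_left_comm]
    gcongr
    rw [← intervalIntegral.integral_const_mul]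
    refine intervalIntegral.norm_integral_le_of_norm_le two_pi_pos.le
      (Eventually.of_forall fun θ _ => ?_) ((hfi i j).const_mul 10)
    have hs : circleMap 0 t θ ∈ sphere (0 : ℂ) t := circleMap_mem_sphere 0 ht0 θ
    have hk0 : 0 ≤ poissonKernel 0 z (circleMap 0 t θ) := le_trans
      (div_nonneg (by linarith [ht.1]) (by positivity)) (le_poissonKernel hs hzt)
    have hk : poissonKernel 0 z (circleMap 0 t θ) ≤ 10 := by
      refine (poissonKernel_le hs hzt).trans ?_
      rw [div_le_iff₀ (by linarith [ht.1])]
      linarith [ht.1]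
    rw [Pi.smul_apply', norm_smul, Real.norm_of_nonneg hk0]
    gcongr
  have hsum : ∀ w, invForm (twoRe H 0) (deriv H w) = ∑ i, ∑ j, ‖f i j w‖ := fun w => by
    rw [invForm_eq_sum hp0]
    simp only [hf, norm_pow]; rfl
  have hint : CircleIntegrable (fun w => invForm (twoRe H 0) (deriv H w)) 0 t := by
    simp only [hsum]
    exact CircleIntegrable.fun_sum _ fun i _ => CircleIntegrable.fun_sum _ fun j _ => hfi i j
  have step1 : invForm (twoRe H z) (deriv H z) ≤
      13 ^ 2 * invForm (twoRe H 0) (deriv H z) :=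
    invForm_le_of_le_smul hp0 (hH.twoRe_posDef hz1) (by norm_num)
      (hH.harnack (hz.trans (by norm_num))).2 _
  have step2 : invForm (twoRe H 0) (deriv H z) ≤
      10 * circleAverage (fun w => invForm (twoRe H 0) (deriv H w)) 0 t := by
    simp only [hsum]
    rw [circleAverage_fun_sum fun i _ => CircleIntegrable.fun_sum _ fun j _ => hfi i j,
      Finset.mul_sum]
    refine Finset.sum_le_sum fun i _ => ?_
    rw [circleAverage_fun_sum fun j _ => hfi i j, Finset.mul_sum]
    exact Finset.sum_le_sum fun j _ => hsub i j
  have step3 : circleAverage (fun w => invForm (twoRe H 0) (deriv H w)) 0 t ≤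
      13 ^ 2 / 4 * circleAverage (energy H) 0 t := by
    rw [← smul_eq_mul, ← circleAverage_fun_smul]
    refine circleAverage_mono hint ((circleIntegrable_of_continuousOn_ball
      hH.continuousOn_energy ht0 ht1).const_fun_smul) fun w hw => ?_
    rw [abs_of_nonneg ht0, mem_sphere_zero_iff_norm] at hw
    have hw1 : w ∈ ball (0 : ℂ) 1 := by rw [mem_ball_zero_iff]; linarith
    have := invForm_le_of_le_smul (hH.twoRe_posDef hw1) hp0 (by norm_num)
      (hH.harnack (hw.le.trans ht.2)).1 (deriv H w)
    simp only [energy, smul_eq_mul]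
    linarith
  have e : energy H z = 4 * invForm (twoRe H z) (deriv H z) := rfl
  rw [e]
  linarith

lemma circleAverage_energy_nonneg (hH : IsDiscPositive H) {s : ℝ} (h0 : 0 ≤ s) (h1 : s < 1) :
    0 ≤ circleAverage (energy H) 0 s :=
  circleAverage_nonneg_of_nonneg fun z hz => hH.energy_nonneg (by
    rw [abs_of_nonneg h0, mem_sphere_zero_iff_norm] at hz
    rw [mem_ball_zero_iff]; linarith)

/-- The energy integral is bounded by the gap in Jensen's inequality for `log det`. -/
lemma integral_energy_le (hH : IsDiscPositive H) {R : ℝ} (hR0 : 0 ≤ R) (hR : R < 1) :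
    ∫ s in 0..R, s * circleAverage (energy H) 0 s * (R ^ 2 - s ^ 2) ≤
      2 * (logDetRe H 0 - circleAverage (logDetRe H) 0 R) := by
  have ha := continuousOn_circleAverage hH.continuousOn_energy hR
  have ha0 : ∀ s ∈ Set.Icc 0 R, 0 ≤ circleAverage (energy H) 0 s := fun s hs =>
    hH.circleAverage_energy_nonneg hs.1 (hs.2.trans_lt hR)
  rw [hH.logDetRe_sub_circleAverage hR0 hR]
  refine (integral_sq_sub_sq_le hR0 ha ha0).trans ?_
  have : 0 ≤ ∫ ρ in 0..R, (∫ s in 0..ρ, s * circleAverage (energy H) 0 s) / ρ :=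
    intervalIntegral.integral_nonneg hR0 fun ρ hρ => div_nonneg (integral_mul_nonneg ha0 hρ) hρ.1
  have h1 : R ^ 2 ≤ 1 := pow_le_one₀ hR0 hR.le
  nlinarith [mul_nonneg (sub_nonneg.2 h1) this]

/-- The circle averages of `log det (H + H*)` decrease with the radius. -/
lemma circleAverage_logDetRe_antitone (hH : IsDiscPositive H) {r R : ℝ} (hr : 0 ≤ r) (hrR : r ≤ R)
    (hR : R < 1) : circleAverage (logDetRe H) 0 R ≤ circleAverage (logDetRe H) 0 r := by
  have hR0 := hr.trans hrR
  have ha := continuousOn_circleAverage hH.continuousOn_energy hR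
  have ha0 : ∀ s ∈ Set.Icc 0 R, 0 ≤ circleAverage (energy H) 0 s := fun s hs =>
    hH.circleAverage_energy_nonneg hs.1 (hs.2.trans_lt hR)
  have h1 := hH.logDetRe_sub_circleAverage hR0 hR
  have h2 := hH.logDetRe_sub_circleAverage hr (hrR.trans_lt hR)
  have h3 := intervalIntegral.integral_mono_interval (c := 0) (d := R) (a := 0) (b := r) le_rfl hr hrR
    ((ae_restrict_iff' measurableSet_Ioc).2 (Eventually.of_forall fun ρ hρ =>
      div_nonneg (integral_mul_nonneg ha0 ⟨hρ.1.le, hρ.2⟩) hρ.1.le))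
    (intervalIntegrable_primitive_div hR0 ha ha0)
  linarith

/-- The gap in Jensen's inequality for `log det` is bounded by the energy integral. -/
lemma logDetRe_sub_circleAverage_le (hH : IsDiscPositive H) {R : ℝ} (hR0 : 7 / 8 ≤ R) (hR : R < 1) :
    logDetRe H 0 - circleAverage (logDetRe H) 0 R ≤
      (40 * 13 ^ 4 + 2) * ∫ s in 0..R, s * circleAverage (energy H) 0 s * (R ^ 2 - s ^ 2) := by
  have ha := continuousOn_circleAverage hH.continuousOn_energy hR
  have ha0 : ∀ s ∈ Set.Icc 0 R, 0 ≤ circleAverage (energy H) 0 s := fun s hs =>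
    hH.circleAverage_energy_nonneg hs.1 (hs.2.trans_lt hR)
  rw [hH.logDetRe_sub_circleAverage (by linarith) hR]
  refine (integral_primitive_div_le hR0 ha ha0 (C := 10 * 13 ^ 4) (by norm_num) ?_).trans_eq
    (by norm_num)
  intro s hs t ht
  refine circleAverage_mono_on_of_le_circle (circleIntegrable_of_continuousOn_ball
    hH.continuousOn_energy hs.1 (by linarith [hs.2])) fun z hz => ?_
  rw [abs_of_nonneg hs.1, mem_sphere_zero_iff_norm] at hz
  exact hH.energy_le_circleAverage (hz.le.trans hs.2) ht

end IsDiscPositive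

end

section

variable {d : ℕ}

/-! ### Integration in polar coordinates -/

lemma polarCoord_symm_eq_circleMap (p : ℝ × ℝ) :
    Complex.polarCoord.symm p = circleMap 0 p.1 p.2 := by
  rw [Complex.polarCoord_symm_apply, circleMap, zero_add, Complex.exp_mul_I]
  simp

/-- The annulus `r < |z| ≤ R`. -/
def annulus (r R : ℝ) : Set ℂ := {z | ‖z‖ ∈ Set.Ioc r R}

lemma measurableSet_annulus (r R : ℝ) : MeasurableSet (annulus r R) :=
  measurable_norm measurableSet_Ioc

lemma setIntegral_annulus {G : ℂ → ℝ} (hG : ContinuousOn G (ball 0 1)) {r R : ℝ} (hr : 0 ≤ r)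
    (hrR : r ≤ R) (hR : R < 1) :
    ∫ z in annulus r R, G z = 2 * π * ∫ s in r..R, s * circleAverage G 0 s := by
  rw [← integral_indicator (measurableSet_annulus r R), ← Complex.integral_comp_polarCoord_symm]
  have e1 : ∀ p : ℝ × ℝ, p ∈ polarCoord.target →
      p.1 • (annulus r R).indicator G (Complex.polarCoord.symm p) =
        (Set.Ioc r R ×ˢ Set.univ).indicator (fun p : ℝ × ℝ => p.1 * G (circleMap 0 p.1 p.2)) p := by
    intro p hp
    rw [polarCoord_symm_eq_circleMap]
    have hp1 : 0 < p.1 := hp.1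
    by_cases h : p.1 ∈ Set.Ioc r R
    · rw [Set.indicator_of_mem, Set.indicator_of_mem (show p ∈ Set.Ioc r R ×ˢ Set.univ from ⟨h, trivial⟩),
        smul_eq_mul]
      simpa [annulus, abs_of_pos hp1] using h
    · rw [Set.indicator_of_notMem, Set.indicator_of_notMem
        (show p ∉ Set.Ioc r R ×ˢ Set.univ from fun hh => h hh.1), smul_zero]
      simpa [annulus, abs_of_pos hp1] using h
  rw [setIntegral_congr_fun polarCoord.open_target.measurableSet e1,
    setIntegral_indicator (measurableSet_Ioc.prod MeasurableSet.univ)]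
  have e2 : polarCoord.target ∩ Set.Ioc r R ×ˢ Set.univ = Set.Ioc r R ×ˢ Set.Ioo (-π) π := by
    rw [polarCoord_target, Set.prod_inter_prod, Set.inter_univ, Set.inter_eq_right.2]
    exact fun s hs => hr.trans_lt hs.1
  rw [e2, Measure.volume_eq_prod, setIntegral_prod]
  · rw [intervalIntegral.integral_of_le hrR, ← integral_const_mul]
    refine setIntegral_congr_fun measurableSet_Ioc fun s hs => ?_
    simp only
    rw [integral_const_mul, ← integral_Ioc_eq_integral_Ioo,
      ← intervalIntegral.integral_of_le (by linarith [pi_pos]), circleAverage_def, smul_eq_mul]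
    have hper : Function.Periodic (fun θ => G (circleMap 0 s θ)) (2 * π) := fun θ => by
      simp only [periodic_circleMap 0 s θ]
    have h := hper.intervalIntegral_add_eq (-π) 0
    rw [show -π + 2 * π = π by ring, zero_add] at h
    rw [h]
    field_simp
  · have hc : ContinuousOn (fun p : ℝ × ℝ => p.1 * G (circleMap 0 p.1 p.2))
        (Set.Icc r R ×ˢ Set.Icc (-π) π) := by
      refine continuousOn_fst.mul (hG.comp (by fun_prop) fun p hp => ?_)
      exact circleMap_mem_ball_one (hr.trans hp.1.1) (hp.1.2.trans_lt hR) _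
    exact (hc.integrableOn_compact (isCompact_Icc.prod isCompact_Icc)).mono_set
      (Set.prod_mono Set.Ioc_subset_Icc_self Set.Ioo_subset_Icc_self)

lemma setLIntegral_annulus {G : ℂ → ℝ} (hG : ContinuousOn G (ball 0 1)) {r R : ℝ} (hr : 0 ≤ r)
    (hrR : r ≤ R) (hR : R < 1) (h0 : ∀ z ∈ annulus r R, 0 ≤ G z) :
    ∫⁻ z in annulus r R, ENNReal.ofReal (G z) =
      ENNReal.ofReal (2 * π * ∫ s in r..R, s * circleAverage G 0 s) := by
  rw [← setIntegral_annulus hG hr hrR hR, ofReal_integral_eq_lintegral_ofReal]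
  · have hsub : annulus r R ⊆ closedBall 0 R := fun z hz => by
      rw [mem_closedBall_zero_iff]; exact hz.2
    exact ((hG.mono (closedBall_subset_ball hR)).integrableOn_compact
      (isCompact_closedBall _ _)).mono_set hsub
  · exact (ae_restrict_iff' (measurableSet_annulus r R)).2 (Eventually.of_forall h0)

lemma circleAverage_norm_mul {G : ℂ → ℝ} (w : ℝ → ℝ) {s : ℝ} (hs : 0 ≤ s) :
    circleAverage (fun z => w ‖z‖ * G z) 0 s = w s * circleAverage G 0 s := by
  rw [← smul_eq_mul (w s), ← circleAverage_fun_smul]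
  refine circleAverage_congr_sphere fun z hz => ?_
  rw [abs_of_nonneg hs, mem_sphere_zero_iff_norm] at hz
  simp [hz]

namespace IsDiscPositive

variable {H : ℂ → Matrix (Fin d) (Fin d) ℂ}

lemma setLIntegral_energy (hH : IsDiscPositive H) {R : ℝ} (hR0 : 0 ≤ R) (hR : R < 1) :
    ∫⁻ z in annulus 0 R, ENNReal.ofReal ((R ^ 2 - ‖z‖ ^ 2) * energy H z) =
      ENNReal.ofReal (2 * π * ∫ s in 0..R, s * circleAverage (energy H) 0 s * (R ^ 2 - s ^ 2)) := by
  rw [setLIntegral_annulus (G := fun z => (R ^ 2 - ‖z‖ ^ 2) * energy H z)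
    (ContinuousOn.mul (by fun_prop) hH.continuousOn_energy) le_rfl hR0 hR]
  · congr 2
    refine intervalIntegral.integral_congr fun s hs => ?_
    rw [Set.uIcc_of_le hR0] at hs
    rw [circleAverage_norm_mul (fun x => R ^ 2 - x ^ 2) hs.1]
    ring
  · intro z hz
    have h2 := hz.2
    refine mul_nonneg (by nlinarith [norm_nonneg z]) (hH.energy_nonneg ?_)
    rw [mem_ball_zero_iff]; exact h2.trans_lt hR

lemma aemeasurable_energy (hH : IsDiscPositive H) :
    AEMeasurable (energy H) (volume.restrict (ball 0 1)) :=
  hH.continuousOn_energy.aemeasurable measurableSet_ball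

/-- The gap in Jensen's inequality over every circle is bounded by the full energy integral. -/
lemma ofReal_gap_le (hH : IsDiscPositive H) {R : ℝ} (hR0 : 7 / 8 ≤ R) (hR : R < 1) :
    ENNReal.ofReal (logDetRe H 0 - circleAverage (logDetRe H) 0 R) ≤
      ENNReal.ofReal (40 * 13 ^ 4 + 2) *
        ∫⁻ z in ball 0 1, ENNReal.ofReal ((1 - ‖z‖ ^ 2) * energy H z) := by
  have hR0' : 0 ≤ R := by linarith
  have hsub : annulus 0 R ⊆ ball 0 1 := fun z hz => by
    rw [mem_ball_zero_iff]; exact hz.2.trans_lt hR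
  have h1 := hH.logDetRe_sub_circleAverage_le hR0 hR
  set J := ∫ s in 0..R, s * circleAverage (energy H) 0 s * (R ^ 2 - s ^ 2)
  have hJ : 0 ≤ J := intervalIntegral.integral_nonneg hR0' fun s hs =>
    mul_nonneg (mul_nonneg hs.1 (hH.circleAverage_energy_nonneg hs.1 (hs.2.trans_lt hR)))
      (by nlinarith [hs.1, hs.2])
  calc _ ≤ ENNReal.ofReal ((40 * 13 ^ 4 + 2) * (2 * π * J)) := by
        refine ENNReal.ofReal_le_ofReal (h1.trans ?_)
        gcongr
        nlinarith [pi_gt_three]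
    _ = ENNReal.ofReal (40 * 13 ^ 4 + 2) * ∫⁻ z in annulus 0 R,
          ENNReal.ofReal ((R ^ 2 - ‖z‖ ^ 2) * energy H z) := by
        rw [hH.setLIntegral_energy hR0' hR, ENNReal.ofReal_mul (by norm_num)]
    _ ≤ ENNReal.ofReal (40 * 13 ^ 4 + 2) * ∫⁻ z in annulus 0 R,
          ENNReal.ofReal ((1 - ‖z‖ ^ 2) * energy H z) := by
        gcongr 1
        refine setLIntegral_mono' (measurableSet_annulus 0 R) fun z hz => ?_
        have := hH.energy_nonneg (hsub hz)
        gcongr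
        nlinarith
    _ ≤ _ := by gcongr

/-- The full energy integral is bounded by the supremum of the gaps in Jensen's inequality. -/
lemma lintegral_energy_le (hH : IsDiscPositive H) {B : ℝ}
    (hB : ∀ R, 0 ≤ R → R < 1 → logDetRe H 0 - circleAverage (logDetRe H) 0 R ≤ B) :
    ∫⁻ z in ball 0 1, ENNReal.ofReal ((1 - ‖z‖ ^ 2) * energy H z) ≤
      ENNReal.ofReal (4 * π * B) := by
  obtain ⟨R, -, hRlt, hRt⟩ := exists_seq_strictMono_tendsto' (show (0 : ℝ) < 1 by norm_num)
  set F : ℕ → ℂ → ℝ≥0∞ := fun n z => ENNReal.ofReal ((R n) ^ 2 - ‖z‖ ^ 2) *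
    ENNReal.ofReal (energy H z)
  have hlim : ∀ z ∈ ball (0 : ℂ) 1, ENNReal.ofReal ((1 - ‖z‖ ^ 2) * energy H z) =
      liminf (fun n => F n z) atTop := fun z hz => by
    have h0 : 0 ≤ 1 - ‖z‖ ^ 2 := by
      rw [mem_ball_zero_iff] at hz; nlinarith [norm_nonneg z]
    rw [ENNReal.ofReal_mul h0]
    refine (Tendsto.liminf_eq ?_).symm
    refine ENNReal.Tendsto.mul_const (ENNReal.tendsto_ofReal ?_) (Or.inr ENNReal.ofReal_ne_top)
    have := (hRt.pow 2).sub_const (‖z‖ ^ 2)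
    rwa [one_pow] at this
  rw [setLIntegral_congr_fun measurableSet_ball hlim]
  refine (lintegral_liminf_le' fun n => ?_).trans ?_
  · exact (Measurable.aemeasurable (by fun_prop)).mul hH.aemeasurable_energy.ennreal_ofReal
  refine liminf_le_of_le (by isBoundedDefault) fun b hb => ?_
  obtain ⟨n, hn⟩ := hb.exists
  refine hn.trans ?_
  have hn0 := (hRlt n).1.le
  have hn1 := (hRlt n).2
  have hle : ∫⁻ z in ball 0 1, F n z ≤ ∫⁻ z in annulus 0 (R n),
      ENNReal.ofReal (((R n) ^ 2 - ‖z‖ ^ 2) * energy H z) := by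
    rw [← lintegral_indicator measurableSet_ball, ← lintegral_indicator (measurableSet_annulus _ _)]
    refine lintegral_mono_ae ?_
    have hne : ∀ᵐ z : ℂ, z ≠ 0 := by simp [ae_iff]
    filter_upwards [hne] with z hz
    by_cases hb : z ∈ ball (0 : ℂ) 1
    · rw [Set.indicator_of_mem hb]
      by_cases ha : z ∈ annulus 0 (R n)
      · rw [Set.indicator_of_mem ha, ENNReal.ofReal_mul]
        have := ha.2
        nlinarith [norm_nonneg z]
      · have : R n < ‖z‖ := by
          by_contra! h
          exact ha ⟨norm_pos_iff.2 hz, h⟩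
        have h0 : (R n) ^ 2 - ‖z‖ ^ 2 ≤ 0 := by nlinarith
        simp [F, ENNReal.ofReal_of_nonpos h0]
    · rw [Set.indicator_of_notMem hb]; exact zero_le
  refine hle.trans ?_
  rw [hH.setLIntegral_energy hn0 hn1]
  refine ENNReal.ofReal_le_ofReal ?_
  have h1 := hH.integral_energy_le hn0 hn1
  have h2 := hB (R n) hn0 hn1
  have hpi := pi_pos
  calc _ ≤ 2 * π * (2 * (logDetRe H 0 - circleAverage (logDetRe H) 0 (R n))) := by gcongr
    _ ≤ 2 * π * (2 * B) := by gcongr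
    _ = 4 * π * B := by ring

end IsDiscPositive

/-! ### Automorphisms of the disk -/

/-- The involutive automorphism of the unit disk that exchanges `0` and `a`. -/
noncomputable def mobius (a z : ℂ) : ℂ := (a - z) / (1 - (starRingEnd ℂ) a * z)

@[simp] lemma mobius_zero (a : ℂ) : mobius a 0 = a := by simp [mobius]

lemma one_sub_conj_mul_ne_zero {a z : ℂ} (ha : ‖a‖ < 1) (hz : ‖z‖ ≤ 1) :
    1 - (starRingEnd ℂ) a * z ≠ 0 := by
  intro h
  have h1 : ‖(starRingEnd ℂ) a * z‖ = 1 := by rw [← sub_eq_zero.1 h, norm_one]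
  rw [norm_mul, RCLike.norm_conj] at h1
  nlinarith [norm_nonneg a, norm_nonneg z]

lemma one_sub_norm_mobius_sq {a z : ℂ} (ha : ‖a‖ < 1) (hz : ‖z‖ ≤ 1) :
    1 - ‖mobius a z‖ ^ 2 =
      (1 - ‖a‖ ^ 2) * (1 - ‖z‖ ^ 2) / ‖1 - (starRingEnd ℂ) a * z‖ ^ 2 := by
  have h : ‖1 - (starRingEnd ℂ) a * z‖ ^ 2 ≠ 0 :=
    pow_ne_zero _ (norm_ne_zero_iff.2 (one_sub_conj_mul_ne_zero ha hz))
  rw [mobius, norm_div, div_pow, eq_div_iff h, sub_mul, div_mul_cancel₀ _ h]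
  simp only [← Complex.normSq_eq_norm_sq, Complex.normSq_apply, Complex.sub_re, Complex.sub_im,
    Complex.mul_re, Complex.mul_im, Complex.conj_re, Complex.conj_im, Complex.one_re,
    Complex.one_im]
  ring

lemma mobius_mem_ball {a z : ℂ} (ha : ‖a‖ < 1) (hz : z ∈ ball (0 : ℂ) 1) :
    mobius a z ∈ ball (0 : ℂ) 1 := by
  rw [mem_ball_zero_iff] at hz ⊢
  have h := one_sub_norm_mobius_sq ha hz.le
  have hp : 0 < ‖1 - (starRingEnd ℂ) a * z‖ ^ 2 :=
    pow_pos (norm_pos_iff.2 (one_sub_conj_mul_ne_zero ha hz.le)) 2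
  have : 0 < (1 - ‖a‖ ^ 2) * (1 - ‖z‖ ^ 2) / ‖1 - (starRingEnd ℂ) a * z‖ ^ 2 :=
    div_pos (mul_pos (by nlinarith [norm_nonneg a]) (by nlinarith [norm_nonneg z])) hp
  nlinarith [norm_nonneg (mobius a z)]

lemma mobius_mobius {a z : ℂ} (ha : ‖a‖ < 1) (hz : z ∈ ball (0 : ℂ) 1) :
    mobius a (mobius a z) = z := by
  have h1 := one_sub_conj_mul_ne_zero ha (mem_ball_zero_iff.1 hz).le
  have h2 := one_sub_conj_mul_ne_zero ha (mem_ball_zero_iff.1 (mobius_mem_ball ha hz)).le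
  have h3 : 1 - (starRingEnd ℂ) a * mobius a z =
      (1 - (starRingEnd ℂ) a * a) / (1 - (starRingEnd ℂ) a * z) := by
    rw [mobius, eq_div_iff h1, sub_mul, mul_assoc, div_mul_cancel₀ _ h1]; ring
  have h4 : 1 - (starRingEnd ℂ) a * a ≠ 0 := one_sub_conj_mul_ne_zero ha ha.le
  have h5 : a - mobius a z = z * (1 - (starRingEnd ℂ) a * a) / (1 - (starRingEnd ℂ) a * z) := by
    rw [mobius, eq_div_iff h1, sub_mul, div_mul_cancel₀ _ h1]; ring
  rw [mobius, h3, h5, div_div_div_cancel_right₀ h1, mul_div_cancel_right₀ _ h4]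

/-- The derivative of `mobius a`. -/
noncomputable def mobiusDeriv (a z : ℂ) : ℂ :=
  -((1 - (starRingEnd ℂ) a * a) / (1 - (starRingEnd ℂ) a * z) ^ 2)

lemma hasDerivAt_mobius {a z : ℂ} (ha : ‖a‖ < 1) (hz : z ∈ ball (0 : ℂ) 1) :
    HasDerivAt (mobius a) (mobiusDeriv a z) z := by
  have h1 := one_sub_conj_mul_ne_zero ha (mem_ball_zero_iff.1 hz).le
  have h := ((hasDerivAt_id z).const_sub a).div
    (((hasDerivAt_id z).const_mul ((starRingEnd ℂ) a)).const_sub 1) h1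
  refine h.congr_deriv ?_
  rw [mobiusDeriv, ← neg_div]
  congr 1
  simp only [id]
  ring

/-- The real Jacobian of multiplication by `c`. -/
lemma det_restrictScalars_smulRight (c : ℂ) :
    (((1 : ℂ →L[ℂ] ℂ).smulRight c).restrictScalars ℝ).det = ‖c‖ ^ 2 := by
  have h : ((((1 : ℂ →L[ℂ] ℂ).smulRight c).restrictScalars ℝ : ℂ →L[ℝ] ℂ) : ℂ →ₗ[ℝ] ℂ) =
      LinearMap.mul ℝ ℂ c := by
    refine LinearMap.ext fun v => ?_
    simp [mul_comm]
  rw [ContinuousLinearMap.det, h, ← Complex.normSq_eq_norm_sq, ← Algebra.norm_complex_apply,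
    Algebra.norm_apply]
  rfl

/-- Change of variables `w = mobius a z` on a measurable subset of the disk. -/
lemma setLIntegral_image_mobius {a : ℂ} (ha : ‖a‖ < 1) {s : Set ℂ} (hs : MeasurableSet s)
    (hsb : s ⊆ ball 0 1) (F : ℂ → ℝ≥0∞) :
    ∫⁻ w in mobius a '' s, F w =
      ∫⁻ z in s, ENNReal.ofReal (‖mobiusDeriv a z‖ ^ 2) * F (mobius a z) := by
  have hinj : Set.InjOn (mobius a) s := fun x hx y hy h => by
    rw [← mobius_mobius ha (hsb hx), h, mobius_mobius ha (hsb hy)]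
  rw [lintegral_image_eq_lintegral_abs_det_fderiv_mul volume hs (fun z hz =>
    ((hasDerivAt_mobius ha (hsb hz)).hasFDerivAt.restrictScalars ℝ).hasFDerivWithinAt) hinj]
  refine setLIntegral_congr_fun hs fun z _ => ?_
  rw [show (ContinuousLinearMap.restrictScalars ℝ (ContinuousLinearMap.toSpanSingleton ℂ
    (mobiusDeriv a z))).det = ‖mobiusDeriv a z‖ ^ 2 from det_restrictScalars_smulRight _,
    abs_of_nonneg (by positivity)]

lemma mobius_image_ball {a : ℂ} (ha : ‖a‖ < 1) : mobius a '' ball 0 1 = ball 0 1 := by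
  refine Set.Subset.antisymm ?_ fun z hz => ⟨mobius a z, mobius_mem_ball ha hz, mobius_mobius ha hz⟩
  rintro _ ⟨z, hz, rfl⟩
  exact mobius_mem_ball ha hz

lemma invForm_smul (A B : Matrix (Fin d) (Fin d) ℂ) (c : ℂ) :
    invForm A (c • B) = ‖c‖ ^ 2 * invForm A B := by
  simp only [invForm, Matrix.conjTranspose_smul, Matrix.mul_smul, Matrix.smul_mul, smul_smul,
    Matrix.trace_smul, smul_eq_mul]
  rw [Complex.star_def, mul_comm _ c, Complex.mul_conj, Complex.re_ofReal_mul,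
    Complex.normSq_eq_norm_sq]

namespace IsDiscPositive

variable {H : ℂ → Matrix (Fin d) (Fin d) ℂ}

lemma comp_mobius (hH : IsDiscPositive H) {a : ℂ} (ha : ‖a‖ < 1) :
    IsDiscPositive (fun z => H (mobius a z)) where
  differentiableOn := fun z hz =>
    ((hH.hasDerivAt (mobius_mem_ball ha hz)).scomp z
      (hasDerivAt_mobius ha hz)).differentiableAt.differentiableWithinAt
  posDef := fun _ hz => hH.posDef _ (mobius_mem_ball ha hz)

/-- The energy density transforms like the Laplacian under automorphisms of the disk. -/
lemma energy_comp_mobius (hH : IsDiscPositive H) {a z : ℂ} (ha : ‖a‖ < 1)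
    (hz : z ∈ ball (0 : ℂ) 1) :
    energy (fun z => H (mobius a z)) z = ‖mobiusDeriv a z‖ ^ 2 * energy H (mobius a z) := by
  have h := ((hH.hasDerivAt (mobius_mem_ball ha hz)).scomp z (hasDerivAt_mobius ha hz)).deriv
  have e : deriv (fun z => H (mobius a z)) z = mobiusDeriv a z • deriv H (mobius a z) := h
  simp only [energy, twoRe, e, invForm_smul]
  ring

lemma lintegral_energy_comp_mobius (hH : IsDiscPositive H) {a : ℂ} (ha : ‖a‖ < 1) :
    ∫⁻ z in ball 0 1, ENNReal.ofReal ((1 - ‖z‖ ^ 2) * energy (fun z => H (mobius a z)) z) =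
      ∫⁻ w in ball 0 1, ENNReal.ofReal ((1 - ‖mobius a w‖ ^ 2) * energy H w) := by
  conv_rhs => rw [← mobius_image_ball ha]
  rw [setLIntegral_image_mobius ha measurableSet_ball le_rfl]
  refine setLIntegral_congr_fun measurableSet_ball fun z hz => ?_
  rw [hH.energy_comp_mobius ha hz, mobius_mobius ha hz, ← ENNReal.ofReal_mul (by positivity)]
  congr 1
  ring

end IsDiscPositive

end

/-! ### The Herglotz integral of a matrix weight -/

section

variable {d : ℕ}

lemma poissonKernel_zero_eq_re (z ζ : ℂ) :
    poissonKernel 0 z ζ = (herglotzRieszKernel 0 z ζ).re := by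
  rw [poissonKernel_eq_re_herglotzRieszKernel]; rfl

lemma poissonKernel_pos {z : ℂ} (hz : z ∈ ball (0 : ℂ) 1) (θ : ℝ) :
    0 < poissonKernel 0 z (circleMap 0 1 θ) := by
  have h := le_poissonKernel (circleMap_mem_sphere 0 zero_le_one θ) hz
  rw [mem_ball_zero_iff] at hz
  exact (div_pos (by linarith) (by positivity)).trans_le h

lemma circleIntegrable_herglotzRieszKernel_smul {E : Type*} [NormedAddCommGroup E]
    [NormedSpace ℂ E] {f : ℂ → E} (hf : CircleIntegrable f 0 1) {z : ℂ} (hz : z ∈ ball (0 : ℂ) 1) :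
    CircleIntegrable (fun ζ => herglotzRieszKernel 0 z ζ • f ζ) 0 1 :=
  hf.continuousOn_smul (continuousOn_herglotzRieszKernel_sphere hz)

/-- A real Poisson integral is the real part of a holomorphic function. -/
lemma exists_differentiableOn_re_eq_harmonicExt {f : ℂ → ℝ} (hf : CircleIntegrable f 0 1) :
    ∃ F : ℂ → ℂ, DifferentiableOn ℂ F (ball 0 1) ∧ ∀ z ∈ ball (0 : ℂ) 1, harmonicExt f z = (F z).re := by
  have hf' : CircleIntegrable (fun ζ => (f ζ : ℂ)) 0 1 := by
    simp only [CircleIntegrable, intervalIntegrable_iff] at hf ⊢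
    exact Complex.ofRealCLM.integrable_comp hf
  refine ⟨_, differentiableOn_circleAverage_herglotzRieszKernel_smul hf', fun z hz => ?_⟩
  rw [re_circleAverage_herglotzRieszKernel_smul hf hz, harmonicExt,
    ← poissonKernel_eq_re_herglotzRieszKernel]
  rfl

lemma circleAverage_re {f : ℂ → ℂ} {R : ℝ} (hf : CircleIntegrable f 0 R) :
    circleAverage (fun z => (f z).re) 0 R = (circleAverage f 0 R).re :=
  Complex.reCLM.circleAverage_comp_comm hf

/-- The mean value property of the harmonic extension on the images of circles under disk
automorphisms. -/
lemma circleAverage_harmonicExt_mobius {f : ℂ → ℝ} (hf : CircleIntegrable f 0 1) {a : ℂ}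
    (ha : ‖a‖ < 1) {R : ℝ} (hR0 : 0 < R) (hR : R < 1) :
    circleAverage (fun z => harmonicExt f (mobius a z)) 0 R = harmonicExt f a := by
  obtain ⟨F, hF, hre⟩ := exists_differentiableOn_re_eq_harmonicExt hf
  have hm : DifferentiableOn ℂ (mobius a) (ball 0 1) := fun z hz =>
    (hasDerivAt_mobius ha hz).differentiableAt.differentiableWithinAt
  have hFm : DifferentiableOn ℂ (fun z => F (mobius a z)) (ball 0 1) :=
    hF.comp hm fun z hz => mobius_mem_ball ha hz
  have hd : DiffContOnCl ℂ (fun z => F (mobius a z)) (ball 0 R) := (hFm.mono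
    (closure_ball_subset_closedBall.trans (closedBall_subset_ball hR))).diffContOnCl
  have h0 : (0 : ℂ) ∈ ball (0 : ℂ) R := by simpa using hR0
  have hP := hd.circleAverage_poissonKernel_smul h0
  have e1 : circleAverage (poissonKernel 0 0 • fun z => F (mobius a z)) 0 R =
      circleAverage (fun z => F (mobius a z)) 0 R := by
    refine circleAverage_congr_sphere fun ζ hζ => ?_
    have : ζ ≠ 0 := by rintro rfl; simp at hζ; exact hR0.ne' (abs_eq_zero.1 hζ.symm)
    simp [poissonKernel_def, this]
  rw [hre a (mem_ball_zero_iff.2 ha)]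
  rw [e1, mobius_zero] at hP
  rw [← hP, ← circleAverage_re (circleIntegrable_of_continuousOn_ball hFm.continuousOn hR0.le hR)]
  refine circleAverage_congr_sphere fun ζ hζ => hre _ (mobius_mem_ball ha ?_)
  rw [abs_of_pos hR0, mem_sphere_zero_iff_norm] at hζ
  rw [mem_ball_zero_iff]; linarith

lemma harmonicExt_const (c : ℝ) {z : ℂ} (hz : z ∈ ball (0 : ℂ) 1) :
    harmonicExt (fun _ => c) z = c := by
  have h := DiffContOnCl.circleAverage_poissonKernel_smul (f := fun _ => (c : ℂ))
    (diffContOnCl_const) hz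
  apply Complex.ofReal_injective
  rw [← h, harmonicExt, ← circleAverage_ofReal]
  congr 1
  funext ζ
  simp

lemma harmonicExt_zero_eq {E : Type*} [NormedAddCommGroup E] [NormedSpace ℝ E] (f : ℂ → E) :
    harmonicExt f 0 = circleAverage f 0 1 := by
  refine circleAverage_congr_sphere fun ζ hζ => ?_
  have : ζ ≠ 0 := by rintro rfl; simp at hζ
  simp [poissonKernel_def, this]

lemma continuousLinearMap_harmonicExt {E F : Type*} [NormedAddCommGroup E] [NormedSpace ℝ E]
    [NormedAddCommGroup F] [NormedSpace ℝ F] [CompleteSpace E] [CompleteSpace F] (T : E →L[ℝ] F)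
    {f : ℂ → E} (hf : CircleIntegrable f 0 1) {z : ℂ} (hz : z ∈ ball (0 : ℂ) 1) :
    T (harmonicExt f z) = harmonicExt (fun ζ => T (f ζ)) z := by
  rw [harmonicExt, ← T.circleAverage_comp_comm (circleIntegrable_poissonKernel_smul hf hz),
    harmonicExt]
  congr 1
  funext ζ
  simp

/-- Half of the Herglotz integral of `W`: a holomorphic function `H` for which `H + H*` is the
harmonic extension of `W`. -/
noncomputable def herglotzInt (W : ℂ → Matrix (Fin d) (Fin d) ℂ) (z : ℂ) :
    Matrix (Fin d) (Fin d) ℂ :=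
  (1 / 2 : ℂ) • circleAverage (fun ζ => herglotzRieszKernel 0 z ζ • W ζ) 0 1

/-- The measure with density `1 - |z|²` times the energy density, on the unit disk. -/
noncomputable def energyMeasure (W : ℂ → Matrix (Fin d) (Fin d) ℂ) : Measure ℂ :=
  (volume.restrict (ball (0 : ℂ) 1)).withDensity fun z =>
    ENNReal.ofReal ((1 - ‖z‖ ^ 2) * energy (herglotzInt W) z)

lemma energyMeasure_compl_ball (W : ℂ → Matrix (Fin d) (Fin d) ℂ) :
    energyMeasure W (ball 0 1)ᶜ = 0 := by
  refine withDensity_absolutelyContinuous _ _ ?_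
  rw [Measure.restrict_apply measurableSet_ball.compl, Set.compl_inter_self, measure_empty]

namespace IsMatrixWeight

variable {W : ℂ → Matrix (Fin d) (Fin d) ℂ}

lemma twoRe_herglotzInt (hW : IsMatrixWeight W) {z : ℂ} (hz : z ∈ ball (0 : ℂ) 1) :
    twoRe (herglotzInt W) z = harmonicExt W z := by
  set T : Matrix (Fin d) (Fin d) ℂ →L[ℝ] Matrix (Fin d) (Fin d) ℂ :=
    ContinuousLinearMap.id ℝ _ + (starL' ℝ : Matrix (Fin d) (Fin d) ℂ ≃L[ℝ] _).toContinuousLinearMap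
  have hT : ∀ M, T M = M + M.conjTranspose := fun M => rfl
  have hi := circleIntegrable_herglotzRieszKernel_smul hW.integrable hz
  have e1 : herglotzInt W z =
      (1 / 2 : ℝ) • circleAverage (fun ζ => herglotzRieszKernel 0 z ζ • W ζ) 0 1 := by
    rw [herglotzInt, ← Complex.coe_smul]; norm_num
  have e2 : twoRe (herglotzInt W) z = T (herglotzInt W z) := rfl
  rw [e2, e1, map_smul, ← T.circleAverage_comp_comm hi, harmonicExt, ← circleAverage_smul,
    circleAverage_def, circleAverage_def]
  congr 1
  refine intervalIntegral.integral_congr_ae (hW.posDef.mono fun θ hθ _ => ?_)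
  have hh := hθ.isHermitian.eq
  simp only [Pi.smul_apply, Function.comp, hT, Matrix.conjTranspose_smul, hh]
  rw [← add_smul, Complex.star_def, Complex.add_conj, poissonKernel_zero_eq_re, ← Complex.coe_smul,
    ← Complex.coe_smul, smul_smul]
  congr 1
  push_cast
  ring

lemma harmonicExt_posDef (hW : IsMatrixWeight W) {z : ℂ} (hz : z ∈ ball (0 : ℂ) 1) :
    (harmonicExt W z).PosDef := by
  have hherm : (harmonicExt W z).IsHermitian := by
    rw [← hW.twoRe_herglotzInt hz]
    exact Matrix.isHermitian_add_transpose_self _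
  refine Matrix.PosDef.of_dotProduct_mulVec_pos hherm fun x hx => ?_
  set ℓ : Matrix (Fin d) (Fin d) ℂ →L[ℝ] ℂ := LinearMap.toContinuousLinearMap
    { toFun := fun M => star x ⬝ᵥ (M.mulVec x)
      map_add' := fun M N => by rw [Matrix.add_mulVec, dotProduct_add]
      map_smul' := fun c M => by rw [Matrix.smul_mulVec, dotProduct_smul]; rfl } with hℓ
  have hℓ' : ∀ M, ℓ M = star x ⬝ᵥ (M.mulVec x) := fun M => rfl
  rw [← hℓ', continuousLinearMap_harmonicExt ℓ hW.integrable hz]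
  have hpos : ∀ᵐ θ : ℝ, 0 < poissonKernel 0 z (circleMap 0 1 θ) • ℓ (W (circleMap 0 1 θ)) :=
    hW.posDef.mono fun θ hθ => smul_pos (poissonKernel_pos hz θ) (hθ.dotProduct_mulVec_pos hx)
  have h0 : 0 ≤ harmonicExt (fun ζ => ℓ (W ζ)) z :=
    circleAverage_nonneg_of_ae (hpos.mono fun θ h => h.le)
  refine lt_of_le_of_ne h0 fun h => ?_
  have hi : CircleIntegrable (fun ζ => poissonKernel 0 z ζ • ℓ (W ζ)) 0 1 := by
    refine circleIntegrable_poissonKernel_smul ?_ hz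
    have := hW.integrable
    simp only [CircleIntegrable, intervalIntegrable_iff] at this ⊢
    exact ℓ.integrable_comp this
  have hr := congrArg Complex.re h.symm
  rw [harmonicExt, ← circleAverage_re hi, Complex.zero_re, circleAverage_def, smul_eq_mul,
    mul_eq_zero, or_iff_right (by positivity),
    intervalIntegral.integral_of_le two_pi_pos.le] at hr
  have hpos' : ∀ᵐ θ ∂volume.restrict (Set.Ioc 0 (2 * π)),
      0 < (poissonKernel 0 z (circleMap 0 1 θ) • ℓ (W (circleMap 0 1 θ))).re :=
    ae_restrict_of_ae (hpos.mono fun θ hθ => (Complex.lt_def.1 hθ).1)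
  have hi' : Integrable (fun θ => (poissonKernel 0 z (circleMap 0 1 θ) •
      ℓ (W (circleMap 0 1 θ))).re) (volume.restrict (Set.Ioc 0 (2 * π))) := by
    have := (intervalIntegrable_iff_integrableOn_Ioc_of_le two_pi_pos.le).1 hi
    exact Complex.reCLM.integrable_comp this
  have hz0 := (integral_eq_zero_iff_of_nonneg_ae (hpos'.mono fun θ h => h.le) hi').1 hr
  have hfalse : ∀ᵐ θ ∂volume.restrict (Set.Ioc 0 (2 * π)), False := by
    filter_upwards [hpos', hz0] with θ h1 h2
    exact h1.ne' h2
  rw [ae_iff] at hfalse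
  simp [pi_pos.not_ge] at hfalse

lemma isDiscPositive (hW : IsMatrixWeight W) : IsDiscPositive (herglotzInt W) where
  differentiableOn :=
    (differentiableOn_circleAverage_herglotzRieszKernel_smul hW.integrable).const_smul (1 / 2 : ℂ)
  posDef := fun z hz => by
    have h := hW.harmonicExt_posDef hz
    rwa [← hW.twoRe_herglotzInt hz] at h

lemma logDetRe_herglotzInt (hW : IsMatrixWeight W) {z : ℂ} (hz : z ∈ ball (0 : ℂ) 1) :
    logDetRe (herglotzInt W) z = Real.log (harmonicExt W z).det.re := by
  rw [logDetRe, hW.twoRe_herglotzInt hz]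

lemma lineDeriv_harmonicExt (hW : IsMatrixWeight W) {z : ℂ} (hz : z ∈ ball (0 : ℂ) 1) (v : ℂ) :
    lineDeriv ℝ (harmonicExt W) z v =
      v • deriv (herglotzInt W) z + (v • deriv (herglotzInt W) z).conjTranspose := by
  obtain ⟨V', h, hv⟩ := hW.isDiscPositive.hasFDerivAt_twoRe hz
  have he : twoRe (herglotzInt W) =ᶠ[𝓝 z] harmonicExt W :=
    (isOpen_ball.mem_nhds hz |> fun h => Filter.mem_of_superset h fun w hw =>
      hW.twoRe_herglotzInt hw)
  rw [(h.congr_of_eventuallyEq he.symm).hasLineDerivAt v |>.lineDeriv, hv]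

/-- Either gradient measure is dominated by the energy measure. -/
lemma gradMeasure_le (hW : IsMatrixWeight W) (v : ℂ) (hv : v = 1 ∨ v = Complex.I) :
    gradMeasure W v ≤ energyMeasure W := by
  refine withDensity_mono ((ae_restrict_iff' measurableSet_ball).2 (Eventually.of_forall
    fun z hz => ENNReal.ofReal_le_ofReal ?_))
  have hp := hW.harmonicExt_posDef hz
  have h0 : 0 ≤ 1 - ‖z‖ ^ 2 := by
    rw [mem_ball_zero_iff] at hz; nlinarith [norm_nonneg z]
  rw [mul_comm]
  refine mul_le_mul_of_nonneg_left ?_ h0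
  refine (norm_invSqrt_mul_sq_le_invForm hp _).trans ?_
  rw [energy, hW.twoRe_herglotzInt hz, ← invForm_add_conjTranspose, hW.lineDeriv_harmonicExt hz]
  rcases hv with rfl | rfl
  · rw [one_smul]
    exact le_add_of_nonneg_right (invForm_nonneg hp _)
  · exact le_add_of_nonneg_left (invForm_nonneg hp _)

lemma setLIntegral_invForm_le (hW : IsMatrixWeight W) (v : ℂ) {s : Set ℂ} (hs : MeasurableSet s) :
    ∫⁻ z in s ∩ ball 0 1, ENNReal.ofReal ((1 - ‖z‖ ^ 2) * invForm (twoRe (herglotzInt W) z)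
        (v • deriv (herglotzInt W) z + (v • deriv (herglotzInt W) z).conjTranspose)) ≤
      ENNReal.ofReal (d ^ 2) * gradMeasure W v s := by
  rw [gradMeasure, withDensity_apply _ hs, Measure.restrict_restrict hs,
    ← lintegral_const_mul' _ _ ENNReal.ofReal_ne_top]
  refine setLIntegral_mono' (hs.inter measurableSet_ball) fun z hz => ?_
  rw [← ENNReal.ofReal_mul (by positivity)]
  refine ENNReal.ofReal_le_ofReal ?_
  have hp := hW.harmonicExt_posDef hz.2
  have h0 : 0 ≤ 1 - ‖z‖ ^ 2 := by
    have := mem_ball_zero_iff.1 hz.2; nlinarith [norm_nonneg z]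
  rw [hW.lineDeriv_harmonicExt hz.2, hW.twoRe_herglotzInt hz.2, ← mul_assoc, mul_comm]
  exact mul_le_mul_of_nonneg_right (invForm_le_norm_invSqrt_mul_sq hp _) h0

/-- The energy measure is dominated by the sum of the gradient measures. The factor `d²` compares
the Frobenius norm with the operator norm. -/
lemma le_gradMeasure (hW : IsMatrixWeight W) :
    energyMeasure W ≤ ENNReal.ofReal (d ^ 2) • (gradMeasure W 1 + gradMeasure W Complex.I) := by
  refine Measure.le_iff.2 fun s hs => ?_
  have hH := hW.isDiscPositive
  rw [Measure.smul_apply, Measure.add_apply, energyMeasure, withDensity_apply _ hs,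
    Measure.restrict_restrict hs, smul_eq_mul, mul_add]
  refine le_trans ?_ (add_le_add (hW.setLIntegral_invForm_le 1 hs)
    (hW.setLIntegral_invForm_le Complex.I hs))
  rw [← lintegral_add_left']
  · refine setLIntegral_mono' (hs.inter measurableSet_ball) fun z hz => ?_
    have h0 : 0 ≤ 1 - ‖z‖ ^ 2 := by
      have := mem_ball_zero_iff.1 hz.2; nlinarith [norm_nonneg z]
    have hp := hH.twoRe_posDef hz.2
    rw [← ENNReal.ofReal_add (mul_nonneg h0 (invForm_nonneg hp _))
      (mul_nonneg h0 (invForm_nonneg hp _)), ← mul_add, energy, ← invForm_add_conjTranspose, one_smul]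
  · have h1 := hH.continuousOn_inv_twoRe
    have h2 := hH.differentiableOn_deriv.continuousOn
    have h3 : ContinuousOn (fun z => (1 : ℂ) • deriv (herglotzInt W) z +
        ((1 : ℂ) • deriv (herglotzInt W) z).conjTranspose) (ball 0 1) :=
      (h2.const_smul (1 : ℂ)).add (h2.const_smul (1 : ℂ)).star
    have hc : ContinuousOn (fun z => (1 - ‖z‖ ^ 2) * invForm (twoRe (herglotzInt W) z)
        ((1 : ℂ) • deriv (herglotzInt W) z + ((1 : ℂ) • deriv (herglotzInt W) z).conjTranspose))
        (ball 0 1) :=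
      ContinuousOn.mul (by fun_prop) (Complex.continuous_re.comp_continuousOn
        (continuous_matrix_trace.comp_continuousOn (((h1.mul h3).mul h1).mul h3.star)))
    exact ((hc.mono Set.inter_subset_right).aemeasurable
      (hs.inter measurableSet_ball)).ennreal_ofReal

/-- **Jensen's inequality**: the harmonic extension of `log det W` is dominated by `log det` of
the harmonic extension. -/
lemma harmonicExt_logDet_le (hW : IsMatrixWeight W) (hL : CircleIntegrable (logDet W) 0 1)
    {z : ℂ} (hz : z ∈ ball (0 : ℂ) 1) :
    harmonicExt (logDet W) z ≤ logDetRe (herglotzInt W) z := by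
  have hA := hW.harmonicExt_posDef hz
  rw [hW.logDetRe_herglotzInt hz]
  set A := harmonicExt W z with hAdef
  set T : Matrix (Fin d) (Fin d) ℂ →L[ℝ] ℝ := Complex.reCLM.comp
    ((LinearMap.toContinuousLinearMap ((Matrix.traceLinearMap (Fin d) ℂ ℂ).comp
      (LinearMap.mulLeft ℂ A⁻¹))).restrictScalars ℝ)
  have hT : ∀ M, T M = (Matrix.trace (A⁻¹ * M)).re := fun M => rfl
  have hTi : CircleIntegrable (fun ζ => T (W ζ)) 0 1 := by
    have := hW.integrable
    simp only [CircleIntegrable, intervalIntegrable_iff] at this ⊢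
    exact T.integrable_comp this
  have hci := circleIntegrable_const (Real.log A.det.re - d) (0 : ℂ) 1
  have h1 : harmonicExt (logDet W) z ≤
      harmonicExt (fun ζ => T (W ζ) + (Real.log A.det.re - d)) z := by
    refine circleAverage_mono_of_ae (circleIntegrable_poissonKernel_smul hL hz)
      (circleIntegrable_poissonKernel_smul (hTi.add hci) hz) (hW.posDef.mono fun θ hθ => ?_)
    refine smul_le_smul_of_nonneg_left ?_ (poissonKernel_pos hz θ).le
    simp only [hT, logDet]
    linarith [log_det_le_add_trace hA hθ]
  have h2 : harmonicExt (fun ζ => T (W ζ) + (Real.log A.det.re - d)) z =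
      harmonicExt (fun ζ => T (W ζ)) z + harmonicExt (fun _ => (Real.log A.det.re - d)) z := by
    simp only [harmonicExt, smul_add]
    exact circleAverage_fun_add (circleIntegrable_poissonKernel_smul hTi hz)
      (circleIntegrable_poissonKernel_smul hci hz)
  have h3 : harmonicExt (fun _ => (Real.log A.det.re - d)) z = Real.log A.det.re - d :=
    harmonicExt_const _ hz
  have h4 : harmonicExt (fun ζ => T (W ζ)) z = d := by
    rw [← continuousLinearMap_harmonicExt T hW.integrable hz, hT,
      Matrix.nonsing_inv_mul _ ((Matrix.isUnit_iff_isUnit_det _).1 hA.isUnit)]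
    simp
  linarith

end IsMatrixWeight

end

/-! ### Boundary values of Poisson integrals -/

section

variable {E : Type*} [NormedAddCommGroup E] [NormedSpace ℝ E]

lemma enorm_circleAverage_le (f : ℂ → E) (R : ℝ) :
    ‖circleAverage f 0 R‖ₑ ≤ ENNReal.ofReal (2 * π)⁻¹ *
      ∫⁻ φ in Set.Ioc 0 (2 * π), ‖f (circleMap 0 R φ)‖ₑ := by
  rw [circleAverage_def, enorm_smul, intervalIntegral.integral_of_le two_pi_pos.le,
    Real.enorm_of_nonneg (by positivity)]
  gcongr
  exact enorm_integral_le_lintegral_enorm _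

lemma poissonKernel_symm {r : ℝ} (θ φ : ℝ) :
    poissonKernel 0 (circleMap 0 r θ) (circleMap 0 1 φ) =
      poissonKernel 0 (circleMap 0 r φ) (circleMap 0 1 θ) := by
  have h : ∀ θ φ : ℝ, ‖circleMap 0 1 φ - circleMap 0 r θ‖ ^ 2 =
      1 + r ^ 2 - 2 * r * Real.cos (θ - φ) := fun θ φ => by
    rw [← Complex.normSq_eq_norm_sq, Complex.normSq_apply, Real.cos_sub]
    simp only [circleMap, zero_add, Complex.sub_re, Complex.sub_im, Complex.re_ofReal_mul,
      Complex.im_ofReal_mul, Complex.exp_ofReal_mul_I_re, Complex.exp_ofReal_mul_I_im]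
    nlinarith [Real.sin_sq_add_cos_sq θ, Real.sin_sq_add_cos_sq φ]
  simp only [poissonKernel_def, sub_zero, norm_circleMap_zero, h]
  rw [← Real.cos_neg (θ - φ), neg_sub]

lemma continuous_poissonKernel_circleMap {r : ℝ} (h0 : 0 ≤ r) (h1 : r < 1) :
    Continuous fun p : ℝ × ℝ => poissonKernel 0 (circleMap 0 r p.1) (circleMap 0 1 p.2) := by
  simp only [poissonKernel_def, sub_zero]
  refine Continuous.div (by fun_prop) (by fun_prop) fun p h => ?_
  have h2 := norm_eq_zero.1 (pow_eq_zero_iff two_ne_zero |>.1 h)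
  have h3 : ‖circleMap 0 1 p.2‖ = ‖circleMap 0 r p.1‖ := by rw [sub_eq_zero.1 h2]
  simp only [norm_circleMap_zero, abs_one, abs_of_nonneg h0] at h3
  linarith

lemma lintegral_poissonKernel {r : ℝ} (h0 : 0 ≤ r) (h1 : r < 1) (φ : ℝ) :
    ∫⁻ θ in Set.Ioc 0 (2 * π), ENNReal.ofReal
      (poissonKernel 0 (circleMap 0 r θ) (circleMap 0 1 φ)) = ENNReal.ofReal (2 * π) := by
  have hg := continuous_poissonKernel_circleMap h0 h1
  -- the joint kernel is abstracted so that unification does not unfold it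
  generalize hk : (fun p : ℝ × ℝ => poissonKernel 0 (circleMap 0 r p.1) (circleMap 0 1 p.2)) = g at hg
  have hc : Continuous fun θ => poissonKernel 0 (circleMap 0 r θ) (circleMap 0 1 φ) := by
    have e : (fun θ => poissonKernel 0 (circleMap 0 r θ) (circleMap 0 1 φ)) = fun θ => g (θ, φ) := by
      rw [← hk]
    rw [e]
    exact hg.comp (continuous_id.prodMk continuous_const)
  rw [← ofReal_integral_eq_lintegral_ofReal]
  · congr 1
    rw [← intervalIntegral.integral_of_le two_pi_pos.le]
    rw [show (fun θ => poissonKernel 0 (circleMap 0 r θ) (circleMap 0 1 φ)) =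
      fun θ => poissonKernel 0 (circleMap 0 r φ) (circleMap 0 1 θ) from
      funext fun θ => poissonKernel_symm θ φ]
    have h := harmonicExt_const 1 (circleMap_mem_ball_one h0 h1 φ)
    rw [harmonicExt, circleAverage_def, smul_eq_mul, inv_mul_eq_iff_eq_mul₀ two_pi_pos.ne'] at h
    simpa using h
  · exact (hc.integrableOn_Icc).mono_set Set.Ioc_subset_Icc_self
  · exact Eventually.of_forall fun θ => (poissonKernel_pos (circleMap_mem_ball_one h0 h1 θ) φ).le

/-- The Poisson integral is a contraction from `L¹` of the circle to `L¹` of smaller circles. -/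
lemma lintegral_enorm_harmonicExt_le {f : ℂ → E} (hf : CircleIntegrable f 0 1) {r : ℝ} (h0 : 0 ≤ r)
    (h1 : r < 1) :
    ∫⁻ θ in Set.Ioc 0 (2 * π), ‖harmonicExt f (circleMap 0 r θ)‖ₑ ≤
      ∫⁻ θ in Set.Ioc 0 (2 * π), ‖f (circleMap 0 1 θ)‖ₑ := by
  have hm : AEStronglyMeasurable (fun θ => f (circleMap 0 1 θ))
      (volume.restrict (Set.Ioc 0 (2 * π))) :=
    ((intervalIntegrable_iff_integrableOn_Ioc_of_le two_pi_pos.le).1 hf).aestronglyMeasurable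
  have hk : Measurable fun p : ℝ × ℝ =>
      ENNReal.ofReal (poissonKernel 0 (circleMap 0 r p.1) (circleMap 0 1 p.2)) :=
    (continuous_poissonKernel_circleMap h0 h1).measurable.ennreal_ofReal
  calc _ ≤ ∫⁻ θ in Set.Ioc 0 (2 * π), ENNReal.ofReal (2 * π)⁻¹ * ∫⁻ φ in Set.Ioc 0 (2 * π),
          ENNReal.ofReal (poissonKernel 0 (circleMap 0 r θ) (circleMap 0 1 φ)) *
            ‖f (circleMap 0 1 φ)‖ₑ := by
        refine lintegral_mono fun θ => (enorm_circleAverage_le _ _).trans_eq ?_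
        congr 1
        refine lintegral_congr fun φ => ?_
        rw [enorm_smul, Real.enorm_of_nonneg
          (poissonKernel_pos (circleMap_mem_ball_one h0 h1 θ) φ).le]
    _ = ENNReal.ofReal (2 * π)⁻¹ * ∫⁻ φ in Set.Ioc 0 (2 * π), ∫⁻ θ in Set.Ioc 0 (2 * π),
          ENNReal.ofReal (poissonKernel 0 (circleMap 0 r θ) (circleMap 0 1 φ)) *
            ‖f (circleMap 0 1 φ)‖ₑ := by
        rw [lintegral_const_mul' _ _ ENNReal.ofReal_ne_top, lintegral_lintegral_swap]
        exact hk.aemeasurable.mul (hm.enorm.comp_quasiMeasurePreserving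
          Measure.quasiMeasurePreserving_snd)
    _ = ENNReal.ofReal (2 * π)⁻¹ * ∫⁻ φ in Set.Ioc 0 (2 * π),
          ENNReal.ofReal (2 * π) * ‖f (circleMap 0 1 φ)‖ₑ := by
        congr 1
        refine lintegral_congr fun φ => ?_
        rw [lintegral_mul_const' _ _ enorm_ne_top, lintegral_poissonKernel h0 h1]
    _ = _ := by
        rw [lintegral_const_mul' _ _ ENNReal.ofReal_ne_top, ← mul_assoc,
          ← ENNReal.ofReal_mul (by positivity), inv_mul_cancel₀ two_pi_pos.ne', ENNReal.ofReal_one,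
          one_mul]

/-- Poisson integrals of uniformly continuous functions converge uniformly at the boundary. -/
lemma eventually_norm_harmonicExt_sub_le [CompleteSpace E] {k : ℂ → E} (hk : UniformContinuous k)
    {M : ℝ} (hM : ∀ z, ‖k z‖ ≤ M) {ε : ℝ} (hε : 0 < ε) :
    ∀ᶠ r in 𝓝[<] (1 : ℝ), ∀ θ, ‖harmonicExt k (circleMap 0 r θ) - k (circleMap 0 1 θ)‖ ≤ ε := by
  obtain ⟨δ, hδ, hδk⟩ := Metric.uniformContinuous_iff.1 hk (ε / 2) (by positivity)
  have hM0 : 0 ≤ M := (norm_nonneg _).trans (hM 0)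
  have hlim : Tendsto (fun r : ℝ => (1 - r ^ 2) * (4 / δ ^ 2) * (2 * M)) (𝓝[<] 1) (𝓝 0) := by
    have : Continuous fun r : ℝ => (1 - r ^ 2) * (4 / δ ^ 2) * (2 * M) := by fun_prop
    have h := this.tendsto 1
    simp only [one_pow, sub_self, zero_mul] at h
    exact h.mono_left nhdsWithin_le_nhds
  have e1 : ∀ᶠ r in 𝓝[<] (1 : ℝ), max 0 (1 - δ / 2) < r :=
    nhdsWithin_le_nhds (Ioi_mem_nhds (by simp [hδ]))
  filter_upwards [hlim.eventually_lt_const (half_pos hε), e1, self_mem_nhdsWithin] with r hr1 hr2 hr3 θ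
  have hr3' : r < 1 := hr3
  have h0 : 0 ≤ r := (le_max_left _ _).trans hr2.le
  have hr2' : 1 - δ / 2 < r := (le_max_right _ _).trans_lt hr2
  set z := circleMap 0 r θ
  set ζ := circleMap 0 1 θ
  have hz : z ∈ ball (0 : ℂ) 1 := circleMap_mem_ball_one h0 hr3' θ
  have hki : CircleIntegrable k 0 1 := hk.continuous.continuousOn.circleIntegrable'
  have hki' : CircleIntegrable (fun η => ‖k η - k ζ‖) 0 1 :=
    (hk.continuous.sub continuous_const).norm.continuousOn.circleIntegrable'
  have hci : CircleIntegrable (fun _ => (1 : ℝ)) 0 1 := circleIntegrable_const _ _ _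
  have hone : circleAverage (fun η => poissonKernel 0 z η • (1 : ℝ)) 0 1 = 1 :=
    harmonicExt_const 1 hz
  have hd : harmonicExt k z - k ζ = circleAverage (fun η => poissonKernel 0 z η • (k η - k ζ)) 0 1 := by
    have e : circleAverage (fun η => poissonKernel 0 z η • k ζ) 0 1 = k ζ := by
      have h := ((1 : ℝ →L[ℝ] ℝ).smulRight (k ζ)).circleAverage_comp_comm
        (circleIntegrable_poissonKernel_smul hci hz)
      rw [hone] at h
      simpa [Function.comp_def] using h
    conv_lhs => rw [← e]
    rw [harmonicExt, ← circleAverage_fun_sub (circleIntegrable_poissonKernel_smul hki hz)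
      (circleIntegrable_poissonKernel_smul (circleIntegrable_const _ _ _) hz)]
    simp only [smul_sub]
  -- split the kernel: near `ζ` use uniform continuity, away from `ζ` the kernel is small
  have hpt : ∀ φ, ‖poissonKernel 0 z (circleMap 0 1 φ) • (k (circleMap 0 1 φ) - k ζ)‖ ≤
      poissonKernel 0 z (circleMap 0 1 φ) * (ε / 2) + ε / 2 := fun φ => by
    have hp := poissonKernel_pos hz φ
    rw [norm_smul, Real.norm_of_nonneg hp.le]
    by_cases hφ : dist (circleMap 0 1 φ) ζ < δ
    · have := (hδk hφ).le
      rw [dist_eq_norm] at this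
      have := mul_le_mul_of_nonneg_left this hp.le
      linarith
    · have h1 : ‖k (circleMap 0 1 φ) - k ζ‖ ≤ 2 * M := by
        refine (norm_sub_le _ _).trans ?_
        linarith [hM (circleMap 0 1 φ), hM ζ]
      have h2 : poissonKernel 0 z (circleMap 0 1 φ) ≤ (1 - r ^ 2) * (4 / δ ^ 2) := by
        have hzζ : ‖z - ζ‖ = 1 - r := by
          rw [show z - ζ = ((r - 1 : ℝ) : ℂ) * ζ by
            simp only [z, ζ]; rw [circleMap_zero_eq_mul]; push_cast; ring, norm_mul,
            Complex.norm_real, norm_circleMap_zero, abs_one, mul_one, Real.norm_of_nonpos (by linarith)]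
          ring
        have h3 : δ / 2 ≤ ‖circleMap 0 1 φ - z‖ := by
          have := dist_triangle (circleMap 0 1 φ) z ζ
          rw [dist_eq_norm _ z, dist_eq_norm z, hzζ] at this
          linarith
        have hz2 : ‖z‖ = r := by rw [norm_circleMap_zero, abs_of_nonneg h0]
        rw [poissonKernel_def, sub_zero, sub_zero, norm_circleMap_zero, hz2, abs_one, one_pow,
          div_eq_mul_inv]
        have h4 : 0 ≤ 1 - r ^ 2 := by nlinarith
        refine mul_le_mul_of_nonneg_left ?_ h4
        rw [← inv_div]
        refine inv_anti₀ (by positivity) ?_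
        calc δ ^ 2 / 4 = (δ / 2) ^ 2 := by ring
          _ ≤ _ := by gcongr
      have h5 := mul_le_mul h2 h1 (norm_nonneg _) (hp.le.trans h2)
      have h6 : 0 ≤ poissonKernel 0 z (circleMap 0 1 φ) * (ε / 2) := by positivity
      linarith
  rw [hd]
  have hPi : CircleIntegrable (fun η => poissonKernel 0 z η * (ε / 2)) 0 1 :=
    circleIntegrable_poissonKernel_smul (circleIntegrable_const (ε / 2) _ _) hz
  have hfin : circleAverage (fun η => poissonKernel 0 z η * (ε / 2) + ε / 2) 0 1 = ε := by
    rw [circleAverage_fun_add hPi (circleIntegrable_const _ _ _), circleAverage_const]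
    have := harmonicExt_const (ε / 2) hz
    rw [harmonicExt] at this
    simp only [smul_eq_mul] at this
    rw [this]; ring
  rw [← hfin, circleAverage_def, circleAverage_def, norm_smul, Real.norm_of_nonneg (by positivity),
    smul_eq_mul]
  gcongr
  exact intervalIntegral.norm_integral_le_of_norm_le two_pi_pos.le
    (Eventually.of_forall fun φ _ => hpt φ) (hPi.add (circleIntegrable_const _ _ _))

/-- Functions continuous on the plane are dense in `L¹` of the circle. -/
lemma exists_continuous_lintegral_circle_sub_le {f : ℂ → E} (hf : CircleIntegrable f 0 1)
    {ε : ℝ≥0∞} (hε : ε ≠ 0) :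
    ∃ k : ℂ → E, Continuous k ∧ HasCompactSupport k ∧
      ∫⁻ θ in Set.Ioc 0 (2 * π), ‖f (circleMap 0 1 θ) - k (circleMap 0 1 θ)‖ₑ ≤ ε := by
  set e : Set.Ioc (0 : ℝ) (2 * π) → ℂ := fun θ => circleMap 0 1 θ
  have hemb : MeasurableEmbedding e := by
    refine (continuous_circleMap 0 1).continuousOn.measurableEmbedding measurableSet_Ioc ?_
    have h := injOn_circleMap_of_abs_sub_le (c := 0) (R := 1) (a := 0) (b := 2 * π) one_ne_zero
      (by rw [zero_sub, abs_neg, abs_of_pos two_pi_pos])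
    rwa [Set.uIoc_of_le two_pi_pos.le] at h
  set ν : Measure ℂ := Measure.map e (Measure.comap Subtype.val volume)
  have hcv : ∀ g : ℂ → ℝ≥0∞, ∫⁻ z, g z ∂ν = ∫⁻ θ in Set.Ioc 0 (2 * π), g (circleMap 0 1 θ) := by
    intro g
    rw [hemb.lintegral_map]
    exact lintegral_subtype_comap measurableSet_Ioc (fun θ => g (circleMap 0 1 θ))
  have : IsFiniteMeasure ν := ⟨by
    have := hcv 1
    simp only [Pi.one_apply, lintegral_one, Measure.restrict_apply_univ] at this
    rw [this, Real.volume_Ioc]; exact ENNReal.ofReal_lt_top⟩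
  have hfν : Integrable f ν := by
    rw [hemb.integrable_map_iff]
    have := (intervalIntegrable_iff_integrableOn_Ioc_of_le two_pi_pos.le).1 hf
    exact (integrableOn_iff_comap_subtypeVal measurableSet_Ioc).1 this
  obtain ⟨k, hk1, hk2, hk3, -⟩ := hfν.exists_hasCompactSupport_lintegral_sub_le hε
  exact ⟨k, hk3, hk1, (hcv _).symm.trans_le hk2⟩

/-- Dilates of the Poisson integral converge to the boundary function in `L¹`. -/
lemma tendsto_lintegral_enorm_harmonicExt_sub [CompleteSpace E] {f : ℂ → E}
    (hf : CircleIntegrable f 0 1) :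
    Tendsto (fun r : ℝ => ∫⁻ θ in Set.Ioc 0 (2 * π),
      ‖harmonicExt f (circleMap 0 r θ) - f (circleMap 0 1 θ)‖ₑ) (𝓝[<] 1) (𝓝 0) := by
  rw [ENNReal.tendsto_nhds_zero]
  intro ε hε
  -- the minimum with `1` keeps `η` finite
  set η : ℝ≥0∞ := min ε 1 / 4 with hη
  have hη0 : η ≠ 0 := by
    simp [hη, hε.ne']
  have hηtop : η ≠ ⊤ := by
    refine ne_top_of_le_ne_top ENNReal.one_ne_top ?_
    calc η ≤ min ε 1 := ENNReal.div_le_of_le_mul (by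
          calc min ε 1 = min ε 1 * 1 := (mul_one _).symm
            _ ≤ min ε 1 * 4 := by gcongr; norm_num)
      _ ≤ 1 := min_le_right _ _
  obtain ⟨k, hkc, hks, hk⟩ := exists_continuous_lintegral_circle_sub_le hf hη0
  obtain ⟨M, hM⟩ := hks.exists_bound_of_continuous hkc
  have hki : CircleIntegrable k 0 1 := hkc.continuousOn.circleIntegrable'
  have hηr : 0 < η.toReal / (2 * π) := div_pos (ENNReal.toReal_pos hη0 hηtop) two_pi_pos
  have hr0 : ∀ᶠ r in 𝓝[<] (1 : ℝ), 0 < r := nhdsWithin_le_nhds (Ioi_mem_nhds one_pos)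
  filter_upwards [eventually_norm_harmonicExt_sub_le
    (hks.uniformContinuous_of_continuous hkc) hM hηr, hr0, self_mem_nhdsWithin] with r hr h0 h1
  have h1' : r < 1 := h1
  have hm : AEStronglyMeasurable (fun θ => f (circleMap 0 1 θ))
      (volume.restrict (Set.Ioc 0 (2 * π))) :=
    ((intervalIntegrable_iff_integrableOn_Ioc_of_le two_pi_pos.le).1 hf).aestronglyMeasurable
  have hmk : Continuous (fun θ => k (circleMap 0 1 θ)) := hkc.comp (continuous_circleMap 0 1)
  calc _ ≤ ∫⁻ θ in Set.Ioc 0 (2 * π), (‖harmonicExt (fun ζ => f ζ - k ζ) (circleMap 0 r θ)‖ₑ +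
        (ENNReal.ofReal (η.toReal / (2 * π)) + ‖f (circleMap 0 1 θ) - k (circleMap 0 1 θ)‖ₑ)) := by
        refine lintegral_mono fun θ => ?_
        have hz := circleMap_mem_ball_one h0.le h1' θ
        have e : harmonicExt (fun ζ => f ζ - k ζ) (circleMap 0 r θ) =
            harmonicExt f (circleMap 0 r θ) - harmonicExt k (circleMap 0 r θ) := by
          simp only [harmonicExt, smul_sub]
          exact circleAverage_fun_sub (circleIntegrable_poissonKernel_smul hf hz)
            (circleIntegrable_poissonKernel_smul hki hz)
        have e2 : harmonicExt f (circleMap 0 r θ) - f (circleMap 0 1 θ) =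
            harmonicExt (fun ζ => f ζ - k ζ) (circleMap 0 r θ) +
            ((harmonicExt k (circleMap 0 r θ) - k (circleMap 0 1 θ)) -
              (f (circleMap 0 1 θ) - k (circleMap 0 1 θ))) := by rw [e]; abel
        rw [e2]
        refine (enorm_add_le _ _).trans (add_le_add le_rfl ((enorm_sub_le).trans
          (add_le_add ?_ le_rfl)))
        rw [← ofReal_norm]
        exact ENNReal.ofReal_le_ofReal (hr θ)
    _ = (∫⁻ θ in Set.Ioc 0 (2 * π), ‖harmonicExt (fun ζ => f ζ - k ζ) (circleMap 0 r θ)‖ₑ) +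
        ((∫⁻ θ in Set.Ioc 0 (2 * π), ENNReal.ofReal (η.toReal / (2 * π))) +
          ∫⁻ θ in Set.Ioc 0 (2 * π), ‖f (circleMap 0 1 θ) - k (circleMap 0 1 θ)‖ₑ) := by
        have hmm : AEMeasurable (fun θ => ‖f (circleMap 0 1 θ) - k (circleMap 0 1 θ)‖ₑ)
            (volume.restrict (Set.Ioc 0 (2 * π))) := (hm.sub hmk.aestronglyMeasurable).enorm
        rw [lintegral_add_right' _ (by exact aemeasurable_const.add hmm), lintegral_add_left measurable_const]
    _ ≤ η + (η + η) := by
        gcongr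
        · exact (lintegral_enorm_harmonicExt_le (hf.sub hki) h0.le h1').trans hk
        · rw [setLIntegral_const, Real.volume_Ioc, sub_zero, ← ENNReal.ofReal_mul hηr.le,
            div_mul_cancel₀ _ two_pi_pos.ne', ENNReal.ofReal_toReal hηtop]
    _ ≤ 4 * η := by
        rw [show (4 : ℝ≥0∞) * η = η + (η + η) + η by ring]; exact le_self_add
    _ ≤ ε := by
        rw [hη, ENNReal.mul_div_cancel (by norm_num) (by norm_num)]; exact min_le_left _ _

end

/-! ### Upper semicontinuity at the boundary -/

section

variable {d : ℕ}

lemma circleAverage_harmonicExt {f : ℂ → ℝ} (hf : CircleIntegrable f 0 1) {R : ℝ} (hR0 : 0 < R)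
    (hR : R < 1) : circleAverage (harmonicExt f) 0 R = harmonicExt f 0 := by
  rw [← circleAverage_harmonicExt_mobius hf (a := 0) (by simp) hR0 hR, ← circleAverage_neg_radius,
    circleAverage_def, circleAverage_def]
  simp [mobius, circleMap]

/-- Along a sequence of radii the Poisson integral converges almost everywhere to the boundary
function. -/
lemma exists_seq_tendsto_harmonicExt {E : Type*} [NormedAddCommGroup E] [NormedSpace ℝ E]
    [CompleteSpace E] {f : ℂ → E} (hf : CircleIntegrable f 0 1)
    (hc : ContinuousOn (harmonicExt f) (ball 0 1)) :
    ∃ r : ℕ → ℝ, Tendsto r atTop (𝓝[<] 1) ∧ (∀ n, 7 / 8 ≤ r n ∧ r n < 1) ∧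
      ∀ᵐ θ ∂volume.restrict (Set.Ioc 0 (2 * π)),
        Tendsto (fun n => harmonicExt f (circleMap 0 (r n) θ)) atTop (𝓝 (f (circleMap 0 1 θ))) := by
  obtain ⟨R, -, hRI, hRt⟩ := exists_seq_strictMono_tendsto' (show (7 / 8 : ℝ) < 1 by norm_num)
  have hR1 : Tendsto R atTop (𝓝[<] 1) :=
    tendsto_nhdsWithin_iff.2 ⟨hRt, Eventually.of_forall fun n => (hRI n).2⟩
  have hm : AEStronglyMeasurable (fun θ => f (circleMap 0 1 θ))
      (volume.restrict (Set.Ioc 0 (2 * π))) :=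
    ((intervalIntegrable_iff_integrableOn_Ioc_of_le two_pi_pos.le).1 hf).aestronglyMeasurable
  have hcont : ∀ n, Continuous fun θ => harmonicExt f (circleMap 0 (R n) θ) := fun n =>
    continuous_comp_circleMap hc (by linarith [(hRI n).1]) (hRI n).2
  have hL := (tendsto_lintegral_enorm_harmonicExt_sub hf).comp hR1
  have hM : TendstoInMeasure (volume.restrict (Set.Ioc 0 (2 * π)))
      (fun n θ => harmonicExt f (circleMap 0 (R n) θ)) atTop (fun θ => f (circleMap 0 1 θ)) := by
    refine tendstoInMeasure_of_tendsto_eLpNorm one_ne_zero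
      (fun n => (hcont n).aestronglyMeasurable) hm ?_
    simp only [eLpNorm_one_eq_lintegral_enorm]
    exact hL
  obtain ⟨ns, hns, hae⟩ := hM.exists_seq_tendsto_ae
  exact ⟨fun n => R (ns n), hR1.comp hns.tendsto_atTop, fun n =>
    ⟨(hRI (ns n)).1.le, (hRI (ns n)).2⟩, hae⟩

namespace IsMatrixWeight

variable {W : ℂ → Matrix (Fin d) (Fin d) ℂ}

/-- Upper semicontinuity at the boundary: the limit of the averages of `log det` of the harmonic
extension over circles of radius `r → 1` does not exceed the average of `log det W`. The proof is
Fatou's lemma for the nonnegative functions `tr A - log det A`. Only radii from `7 / 8` on, where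
the energy bound of the Jensen gap is available, enter the hypothesis. -/
lemma le_circleAverage_logDet (hW : IsMatrixWeight W) {c : ℝ}
    (hc : ∀ r, 7 / 8 ≤ r → r < 1 → c ≤ circleAverage (logDetRe (herglotzInt W)) 0 r) :
    CircleIntegrable (logDet W) 0 1 ∧ c ≤ circleAverage (logDet W) 0 1 := by
  set ν := volume.restrict (Set.Ioc 0 (2 * π)) with hν
  have hH := hW.isDiscPositive
  have hcV : ContinuousOn (harmonicExt W) (ball 0 1) :=
    hH.continuousOn_twoRe.congr fun z hz => (hW.twoRe_herglotzInt hz).symm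
  obtain ⟨r, -, hr, hae⟩ := exists_seq_tendsto_harmonicExt hW.integrable hcV
  have hr0 : ∀ n, 0 ≤ r n := fun n => by linarith [(hr n).1]
  set T : Matrix (Fin d) (Fin d) ℂ →L[ℝ] ℝ := Complex.reCLM.comp
    ((LinearMap.toContinuousLinearMap (Matrix.traceLinearMap (Fin d) ℂ ℂ)).restrictScalars ℝ)
  have hT : ∀ M, T M = (Matrix.trace M).re := fun M => rfl
  have hTi : CircleIntegrable (fun ζ => T (W ζ)) 0 1 := by
    have := hW.integrable
    simp only [CircleIntegrable, intervalIntegrable_iff] at this ⊢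
    exact T.integrable_comp this
  set t : ℝ := circleAverage (fun ζ => T (W ζ)) 0 1 with ht
  have hTV : ∀ z ∈ ball (0 : ℂ) 1, T (harmonicExt W z) = harmonicExt (fun ζ => T (W ζ)) z :=
    fun z hz => continuousLinearMap_harmonicExt T hW.integrable hz
  -- the nonnegative functions to which Fatou's lemma is applied
  set q : Matrix (Fin d) (Fin d) ℂ → ℝ := fun A => T A - Real.log A.det.re
  have hq0 : ∀ A : Matrix (Fin d) (Fin d) ℂ, A.PosDef → 0 ≤ q A := fun A hA => by
    have := log_det_le_trace_sub hA
    have hd : (0 : ℝ) ≤ d := d.cast_nonneg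
    simp only [q, hT]; linarith
  have hqc : ∀ A : Matrix (Fin d) (Fin d) ℂ, A.PosDef → ContinuousAt q A := fun A hA => by
    refine T.continuous.continuousAt.sub (ContinuousAt.log ?_ hA.det_re_pos.ne')
    exact (Complex.continuous_re.comp (continuous_id.matrix_det)).continuousAt
  have hVpd : ∀ n θ, (harmonicExt W (circleMap 0 (r n) θ)).PosDef := fun n θ =>
    hW.harmonicExt_posDef (circleMap_mem_ball_one (hr0 n) (hr n).2 θ)
  have hqV : ContinuousOn (fun z => q (harmonicExt W z)) (ball 0 1) := fun z hz =>
    ContinuousAt.comp_continuousWithinAt (hqc _ (hW.harmonicExt_posDef hz)) (hcV z hz)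
  have hqVc : ∀ n, Continuous fun θ => q (harmonicExt W (circleMap 0 (r n) θ)) := fun n =>
    continuous_comp_circleMap hqV (hr0 n) (hr n).2
  have hWpd : ∀ᵐ θ ∂ν, (W (circleMap 0 1 θ)).PosDef := ae_restrict_of_ae hW.posDef
  have hlim : ∀ᵐ θ ∂ν, Tendsto (fun n => q (harmonicExt W (circleMap 0 (r n) θ))) atTop
      (𝓝 (q (W (circleMap 0 1 θ)))) := by
    filter_upwards [hae, hWpd] with θ h1 h2
    exact (hqc _ h2).tendsto.comp h1
  have hqm : AEStronglyMeasurable (fun θ => q (W (circleMap 0 1 θ))) ν :=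
    aestronglyMeasurable_of_tendsto_ae atTop (fun n => (hqVc n).aestronglyMeasurable) hlim
  have hqW0 : 0 ≤ᵐ[ν] fun θ => q (W (circleMap 0 1 θ)) := hWpd.mono fun θ h => hq0 _ h
  have havg : ∀ n, circleAverage (fun z => q (harmonicExt W z)) 0 (r n) ≤ t - c := fun n => by
    have h0 : 0 < r n := by linarith [(hr n).1]
    have hTc : ContinuousOn (fun z => T (harmonicExt W z)) (ball 0 1) :=
      T.continuous.comp_continuousOn hcV
    have e1 : circleAverage (fun z => T (harmonicExt W z)) 0 (r n) = t := by
      rw [ht, ← harmonicExt_zero_eq, ← circleAverage_harmonicExt hTi h0 (hr n).2]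
      refine circleAverage_congr_sphere fun z hz => hTV z ?_
      rw [abs_of_pos h0, mem_sphere_zero_iff_norm] at hz
      rw [mem_ball_zero_iff, hz]; exact (hr n).2
    have e2 : circleAverage (fun z => q (harmonicExt W z)) 0 (r n) =
        circleAverage (fun z => T (harmonicExt W z) - logDetRe (herglotzInt W) z) 0 (r n) := by
      refine circleAverage_congr_sphere fun z hz => ?_
      rw [abs_of_pos h0, mem_sphere_zero_iff_norm] at hz
      simp only [q]
      rw [hW.logDetRe_herglotzInt (by rw [mem_ball_zero_iff, hz]; exact (hr n).2)]
    rw [e2, circleAverage_fun_sub (circleIntegrable_of_continuousOn_ball hTc h0.le (hr n).2)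
      (circleIntegrable_of_continuousOn_ball hH.continuousOn_logDetRe h0.le (hr n).2), e1]
    linarith [hc (r n) (hr n).1 (hr n).2]
  have hint : ∀ n, ∫⁻ θ, ENNReal.ofReal (q (harmonicExt W (circleMap 0 (r n) θ))) ∂ν ≤
      ENNReal.ofReal (2 * π * (t - c)) := fun n => by
    rw [← ofReal_integral_eq_lintegral_ofReal
      (((hqVc n).integrableOn_Icc).mono_set Set.Ioc_subset_Icc_self)
      (Eventually.of_forall fun θ => hq0 _ (hVpd n θ))]
    refine ENNReal.ofReal_le_ofReal ?_
    have h := havg n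
    rw [circleAverage_def, smul_eq_mul, inv_mul_le_iff₀ two_pi_pos,
      intervalIntegral.integral_of_le two_pi_pos.le] at h
    exact h
  have hfatou : ∫⁻ θ, ENNReal.ofReal (q (W (circleMap 0 1 θ))) ∂ν ≤
      ENNReal.ofReal (2 * π * (t - c)) := by
    calc _ = ∫⁻ θ, liminf (fun n => ENNReal.ofReal
            (q (harmonicExt W (circleMap 0 (r n) θ)))) atTop ∂ν :=
          lintegral_congr_ae (hlim.mono fun θ h =>
            ((ENNReal.continuous_ofReal.tendsto _).comp h).liminf_eq.symm)
      _ ≤ liminf (fun n => ∫⁻ θ, ENNReal.ofReal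
            (q (harmonicExt W (circleMap 0 (r n) θ))) ∂ν) atTop :=
          lintegral_liminf_le' fun n => (hqVc n).measurable.ennreal_ofReal.aemeasurable
      _ ≤ _ := liminf_le_of_frequently_le' (Eventually.of_forall hint).frequently
  have hqi : Integrable (fun θ => q (W (circleMap 0 1 θ))) ν := by
    refine ⟨hqm, ?_⟩
    rw [hasFiniteIntegral_iff_ofReal hqW0]
    exact hfatou.trans_lt ENNReal.ofReal_lt_top
  have hqci : CircleIntegrable (fun ζ => q (W ζ)) 0 1 :=
    (intervalIntegrable_iff_integrableOn_Ioc_of_le two_pi_pos.le).2 hqi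
  have hld : logDet W = fun ζ => T (W ζ) - q (W ζ) := by
    funext ζ; simp [q, logDet]
  have htc : 0 ≤ t - c := by
    refine le_trans ?_ (havg 0)
    rw [circleAverage_def]
    exact smul_nonneg (by positivity) (intervalIntegral.integral_nonneg two_pi_pos.le
      fun θ _ => hq0 _ (hVpd 0 θ))
  refine ⟨hld ▸ hTi.sub hqci, ?_⟩
  have h1 : circleAverage (fun ζ => q (W ζ)) 0 1 ≤ t - c := by
    rw [circleAverage_def, smul_eq_mul, inv_mul_le_iff₀ two_pi_pos,
      intervalIntegral.integral_of_le two_pi_pos.le, integral_eq_lintegral_of_nonneg_ae hqW0 hqm]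
    exact ENNReal.toReal_le_of_le_ofReal (by positivity) hfatou
  rw [hld, circleAverage_fun_sub hTi hqci]
  linarith

end IsMatrixWeight

end

/-! ### Jensen gap and energy at an arbitrary point of the disk -/

section

variable {d : ℕ}

lemma norm_one_sub_conj_mul_le {a z : ℂ} (ha : ‖a‖ ≤ 1) (hz : ‖z‖ ≤ 1) :
    ‖1 - (starRingEnd ℂ) a * z‖ ≤ 2 := by
  refine (norm_sub_le _ _).trans ?_
  rw [norm_one, norm_mul, RCLike.norm_conj]
  nlinarith [norm_nonneg a, norm_nonneg z]

lemma one_sub_le_norm_one_sub_conj_mul {a z : ℂ} (hz : ‖z‖ ≤ 1) :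
    1 - ‖a‖ ≤ ‖1 - (starRingEnd ℂ) a * z‖ := by
  have h := norm_sub_norm_le 1 ((starRingEnd ℂ) a * z)
  rw [norm_one, norm_mul, RCLike.norm_conj] at h
  nlinarith [norm_nonneg a, norm_nonneg z]

lemma le_norm_mobiusDeriv_sq {a z : ℂ} (ha : ‖a‖ < 1) (hz : z ∈ ball (0 : ℂ) 1) :
    ((1 - ‖a‖ ^ 2) / 4) ^ 2 ≤ ‖mobiusDeriv a z‖ ^ 2 := by
  have hz' := (mem_ball_zero_iff.1 hz).le
  have h1 : 0 < 1 - ‖a‖ ^ 2 := by nlinarith [norm_nonneg a]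
  have h2 : ‖1 - (starRingEnd ℂ) a * a‖ = 1 - ‖a‖ ^ 2 := by
    rw [Complex.conj_mul', ← Complex.ofReal_pow, ← Complex.ofReal_one, ← Complex.ofReal_sub,
      Complex.norm_real, Real.norm_of_nonneg h1.le]
  have h3 : 0 < ‖1 - (starRingEnd ℂ) a * z‖ := norm_pos_iff.2 (one_sub_conj_mul_ne_zero ha hz')
  have h4 := norm_one_sub_conj_mul_le ha.le hz'
  rw [mobiusDeriv, norm_neg, norm_div, norm_pow, h2]
  gcongr
  nlinarith

lemma one_sub_norm_mobius_sq_le {a z : ℂ} (ha : ‖a‖ < 1) (hz : ‖z‖ ≤ 1) :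
    1 - ‖mobius a z‖ ^ 2 ≤ (1 - ‖a‖ ^ 2) / (1 - ‖a‖) ^ 2 * (1 - ‖z‖ ^ 2) := by
  rw [one_sub_norm_mobius_sq ha hz, mul_div_right_comm]
  have h1 : 0 ≤ 1 - ‖a‖ ^ 2 := by nlinarith [norm_nonneg a]
  have h2 : 0 ≤ 1 - ‖z‖ ^ 2 := by nlinarith [norm_nonneg z]
  have h3 : 0 < 1 - ‖a‖ := by linarith
  have h4 := one_sub_le_norm_one_sub_conj_mul (a := a) hz
  gcongr

lemma le_one_sub_norm_mobius_sq {a z : ℂ} (ha : ‖a‖ < 1) (hz : ‖z‖ ≤ 1) :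
    (1 - ‖a‖ ^ 2) / 4 * (1 - ‖z‖ ^ 2) ≤ 1 - ‖mobius a z‖ ^ 2 := by
  rw [one_sub_norm_mobius_sq ha hz, mul_div_right_comm]
  have h1 : 0 ≤ 1 - ‖a‖ ^ 2 := by nlinarith [norm_nonneg a]
  have h2 : 0 ≤ 1 - ‖z‖ ^ 2 := by nlinarith [norm_nonneg z]
  have h3 : 0 < ‖1 - (starRingEnd ℂ) a * z‖ := norm_pos_iff.2 (one_sub_conj_mul_ne_zero ha hz)
  have h4 := norm_one_sub_conj_mul_le ha.le hz
  gcongr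
  nlinarith

lemma continuousOn_mobius {a : ℂ} (ha : ‖a‖ < 1) : ContinuousOn (mobius a) (ball 0 1) :=
  fun _ hz => (hasDerivAt_mobius ha hz).continuousAt.continuousWithinAt

/-- Automorphisms distort thin annuli at the boundary by a bounded factor. -/
lemma mobius_image_annulus_subset {a : ℂ} (ha : ‖a‖ < 1) {r R : ℝ} (hR0 : 0 ≤ R)
    (hR : R < 1) : mobius a '' annulus r R ⊆
      annulus (1 - 2 * ((1 - ‖a‖ ^ 2) / (1 - ‖a‖) ^ 2) * (1 - r))
        (Real.sqrt (1 - (1 - ‖a‖ ^ 2) / 4 * (1 - R ^ 2))) := by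
  set Q := (1 - ‖a‖ ^ 2) / (1 - ‖a‖) ^ 2
  set m := (1 - ‖a‖ ^ 2) / 4
  have h1a : 0 < 1 - ‖a‖ ^ 2 := by nlinarith [norm_nonneg a]
  have hQ : 0 < Q := div_pos h1a (pow_pos (by linarith) 2)
  have hm : 0 < m := by positivity
  rintro _ ⟨z, hz, rfl⟩
  have hzb : ‖z‖ < 1 := hz.2.trans_lt hR
  have hwb := mem_ball_zero_iff.1 (mobius_mem_ball ha (mem_ball_zero_iff.2 hzb))
  have h1 : 1 - ‖mobius a z‖ ^ 2 ≤ Q * (1 - ‖z‖ ^ 2) := one_sub_norm_mobius_sq_le ha hzb.le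
  have h2 : m * (1 - ‖z‖ ^ 2) ≤ 1 - ‖mobius a z‖ ^ 2 := le_one_sub_norm_mobius_sq ha hzb.le
  have hz1 : r < ‖z‖ := hz.1
  have hz2 : ‖z‖ ≤ R := hz.2
  constructor
  · have h3 : 1 - ‖z‖ ^ 2 < 2 * (1 - r) := by nlinarith [norm_nonneg z]
    have h4 := mul_lt_mul_of_pos_left h3 hQ
    have h5 : ‖mobius a z‖ ^ 2 ≤ ‖mobius a z‖ := by nlinarith [norm_nonneg (mobius a z)]
    linarith
  · refine Real.le_sqrt_of_sq_le ?_
    have h3 : 1 - R ^ 2 ≤ 1 - ‖z‖ ^ 2 := by nlinarith [norm_nonneg z]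
    have h4 := mul_le_mul_of_nonneg_left h3 hm.le
    linarith

lemma le_integral_mul_circleAverage {u : ℂ → ℝ} (hu : ContinuousOn u (ball 0 1)) {c r R : ℝ}
    (hc0 : 0 ≤ c) (hr : 7 / 8 ≤ r) (hrR : r ≤ R) (hR : R < 1)
    (hc : ∀ s ∈ Set.Icc r R, c ≤ circleAverage u 0 s) :
    c * (7 / 8) * (R - r) ≤ ∫ s in r..R, s * circleAverage u 0 s := by
  have h := intervalIntegral.integral_mono_on (a := r) (b := R) (μ := volume)
    (f := fun _ => c * (7 / 8)) (g := fun s => s * circleAverage u 0 s) hrR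
    intervalIntegrable_const ((continuousOn_id.mul
      ((continuousOn_circleAverage hu hR).mono
        (Set.Icc_subset_Icc_left (by linarith)))).intervalIntegrable_of_Icc hrR) fun s hs => by
      have h2 : (7 / 8 : ℝ) ≤ s := hr.trans hs.1
      rw [mul_comm s]
      exact mul_le_mul (hc s hs) h2 (by norm_num) (hc0.trans (hc s hs))
  rw [intervalIntegral.integral_const, smul_eq_mul] at h
  linarith

lemma integral_mul_circleAverage_le {u : ℂ → ℝ} (hu : ContinuousOn u (ball 0 1)) {ε r R : ℝ}
    (hε : 0 ≤ ε) (hr : 0 ≤ r) (hrR : r ≤ R) (hR : R < 1)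
    (h : ∀ s ∈ Set.Icc r R, circleAverage u 0 s ≤ ε) :
    ∫ s in r..R, s * circleAverage u 0 s ≤ ε * (R - r) := by
  have h := intervalIntegral.integral_mono_on (a := r) (b := R) (μ := volume)
    (g := fun _ => ε) (f := fun s => s * circleAverage u 0 s) hrR ((continuousOn_id.mul
      ((continuousOn_circleAverage hu hR).mono
        (Set.Icc_subset_Icc_left hr))).intervalIntegrable_of_Icc hrR)
    intervalIntegrable_const fun s hs => by
      have h2 : 0 ≤ s := hr.trans hs.1
      have h3 : s ≤ 1 := (hs.2.trans_lt hR).le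
      calc s * circleAverage u 0 s ≤ s * ε := mul_le_mul_of_nonneg_left (h s hs) h2
        _ ≤ 1 * ε := mul_le_mul_of_nonneg_right h3 hε
        _ = ε := one_mul _
  rw [intervalIntegral.integral_const, smul_eq_mul] at h
  linarith

lemma setLIntegral_comp_mobius_le (u : ℂ → ℝ) {a : ℂ} (ha : ‖a‖ < 1) {r R r' R' : ℝ} (hR : R < 1)
    (hsub : mobius a '' annulus r R ⊆ annulus r' R') :
    ENNReal.ofReal (((1 - ‖a‖ ^ 2) / 4) ^ 2) *
      ∫⁻ z in annulus r R, ENNReal.ofReal (u (mobius a z)) ≤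
      ∫⁻ w in annulus r' R', ENNReal.ofReal (u w) := by
  have hAb : annulus r R ⊆ ball 0 1 := fun z hz => by
    rw [mem_ball_zero_iff]; exact hz.2.trans_lt hR
  refine le_trans ?_ (lintegral_mono_set hsub)
  rw [setLIntegral_image_mobius ha (measurableSet_annulus r R) hAb,
    ← lintegral_const_mul' _ _ ENNReal.ofReal_ne_top]
  refine setLIntegral_mono' (measurableSet_annulus r R) fun z hz => ?_
  exact mul_le_mul_left (ENNReal.ofReal_le_ofReal (le_norm_mobiusDeriv_sq ha (hAb hz))) _

/-- If the circle averages of a nonnegative function vanish at the boundary of the disk, then the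
averages over the images of circles under a disk automorphism have no positive lower bound. The
two kinds of averages are compared through area integrals over thin annuli, which automorphisms
distort by a bounded factor only. -/
lemma nonpos_of_le_circleAverage_mobius {u : ℂ → ℝ} (hu : ContinuousOn u (ball 0 1))
    (hu0 : ∀ z ∈ ball (0 : ℂ) 1, 0 ≤ u z)
    (hlim : ∀ ε, 0 < ε → ∀ᶠ s in 𝓝[<] (1 : ℝ), circleAverage u 0 s ≤ ε)
    {a : ℂ} (ha : ‖a‖ < 1) {c : ℝ}
    (hc : ∀ s, 7 / 8 ≤ s → s < 1 → c ≤ circleAverage (fun z => u (mobius a z)) 0 s) : c ≤ 0 := by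
  by_contra! hc0
  have hsub := fun r R => mobius_image_annulus_subset ha (r := r) (R := R)
  have hcmp := fun r R r' R' => setLIntegral_comp_mobius_le u ha (r := r) (R := R) (r' := r')
    (R' := R')
  set Q := (1 - ‖a‖ ^ 2) / (1 - ‖a‖) ^ 2 with hQdef
  set m := (1 - ‖a‖ ^ 2) / 4 with hmdef
  have h1a : 0 < 1 - ‖a‖ ^ 2 := by nlinarith [norm_nonneg a]
  have hQ : 0 < Q := div_pos h1a (pow_pos (by linarith) 2)
  have hm : 0 < m := by positivity
  clear_value Q m
  -- with this `ε` the upper bound for the area integral falls below the lower bound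
  obtain ⟨ε, hε⟩ : ∃ ε, ε = c * m ^ 2 / (16 * Q) := ⟨_, rfl⟩
  have hε0 : 0 < ε := hε ▸ by positivity
  obtain ⟨r₁, hr₁, hr₁u⟩ := (mem_nhdsLT_iff_exists_Ioo_subset' (show (0 : ℝ) < 1 by norm_num)).1
    (hlim ε hε0)
  have hr₁' : r₁ < 1 := hr₁
  -- the inner radius of the thin annulus
  obtain ⟨r, hr7, hr1, hrQ⟩ : ∃ r : ℝ, 7 / 8 ≤ r ∧ r < 1 ∧ max r₁ 0 < 1 - 2 * Q * (1 - r) := by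
    have h1 : Tendsto (fun r : ℝ => 1 - 2 * Q * (1 - r)) (𝓝[<] 1) (𝓝 1) := by
      have : Continuous fun r : ℝ => 1 - 2 * Q * (1 - r) := by fun_prop
      have h := this.tendsto 1
      simp only [sub_self, mul_zero, sub_zero] at h
      exact h.mono_left nhdsWithin_le_nhds
    have h2 : ∀ᶠ r in 𝓝[<] (1 : ℝ), 7 / 8 < r := nhdsWithin_le_nhds (Ioi_mem_nhds (by norm_num))
    obtain ⟨r, h3, h4, h5⟩ := ((h1.eventually_const_lt (max_lt hr₁' one_pos)).and
      (h2.and self_mem_nhdsWithin)).exists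
    exact ⟨r, h4.le, h5, h3⟩
  obtain ⟨R, hR⟩ : ∃ R, R = (1 + r) / 2 := ⟨_, rfl⟩
  have hR1 : R < 1 := by linarith
  have hrR : r < R := by linarith
  have hR0 : 0 ≤ R := by linarith
  have hsub := hsub r R hR0 hR1
  obtain ⟨r', hr'⟩ : ∃ r', r' = 1 - 2 * Q * (1 - r) := ⟨_, rfl⟩
  rw [← hr'] at hrQ hsub
  have hr'0 : 0 ≤ r' := (le_max_right r₁ 0).trans hrQ.le
  have hr'r₁ : r₁ < r' := (le_max_left r₁ 0).trans_lt hrQ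
  have hR'1 : Real.sqrt (1 - m * (1 - R ^ 2)) < 1 := by
    have : 0 < m * (1 - R ^ 2) := mul_pos hm (by nlinarith)
    rw [Real.sqrt_lt' one_pos]; linarith
  generalize Real.sqrt (1 - m * (1 - R ^ 2)) = R' at hsub hR'1
  have hcmp := hcmp r R r' R' hR1 hsub
  have hr'R' : r' ≤ R' := by
    have hz : (R : ℂ) ∈ annulus r R := by
      change ‖(R : ℂ)‖ ∈ Set.Ioc r R
      rw [Complex.norm_real, Real.norm_of_nonneg hR0]
      exact ⟨hrR, le_rfl⟩
    have := hsub ⟨_, hz, rfl⟩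
    exact this.1.le.trans this.2
  have hum : ContinuousOn (fun z => u (mobius a z)) (ball 0 1) :=
    hu.comp (continuousOn_mobius ha) fun z hz => mobius_mem_ball ha hz
  have hlow := le_integral_mul_circleAverage hum hc0.le hr7 hrR.le hR1 fun s hs =>
    hc s (hr7.trans hs.1) (hs.2.trans_lt hR1)
  have hup := integral_mul_circleAverage_le hu hε0.le hr'0 hr'R' hR'1 fun s hs =>
    hr₁u ⟨hr'r₁.trans_le hs.1, hs.2.trans_lt hR'1⟩
  rw [setLIntegral_annulus hum (by linarith) hrR.le hR1 fun z hz =>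
      hu0 _ (mobius_mem_ball ha (mem_ball_zero_iff.2 (hz.2.trans_lt hR1))),
    setLIntegral_annulus hu hr'0 hr'R' hR'1 fun z hz =>
      hu0 z (mem_ball_zero_iff.2 (hz.2.trans_lt hR'1)), ← ENNReal.ofReal_mul (sq_nonneg m)] at hcmp
  generalize (∫ s in r..R, s * circleAverage (fun z => u (mobius a z)) 0 s) = I at hlow hcmp
  generalize (∫ s in r'..R', s * circleAverage u 0 s) = I' at hup hcmp
  have hpos : 0 < c * (7 / 8) * (R - r) := mul_pos (by positivity) (by linarith)
  have hIpos : 0 < I := hpos.trans_le hlow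
  have hm2 : 0 < m ^ 2 * (2 * π * I) := by positivity
  have h1 : m ^ 2 * (2 * π * I) ≤ 2 * π * I' := by
    rcases ENNReal.ofReal_le_ofReal_iff'.1 hcmp with h | h
    · exact h
    · exact absurd h (not_le.2 hm2)
  have h1' : m ^ 2 * I ≤ I' := by
    refine le_of_mul_le_mul_left ?_ two_pi_pos
    linarith
  have h2 : ε * (R' - r') ≤ ε * (2 * Q * (1 - r)) :=
    mul_le_mul_of_nonneg_left (by linarith) hε0.le
  have h3 : ε * (2 * Q * (1 - r)) = c * m ^ 2 / 8 * (1 - r) := by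
    rw [hε]; field_simp; ring
  have h4 : m ^ 2 * (c * (7 / 8) * (R - r)) = 7 / 16 * (c * m ^ 2 * (1 - r)) := by
    rw [hR]; ring
  have h5 := mul_le_mul_of_nonneg_left hlow (sq_nonneg m)
  have h6 : 0 < c * m ^ 2 * (1 - r) := mul_pos (by positivity) (by linarith)
  linarith

lemma continuousOn_harmonicExt_real {f : ℂ → ℝ} (hf : CircleIntegrable f 0 1) :
    ContinuousOn (harmonicExt f) (ball 0 1) := by
  obtain ⟨F, hF, hre⟩ := exists_differentiableOn_re_eq_harmonicExt hf
  exact (Complex.continuous_re.comp_continuousOn hF.continuousOn).congr hre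

/-- The gap in Jensen's inequality for the harmonic measure at `z`. -/
noncomputable def jensenGap (W : ℂ → Matrix (Fin d) (Fin d) ℂ) (z : ℂ) : ℝ :=
  logDetRe (herglotzInt W) z - harmonicExt (logDet W) z

/-- The energy of the weight seen from the point `a` of the disk: the area integral of the energy
density against `1 - |φ|²`, where `φ` is the automorphism exchanging `0` and `a`. -/
noncomputable def energyAt (W : ℂ → Matrix (Fin d) (Fin d) ℂ) (a : ℂ) : ℝ≥0∞ :=
  ∫⁻ w in ball 0 1, ENNReal.ofReal ((1 - ‖mobius a w‖ ^ 2) * energy (herglotzInt W) w)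

namespace IsMatrixWeight

variable {W : ℂ → Matrix (Fin d) (Fin d) ℂ}

lemma jensenGap_nonneg (hW : IsMatrixWeight W) (hL : CircleIntegrable (logDet W) 0 1) {z : ℂ}
    (hz : z ∈ ball (0 : ℂ) 1) : 0 ≤ jensenGap W z :=
  sub_nonneg.2 (hW.harmonicExt_logDet_le hL hz)

lemma continuousOn_jensenGap (hW : IsMatrixWeight W) (hL : CircleIntegrable (logDet W) 0 1) :
    ContinuousOn (jensenGap W) (ball 0 1) :=
  hW.isDiscPositive.continuousOn_logDetRe.sub (continuousOn_harmonicExt_real hL)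

lemma circleAverage_jensenGap_mobius (hW : IsMatrixWeight W)
    (hL : CircleIntegrable (logDet W) 0 1) {a : ℂ} (ha : ‖a‖ < 1) {R : ℝ} (hR0 : 0 < R)
    (hR : R < 1) : circleAverage (fun z => jensenGap W (mobius a z)) 0 R =
      circleAverage (logDetRe fun z => herglotzInt W (mobius a z)) 0 R -
        harmonicExt (logDet W) a := by
  have h1 := (hW.isDiscPositive.comp_mobius ha).continuousOn_logDetRe
  have h2 : ContinuousOn (fun z => harmonicExt (logDet W) (mobius a z)) (ball 0 1) :=
    (continuousOn_harmonicExt_real hL).comp (continuousOn_mobius ha)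
      fun z hz => mobius_mem_ball ha hz
  rw [← circleAverage_harmonicExt_mobius hL ha hR0 hR, ← circleAverage_fun_sub
    (circleIntegrable_of_continuousOn_ball h1 hR0.le hR)
    (circleIntegrable_of_continuousOn_ball h2 hR0.le hR)]
  rfl

lemma circleAverage_jensenGap (hW : IsMatrixWeight W)
    (hL : CircleIntegrable (logDet W) 0 1) {R : ℝ} (hR0 : 0 < R)
    (hR : R < 1) : circleAverage (jensenGap W) 0 R =
      circleAverage (logDetRe (herglotzInt W)) 0 R - circleAverage (logDet W) 0 1 := by
  rw [← harmonicExt_zero_eq, ← circleAverage_harmonicExt hL hR0 hR, ← circleAverage_fun_sub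
    (circleIntegrable_of_continuousOn_ball hW.isDiscPositive.continuousOn_logDetRe hR0.le hR)
    (circleIntegrable_of_continuousOn_ball (continuousOn_harmonicExt_real hL) hR0.le hR)]
  rfl

lemma eventually_circleAverage_jensenGap_le (hW : IsMatrixWeight W)
    (hL : CircleIntegrable (logDet W) 0 1) {ε : ℝ} (hε : 0 < ε) :
    ∀ᶠ s in 𝓝[<] (1 : ℝ), circleAverage (jensenGap W) 0 s ≤ ε := by
  obtain ⟨r, hr7, hr1, hr⟩ : ∃ r : ℝ, 7 / 8 ≤ r ∧ r < 1 ∧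
      circleAverage (logDetRe (herglotzInt W)) 0 r < circleAverage (logDet W) 0 1 + ε := by
    by_contra! h
    linarith [(hW.le_circleAverage_logDet h).2]
  have e1 : ∀ᶠ s in 𝓝[<] (1 : ℝ), r < s := nhdsWithin_le_nhds (Ioi_mem_nhds hr1)
  filter_upwards [e1, self_mem_nhdsWithin] with s hs hs1
  rw [hW.circleAverage_jensenGap hL (by linarith) hs1]
  have := hW.isDiscPositive.circleAverage_logDetRe_antitone (by linarith) hs.le hs1
  linarith

/-- Finite energy makes `log det W` integrable. -/
lemma circleIntegrable_logDet (hW : IsMatrixWeight W) (h : energyAt W 0 ≠ ⊤) :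
    CircleIntegrable (logDet W) 0 1 := by
  have e : energyAt W 0 =
      ∫⁻ w in ball 0 1, ENNReal.ofReal ((1 - ‖w‖ ^ 2) * energy (herglotzInt W) w) := by
    simp [energyAt, mobius]
  set K := ENNReal.ofReal (40 * 13 ^ 4 + 2) * energyAt W 0 with hK
  have hKt : K ≠ ⊤ := ENNReal.mul_ne_top ENNReal.ofReal_ne_top h
  refine (hW.le_circleAverage_logDet (c := logDetRe (herglotzInt W) 0 - K.toReal)
    fun r hr7 hr1 => ?_).1
  have h1 := hW.isDiscPositive.ofReal_gap_le hr7 hr1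
  rw [← e, ← hK, ENNReal.ofReal_le_iff_le_toReal hKt] at h1
  linarith

/-- The gap in Jensen's inequality is bounded by the energy. -/
lemma jensenGap_le_energyAt (hW : IsMatrixWeight W) (hL : CircleIntegrable (logDet W) 0 1) {a : ℂ}
    (ha : ‖a‖ < 1) (h : energyAt W a ≠ ⊤) :
    jensenGap W a ≤ (40 * 13 ^ 4 + 2) * (energyAt W a).toReal := by
  have hH := hW.isDiscPositive.comp_mobius ha
  refine sub_nonpos.1 (nonpos_of_le_circleAverage_mobius (hW.continuousOn_jensenGap hL)
    (fun z hz => hW.jensenGap_nonneg hL hz) (fun ε hε => hW.eventually_circleAverage_jensenGap_le hL hε) ha fun s hs7 hs1 => ?_)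
  have h1 := hH.ofReal_gap_le hs7 hs1
  rw [hW.isDiscPositive.lintegral_energy_comp_mobius ha, ← energyAt, ENNReal.ofReal_le_iff_le_toReal
    (ENNReal.mul_ne_top ENNReal.ofReal_ne_top h), ENNReal.toReal_mul,
    ENNReal.toReal_ofReal (by norm_num)] at h1
  have e : logDetRe (fun z => herglotzInt W (mobius a z)) 0 = logDetRe (herglotzInt W) a := by
    simp [logDetRe, twoRe]
  rw [e] at h1
  rw [hW.circleAverage_jensenGap_mobius hL ha (by linarith) hs1, jensenGap]
  linarith

/-- The energy is bounded by the gap in Jensen's inequality. -/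
lemma energyAt_le_jensenGap (hW : IsMatrixWeight W) (hL : CircleIntegrable (logDet W) 0 1) {a : ℂ}
    (ha : ‖a‖ < 1) : energyAt W a ≤ ENNReal.ofReal (4 * π * jensenGap W a) := by
  have hH := hW.isDiscPositive.comp_mobius ha
  rw [energyAt, ← hW.isDiscPositive.lintegral_energy_comp_mobius ha]
  have e : logDetRe (fun z => herglotzInt W (mobius a z)) 0 = logDetRe (herglotzInt W) a := by
    simp [logDetRe, twoRe]
  refine hH.lintegral_energy_le fun R hR0 hR1 => ?_
  rw [e, jensenGap]
  rcases hR0.eq_or_lt with rfl | hR0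
  · rw [circleAverage_zero, e, sub_self]
    exact hW.jensenGap_nonneg hL (mem_ball_zero_iff.2 ha)
  · have h1 := hW.circleAverage_jensenGap_mobius hL ha hR0 hR1
    have h2 : 0 ≤ circleAverage (fun z => jensenGap W (mobius a z)) 0 R := by
      refine circleAverage_nonneg_of_ae (Eventually.of_forall fun θ => ?_)
      exact hW.jensenGap_nonneg hL (mobius_mem_ball ha (circleMap_mem_ball_one hR0.le hR1 θ))
    linarith

end IsMatrixWeight

end

/-! ### Vanishing Carleson measures -/

section

lemma isVanishingCarleson_iff (μ : Measure ℂ) : IsVanishingCarleson μ ↔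
    ∀ ε : ℝ, 0 < ε → ∃ δ > 0, ∀ a h : ℝ, 0 < h → h < δ →
      μ (carlesonSquare a h) ≤ ENNReal.ofReal (ε * h) := by
  have hb := (hasBasis_top (α := ℝ)).prod (nhdsGT_basis (0 : ℝ))
  have key : ∀ ε : ℝ, 0 < ε → ((∀ᶠ p in (⊤ : Filter ℝ) ×ˢ 𝓝[>] (0 : ℝ),
      μ (carlesonSquare p.1 p.2) / ENNReal.ofReal p.2 ≤ ENNReal.ofReal ε) ↔
      ∃ δ > 0, ∀ a h : ℝ, 0 < h → h < δ →
        μ (carlesonSquare a h) ≤ ENNReal.ofReal (ε * h)) := fun ε hε => by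
    rw [hb.eventually_iff]
    have e : ∀ a h : ℝ, 0 < h → (μ (carlesonSquare a h) / ENNReal.ofReal h ≤ ENNReal.ofReal ε ↔
        μ (carlesonSquare a h) ≤ ENNReal.ofReal (ε * h)) := fun a h hh => by
      rw [ENNReal.div_le_iff (by simpa using hh) ENNReal.ofReal_ne_top,
        ENNReal.ofReal_mul hε.le]
    constructor
    · rintro ⟨⟨_, δ⟩, ⟨_, hδ⟩, h⟩
      exact ⟨δ, hδ, fun a t ht htδ => (e a t ht).1 (h (x := (a, t)) ⟨trivial, ht, htδ⟩)⟩
    · rintro ⟨δ, hδ, h⟩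
      exact ⟨((), δ), ⟨trivial, hδ⟩, fun p hp => (e _ _ hp.2.1).2 (h _ _ hp.2.1 hp.2.2)⟩
  have hiff : IsVanishingCarleson μ ↔
      Tendsto (fun p : ℝ × ℝ => μ (carlesonSquare p.1 p.2) / ENNReal.ofReal p.2)
        ((⊤ : Filter ℝ) ×ˢ 𝓝[>] (0 : ℝ)) (𝓝 0) := by
    constructor
    · intro h
      exact tendsto_of_le_liminf_of_limsup_le zero_le (le_of_eq h)
    · exact fun h => h.limsup_eq
  rw [hiff, ENNReal.tendsto_nhds_zero]
  constructor
  · exact fun h ε hε => (key ε hε).1 (h _ (by simpa using hε))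
  · intro h ε hε
    obtain ⟨ε', h0, hε'⟩ := ENNReal.lt_iff_exists_real_btwn.1 hε
    exact ((key ε' (by simpa using hε'.1)).2 (h ε' (by simpa using hε'.1))).mono
      fun p hp => hp.trans hε'.2.le

lemma IsVanishingCarleson.mono {μ ν : Measure ℂ} (hν : IsVanishingCarleson ν) (h : μ ≤ ν) :
    IsVanishingCarleson μ := by
  rw [isVanishingCarleson_iff] at hν ⊢
  intro ε hε
  obtain ⟨δ, hδ, H⟩ := hν ε hε
  exact ⟨δ, hδ, fun a t h0 h1 => (h _).trans (H a t h0 h1)⟩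

lemma IsVanishingCarleson.smul_add {μ ν : Measure ℂ} (hμ : IsVanishingCarleson μ)
    (hν : IsVanishingCarleson ν) {c : ℝ} (hc : 0 ≤ c) :
    IsVanishingCarleson (ENNReal.ofReal c • (μ + ν)) := by
  rw [isVanishingCarleson_iff] at hμ hν ⊢
  intro ε hε
  have hε' : 0 < ε / (2 * (c + 1)) := by positivity
  obtain ⟨δ, hδ, H⟩ := hμ _ hε'
  obtain ⟨δ', hδ', H'⟩ := hν _ hε'
  refine ⟨min δ δ', lt_min hδ hδ', fun a t h0 h1 => ?_⟩
  have h2 := H a t h0 (h1.trans_le (min_le_left _ _))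
  have h3 := H' a t h0 (h1.trans_le (min_le_right _ _))
  have h4 : 0 ≤ ε / (2 * (c + 1)) * t := by positivity
  rw [Measure.smul_apply, Measure.add_apply, smul_eq_mul]
  calc _ ≤ ENNReal.ofReal c * (ENNReal.ofReal (ε / (2 * (c + 1)) * t) +
        ENNReal.ofReal (ε / (2 * (c + 1)) * t)) := by gcongr
    _ = ENNReal.ofReal (c * (ε / (2 * (c + 1)) * t + ε / (2 * (c + 1)) * t)) := by
        rw [← ENNReal.ofReal_add h4 h4, ← ENNReal.ofReal_mul hc]
    _ ≤ _ := by
        refine ENNReal.ofReal_le_ofReal ?_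
        have : c * (ε / (2 * (c + 1)) * t + ε / (2 * (c + 1)) * t) = c / (c + 1) * (ε * t) := by
          field_simp; ring
        rw [this]
        have h5 : c / (c + 1) ≤ 1 := by rw [div_le_one (by positivity)]; linarith
        exact mul_le_of_le_one_left (by positivity) h5

lemma norm_circleMap_sub_circleMap_le (s t : ℝ) :
    ‖circleMap 0 1 s - circleMap 0 1 t‖ ≤ |s - t| := by
  have h := Real.norm_exp_I_mul_ofReal_sub_one_le (x := s - t)
  have e : circleMap 0 1 s - circleMap 0 1 t =
      circleMap 0 1 t * (Complex.exp (Complex.I * ((s - t : ℝ) : ℂ)) - 1) := by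
    simp only [circleMap, zero_add, Complex.ofReal_one, one_mul, mul_sub, mul_one,
      ← Complex.exp_add]
    congr 2
    push_cast
    ring
  rw [e, norm_mul, norm_circleMap_zero, abs_one, one_mul]
  exact h

/-- On the Carleson square of an arc of length `h` the pseudo-distance to the inner corner of the
square is at most `(2 + 2π) h`. -/
lemma norm_one_sub_conj_mul_le_of_mem_carlesonSquare {a h : ℝ} (h0 : 0 < h) (h1 : h < 1) {w : ℂ}
    (hw : w ∈ carlesonSquare a h) :
    ‖1 - (starRingEnd ℂ) (circleMap 0 (1 - h) (2 * π * a)) * w‖ ≤ 9 * h := by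
  obtain ⟨⟨t, ht, htw⟩, hw1, hw2⟩ := hw
  have hw0 : (‖w‖ : ℂ) ≠ 0 := by
    rw [Complex.ofReal_ne_zero]; linarith
  have hwe : w = ‖w‖ * circleMap 0 1 (2 * π * t) := by
    simp only at htw
    rw [htw, mul_div_cancel₀ _ hw0]
  set α := 2 * π * a
  set β := 2 * π * t
  set ρ := ‖w‖
  have hα : (starRingEnd ℂ) (circleMap 0 1 α) * circleMap 0 1 α = 1 := by
    rw [Complex.conj_mul', norm_circleMap_zero]; simp
  have e : 1 - (starRingEnd ℂ) (circleMap 0 (1 - h) α) * w =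
      ((1 - (1 - h) * ρ : ℝ) : ℂ) - (((1 - h) * ρ : ℝ) : ℂ) *
        ((starRingEnd ℂ) (circleMap 0 1 α) * (circleMap 0 1 β - circleMap 0 1 α)) := by
    rw [circleMap_zero_eq_mul (1 - h), mul_sub ((starRingEnd ℂ) (circleMap 0 1 α)), hα, hwe]
    simp only [map_mul, Complex.conj_ofReal]
    push_cast
    ring
  have hρ : 0 ≤ (1 - h) * ρ := mul_nonneg (by linarith) (norm_nonneg _)
  have hρ1 : (1 - h) * ρ ≤ 1 := by nlinarith [norm_nonneg w]
  have h2 : ‖circleMap 0 1 β - circleMap 0 1 α‖ ≤ 2 * π * h := by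
    refine (norm_circleMap_sub_circleMap_le _ _).trans ?_
    rw [← mul_sub, abs_mul, abs_of_pos two_pi_pos, abs_of_nonneg (by linarith [ht.1])]
    have := ht.2
    gcongr
    linarith
  rw [e]
  refine (norm_sub_le _ _).trans ?_
  rw [norm_mul, norm_mul, Complex.norm_real, Complex.norm_real, RCLike.norm_conj,
    norm_circleMap_zero, abs_one, one_mul, Real.norm_of_nonneg hρ,
    Real.norm_of_nonneg (by linarith)]
  have h3 := mul_le_mul hρ1 h2 (norm_nonneg _) zero_le_one
  have h4 : 1 - (1 - h) * ρ ≤ 2 * h := by nlinarith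
  have h5 : 2 * π * h ≤ 7 * h := by gcongr; linarith [pi_lt_d2]
  linarith

/-- The mass of a Carleson square is controlled by one Poisson type integral. -/
lemma measure_carlesonSquare_le (μ : Measure ℂ) {a h : ℝ} (h0 : 0 < h) (h1 : h < 1) :
    μ (carlesonSquare a h) ≤ ENNReal.ofReal (81 * h) *
      ∫⁻ w, ENNReal.ofReal ((1 - ‖circleMap 0 (1 - h) (2 * π * a)‖ ^ 2) /
        ‖1 - (starRingEnd ℂ) (circleMap 0 (1 - h) (2 * π * a)) * w‖ ^ 2) ∂μ := by
  set l := circleMap 0 (1 - h) (2 * π * a)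
  have hl : ‖l‖ = 1 - h := by rw [norm_circleMap_zero, abs_of_pos (by linarith)]
  have hmeas : Measurable fun w : ℂ => ENNReal.ofReal ((1 - ‖l‖ ^ 2) /
        ‖1 - (starRingEnd ℂ) l * w‖ ^ 2) := by fun_prop
  have hsub : carlesonSquare a h ⊆ {w | ENNReal.ofReal (81 * h)⁻¹ ≤
      ENNReal.ofReal ((1 - ‖l‖ ^ 2) / ‖1 - (starRingEnd ℂ) l * w‖ ^ 2)} := fun w hw => by
    refine ENNReal.ofReal_le_ofReal ?_
    have h2 : ‖1 - (starRingEnd ℂ) l * w‖ ≤ 9 * h :=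
      norm_one_sub_conj_mul_le_of_mem_carlesonSquare h0 h1 hw
    have h3 : 0 < ‖1 - (starRingEnd ℂ) l * w‖ :=
      norm_pos_iff.2 (one_sub_conj_mul_ne_zero (by rw [hl]; linarith) hw.2.2.le)
    calc (81 * h)⁻¹ = h / (9 * h) ^ 2 := by field_simp; norm_num
      _ ≤ (1 - ‖l‖ ^ 2) / ‖1 - (starRingEnd ℂ) l * w‖ ^ 2 := by
        have : h ≤ 1 - ‖l‖ ^ 2 := by rw [hl]; nlinarith
        gcongr
        nlinarith
  have h4 := (mul_le_mul_right (measure_mono hsub) (ENNReal.ofReal (81 * h)⁻¹)).trans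
    (mul_meas_ge_le_lintegral hmeas (μ := μ) (ENNReal.ofReal (81 * h)⁻¹))
  have h5 : ENNReal.ofReal (81 * h) * ENNReal.ofReal (81 * h)⁻¹ = 1 := by
    rw [← ENNReal.ofReal_mul (by positivity), mul_inv_cancel₀ (by positivity), ENNReal.ofReal_one]
  calc μ (carlesonSquare a h) =
      ENNReal.ofReal (81 * h) * (ENNReal.ofReal (81 * h)⁻¹ * μ (carlesonSquare a h)) := by
        rw [← mul_assoc, h5, one_mul]
    _ ≤ _ := by gcongr

/-- A disk that is small in the pseudo-distance `|1 - āw|` lies in a Carleson square of comparable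
size. -/
lemma mem_carlesonSquare_of_norm_one_sub_lt {l : ℂ} (hl : ‖l‖ ≤ 1) {t : ℝ} (ht : t ≤ 1 / 2) {w : ℂ}
    (hw : ‖w‖ < 1) (h : ‖1 - (starRingEnd ℂ) l * w‖ < t) :
    w ∈ carlesonSquare (l.arg / (2 * π) - t / 2) t := by
  set ξ := (starRingEnd ℂ) l * w with hξ
  have hre : 1 - t < ξ.re := by
    have := (Complex.abs_re_le_norm (1 - ξ)).trans_lt h
    rw [Complex.sub_re, Complex.one_re, abs_lt] at this
    linarith
  have him : |ξ.im| < t := by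
    have := (Complex.abs_im_le_norm (1 - ξ)).trans_lt h
    rwa [Complex.sub_im, Complex.one_im, zero_sub, abs_neg] at this
  have ht0 : 0 < t := (norm_nonneg _).trans_lt h
  have hreξ : ξ.re ≤ ‖ξ‖ := (le_abs_self _).trans (Complex.abs_re_le_norm _)
  have hξl : ‖ξ‖ = ‖l‖ * ‖w‖ := by rw [hξ, norm_mul, RCLike.norm_conj]
  have hξpos : 0 < ‖ξ‖ := by linarith
  have hξw : ‖ξ‖ ≤ ‖w‖ := by rw [hξl]; nlinarith [norm_nonneg w]
  have hl0 : 0 < ‖l‖ := by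
    by_contra! h0
    nlinarith [norm_nonneg w]
  have hw0 : 0 < ‖w‖ := by linarith
  have harg : |ξ.arg| ≤ π * t := by
    have h1 : |ξ.arg| ≤ π / 2 := (Complex.abs_arg_lt_pi_div_two_iff.2 (Or.inl (by linarith))).le
    have h2 := Real.mul_le_sin (abs_nonneg ξ.arg) h1
    have h3 : Real.sin |ξ.arg| = |ξ.im| / ‖ξ‖ := by
      rw [← Real.abs_sin_eq_sin_abs_of_abs_le_pi (h1.trans (by linarith [pi_pos])),
        Complex.sin_arg, abs_div, abs_of_pos hξpos]
    rw [h3] at h2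
    have h4 : |ξ.im| / ‖ξ‖ ≤ 2 * t := by
      rw [div_le_iff₀ hξpos]
      nlinarith
    have h5 : 2 / π * |ξ.arg| * π ≤ 2 * t * π :=
      mul_le_mul_of_nonneg_right (h2.trans h4) pi_pos.le
    have h6 : 2 / π * |ξ.arg| * π = 2 * |ξ.arg| := by field_simp
    linarith
  refine ⟨⟨(l.arg + ξ.arg) / (2 * π), ⟨?_, ?_⟩, ?_⟩, by linarith, hw⟩
  · rw [add_div, sub_eq_add_neg]
    gcongr
    rw [le_div_iff₀ two_pi_pos]
    linarith [(abs_le.1 harg).1]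
  · rw [add_div, show l.arg / (2 * π) - t / 2 + t = l.arg / (2 * π) + t / 2 by ring]
    refine add_le_add_right ?_ _
    rw [div_le_iff₀ two_pi_pos]
    linarith [(abs_le.1 harg).2]
  · simp only
    rw [mul_div_cancel₀ _ two_pi_pos.ne', eq_div_iff (by exact_mod_cast hw0.ne')]
    have e1 : (‖l‖ : ℂ) * Complex.exp (l.arg * Complex.I) = l := Complex.norm_mul_exp_arg_mul_I l
    have e2 : (‖ξ‖ : ℂ) * Complex.exp (ξ.arg * Complex.I) = ξ := Complex.norm_mul_exp_arg_mul_I ξ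
    have hl0' : (‖l‖ : ℂ) ≠ 0 := by exact_mod_cast hl0.ne'
    refine mul_left_cancel₀ (pow_ne_zero 2 hl0') ?_
    calc (‖l‖ : ℂ) ^ 2 * (circleMap 0 1 (l.arg + ξ.arg) * ‖w‖)
        = (‖l‖ * Complex.exp (l.arg * Complex.I)) *
          (((‖l‖ * ‖w‖ : ℝ) : ℂ) * Complex.exp (ξ.arg * Complex.I)) := by
          rw [circleMap, zero_add, Complex.ofReal_add, add_mul, Complex.exp_add]
          push_cast
          ring
      _ = l * ξ := by rw [e1, ← hξl, e2]
      _ = (‖l‖ : ℂ) ^ 2 * w := by rw [hξ, ← mul_assoc, Complex.mul_conj']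

/-- Dyadic decomposition of the Poisson type integral of a Carleson measure. Points with
`|1 - āw| ≥ δ / 2` contribute the first term; the others lie in the sets where `|1 - āw|` is
between `2ᵏ (1 - |a|)` and `2ᵏ⁺¹ (1 - |a|)`. -/
lemma lintegral_le_of_carleson {μ : Measure ℂ} (hμ : μ (ball 0 1)ᶜ = 0) {ε δ : ℝ} (hε : 0 ≤ ε)
    (hδ0 : 0 < δ) (hδ : δ ≤ 1 / 2)
    (h : ∀ a h : ℝ, 0 < h → h < δ → μ (carlesonSquare a h) ≤ ENNReal.ofReal (ε * h))
    {l : ℂ} (hl : ‖l‖ < 1) :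
    ∫⁻ w, ENNReal.ofReal ((1 - ‖l‖ ^ 2) / ‖1 - (starRingEnd ℂ) l * w‖ ^ 2) ∂μ ≤
      ENNReal.ofReal (8 * (1 - ‖l‖) / δ ^ 2) * μ Set.univ + ENNReal.ofReal (8 * ε) := by
  set η := 1 - ‖l‖ with hη
  have hη0 : 0 < η := by linarith
  have hη2 : 1 - ‖l‖ ^ 2 ≤ 2 * η := by nlinarith [norm_nonneg l]
  set N : ℂ → ℝ := fun w => ‖1 - (starRingEnd ℂ) l * w‖
  have hNc : Continuous N := by fun_prop
  set S : ℕ → Set ℂ := fun k => if 2 ^ (k + 1) * η < δ then {w | N w < 2 ^ (k + 1) * η} else ∅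
  have hS : ∀ k, MeasurableSet (S k) := fun k => by
    simp only [S]
    split_ifs
    · exact measurableSet_lt hNc.measurable measurable_const
    · exact MeasurableSet.empty
  have hSμ : ∀ k, μ (S k) ≤ ENNReal.ofReal (ε * (2 ^ (k + 1) * η)) := fun k => by
    simp only [S]
    split_ifs with hk
    · calc _ ≤ μ (carlesonSquare (l.arg / (2 * π) - 2 ^ (k + 1) * η / 2) (2 ^ (k + 1) * η) ∪
              (ball 0 1)ᶜ) := by
            refine measure_mono fun w hw => ?_
            by_cases hwb : w ∈ ball (0 : ℂ) 1
            · exact Or.inl (mem_carlesonSquare_of_norm_one_sub_lt hl.le (by linarith)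
                (mem_ball_zero_iff.1 hwb) hw)
            · exact Or.inr hwb
        _ ≤ _ := (measure_union_le _ _).trans (by
            rw [hμ, add_zero]; exact h _ _ (by positivity) hk)
    · simp
  have hpt : ∀ w ∈ ball (0 : ℂ) 1, ENNReal.ofReal ((1 - ‖l‖ ^ 2) / N w ^ 2) ≤
      ENNReal.ofReal (8 * η / δ ^ 2) +
        ∑' k, (S k).indicator (fun _ => ENNReal.ofReal (2 / (4 ^ k * η))) w := fun w hw => by
    have hNη : η ≤ N w := one_sub_le_norm_one_sub_conj_mul (mem_ball_zero_iff.1 hw).le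
    have hN0 : 0 < N w := hη0.trans_le hNη
    by_cases hNδ : δ / 2 ≤ N w
    · refine le_trans (ENNReal.ofReal_le_ofReal ?_) le_self_add
      calc (1 - ‖l‖ ^ 2) / N w ^ 2 ≤ 2 * η / (δ / 2) ^ 2 := by gcongr
        _ = 8 * η / δ ^ 2 := by field_simp; norm_num
    · push Not at hNδ
      obtain ⟨k, hk1, hk2⟩ := exists_nat_pow_near ((one_le_div hη0).2 hNη)
        (one_lt_two : (1 : ℝ) < 2)
      rw [le_div_iff₀ hη0] at hk1
      rw [div_lt_iff₀ hη0] at hk2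
      have hkδ : 2 ^ (k + 1) * η < δ := by rw [pow_succ]; linarith
      refine le_trans ?_ ((ENNReal.le_tsum k).trans le_add_self)
      have hwS : w ∈ S k := by simp only [S, if_pos hkδ]; exact hk2
      rw [Set.indicator_of_mem hwS]
      refine ENNReal.ofReal_le_ofReal ?_
      calc (1 - ‖l‖ ^ 2) / N w ^ 2 ≤ 2 * η / (2 ^ k * η) ^ 2 := by gcongr
        _ = 2 / (4 ^ k * η) := by
          rw [show (4 : ℝ) = 2 ^ 2 by norm_num, ← pow_mul, mul_comm 2 k, pow_mul]
          field_simp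
  have hae : ∀ᵐ w ∂μ, w ∈ ball (0 : ℂ) 1 := hμ
  calc _ ≤ ∫⁻ w, (ENNReal.ofReal (8 * η / δ ^ 2) +
        ∑' k, (S k).indicator (fun _ => ENNReal.ofReal (2 / (4 ^ k * η))) w) ∂μ :=
        lintegral_mono_ae (hae.mono hpt)
    _ = ENNReal.ofReal (8 * η / δ ^ 2) * μ Set.univ +
        ∑' k, ENNReal.ofReal (2 / (4 ^ k * η)) * μ (S k) := by
        rw [lintegral_add_left measurable_const, lintegral_const, lintegral_tsum
          fun k => (measurable_const.indicator (hS k)).aemeasurable]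
        congr 2
        funext k
        exact lintegral_indicator_const (hS k) _
    _ ≤ ENNReal.ofReal (8 * η / δ ^ 2) * μ Set.univ +
        ∑' k : ℕ, ENNReal.ofReal (4 * ε * (1 / 2) ^ k) := by
        gcongr with k
        calc _ ≤ ENNReal.ofReal (2 / (4 ^ k * η)) * ENNReal.ofReal (ε * (2 ^ (k + 1) * η)) := by
              gcongr; exact hSμ k
          _ = _ := by
            rw [← ENNReal.ofReal_mul (by positivity)]
            congr 1
            rw [show (4 : ℝ) ^ k = 2 ^ k * 2 ^ k by rw [← mul_pow]; norm_num, one_div, inv_pow]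
            field_simp
            ring
    _ = _ := by
        rw [← ENNReal.ofReal_tsum_of_nonneg (fun k => by positivity)
          (summable_geometric_two.mul_left _), tsum_mul_left, tsum_geometric_two]
        congr 2
        ring

end

/-! ### Boundary behaviour of the Jensen gap -/

section

variable {d : ℕ}

namespace IsMatrixWeight

variable {W : ℂ → Matrix (Fin d) (Fin d) ℂ}

lemma continuousOn_density (hW : IsMatrixWeight W) :
    ContinuousOn (fun z => (1 - ‖z‖ ^ 2) * energy (herglotzInt W) z) (ball 0 1) :=
  (by fun_prop : Continuous fun z : ℂ => 1 - ‖z‖ ^ 2).continuousOn.mul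
    hW.isDiscPositive.continuousOn_energy

/-- The energy seen from a point, as an integral against the energy measure. -/
lemma energyAt_eq (hW : IsMatrixWeight W) {a : ℂ} (ha : ‖a‖ < 1) :
    energyAt W a = ∫⁻ w, ENNReal.ofReal ((1 - ‖a‖ ^ 2) / ‖1 - (starRingEnd ℂ) a * w‖ ^ 2)
      ∂energyMeasure W := by
  rw [energyMeasure, lintegral_withDensity_eq_lintegral_mul₀
    (hW.continuousOn_density.aemeasurable measurableSet_ball).ennreal_ofReal
    (by fun_prop), energyAt]
  refine setLIntegral_congr_fun measurableSet_ball fun w hw => ?_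
  have hw' := mem_ball_zero_iff.1 hw
  have h0 : 0 ≤ (1 - ‖w‖ ^ 2) * energy (herglotzInt W) w :=
    mul_nonneg (by nlinarith [norm_nonneg w]) (hW.isDiscPositive.energy_nonneg hw)
  simp only [Pi.mul_apply]
  rw [← ENNReal.ofReal_mul h0, one_sub_norm_mobius_sq ha hw'.le]
  congr 1
  ring

/-- A vanishing Carleson energy measure is finite, by compactness of the closed disk. -/
lemma energyMeasure_univ_lt_top (hW : IsMatrixWeight W)
    (h : IsVanishingCarleson (energyMeasure W)) : energyMeasure W Set.univ < ⊤ := by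
  obtain ⟨δ, hδ0, hδ⟩ := (isVanishingCarleson_iff _).1 h 1 one_pos
  have hc : energyMeasure W (closedBall 0 1) < ⊤ := by
    refine (isCompact_closedBall (0 : ℂ) 1).measure_lt_top_of_nhdsWithin fun x hx => ?_
    rw [mem_closedBall_zero_iff] at hx
    rcases hx.lt_or_eq with hx | hx
    · obtain ⟨r, hr0, hr⟩ := Metric.isOpen_iff.1 (isOpen_ball : IsOpen (ball (0 : ℂ) 1)) x
        (mem_ball_zero_iff.2 hx)
      have hsub : closedBall x (r / 2) ⊆ ball 0 1 :=
        (closedBall_subset_ball (by linarith)).trans hr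
      refine ⟨closedBall x (r / 2), mem_nhdsWithin_of_mem_nhds
        (closedBall_mem_nhds x (by positivity)), ?_⟩
      rw [energyMeasure, withDensity_apply _ measurableSet_closedBall,
        Measure.restrict_restrict measurableSet_closedBall, Set.inter_eq_left.2 hsub]
      exact ((hW.continuousOn_density.mono hsub).integrableOn_compact
        (isCompact_closedBall _ _)).lintegral_lt_top
    -- near a boundary point the disk is contained in a Carleson square
    · set t := min (δ / 2) (1 / 2)
      have ht0 : 0 < t := by positivity
      have htδ : t < δ := (min_le_left _ _).trans_lt (by linarith)
      refine ⟨{w | ‖1 - (starRingEnd ℂ) x * w‖ < t}, mem_nhdsWithin_of_mem_nhds ?_, ?_⟩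
      · have ho : IsOpen {w | ‖1 - (starRingEnd ℂ) x * w‖ < t} :=
          isOpen_lt (by fun_prop) continuous_const
        refine ho.mem_nhds ?_
        change ‖1 - (starRingEnd ℂ) x * x‖ < t
        rw [Complex.conj_mul', hx]
        simpa using ht0
      · calc _ ≤ energyMeasure W (carlesonSquare (x.arg / (2 * π) - t / 2) t ∪ (ball 0 1)ᶜ) := by
              refine measure_mono fun w hw => ?_
              by_cases hwb : w ∈ ball (0 : ℂ) 1
              · exact Or.inl (mem_carlesonSquare_of_norm_one_sub_lt hx.le (min_le_right _ _)
                  (mem_ball_zero_iff.1 hwb) hw)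
              · exact Or.inr hwb
          _ ≤ ENNReal.ofReal (1 * t) := (measure_union_le _ _).trans (by
              rw [energyMeasure_compl_ball, add_zero]; exact hδ _ _ ht0 htδ)
          _ < ⊤ := ENNReal.ofReal_lt_top
  calc _ ≤ energyMeasure W (closedBall 0 1 ∪ (ball 0 1)ᶜ) := measure_mono fun w _ => by
        by_cases hw : w ∈ ball (0 : ℂ) 1
        · exact Or.inl (ball_subset_closedBall hw)
        · exact Or.inr hw
    _ ≤ _ := measure_union_le _ _
    _ < ⊤ := by rwa [energyMeasure_compl_ball, add_zero]

/-- For a vanishing Carleson energy measure the energy seen from a point is finite and tends to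
zero at the boundary. -/
lemma tendsto_energyAt (hW : IsMatrixWeight W) (h : IsVanishingCarleson (energyMeasure W)) :
    (∀ a : ℂ, ‖a‖ < 1 → energyAt W a ≠ ⊤) ∧
      ∀ ε : ℝ, 0 < ε → ∃ r < 1, ∀ a : ℂ, r < ‖a‖ → ‖a‖ < 1 → (energyAt W a).toReal ≤ ε := by
  have hfin := hW.energyMeasure_univ_lt_top h
  set M := (energyMeasure W Set.univ).toReal
  have hM : energyMeasure W Set.univ = ENNReal.ofReal M := (ENNReal.ofReal_toReal hfin.ne).symm
  have hM0 : 0 ≤ M := ENNReal.toReal_nonneg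
  have key : ∀ ε : ℝ, 0 < ε → ∃ δ > 0, ∀ a : ℂ, ‖a‖ < 1 →
      energyAt W a ≤ ENNReal.ofReal (8 * (1 - ‖a‖) / δ ^ 2 * M + 8 * ε) := fun ε hε => by
    obtain ⟨δ, hδ0, hδ⟩ := (isVanishingCarleson_iff _).1 h ε hε
    refine ⟨min δ (1 / 2), by positivity, fun a ha => ?_⟩
    rw [hW.energyAt_eq ha]
    refine (lintegral_le_of_carleson (energyMeasure_compl_ball W) hε.le (by positivity)
      (min_le_right δ (1 / 2)) (fun b t h0 h1 => hδ b t h0 (h1.trans_le (min_le_left _ _))) ha).trans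
      (le_of_eq ?_)
    have h1 : 0 ≤ 1 - ‖a‖ := by linarith
    rw [hM, ← ENNReal.ofReal_mul (by positivity), ← ENNReal.ofReal_add (by positivity)
      (by positivity)]
  constructor
  · intro a ha
    obtain ⟨δ, -, hδ⟩ := key 1 one_pos
    exact ((hδ a ha).trans_lt ENNReal.ofReal_lt_top).ne
  · intro ε hε
    obtain ⟨δ, hδ0, hδ⟩ := key (ε / 16) (by positivity)
    refine ⟨1 - ε * δ ^ 2 / (16 * (M + 1)), sub_lt_self _ (by positivity), fun a har ha => ?_⟩
    have h1 : 0 ≤ 1 - ‖a‖ := by linarith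
    refine ENNReal.toReal_le_of_le_ofReal hε.le ((hδ a ha).trans (ENNReal.ofReal_le_ofReal ?_))
    have h2 : 8 * (1 - ‖a‖) / δ ^ 2 * M ≤ ε / 2 := by
      have h3 : 1 - ‖a‖ ≤ ε * δ ^ 2 / (16 * (M + 1)) := by linarith
      calc 8 * (1 - ‖a‖) / δ ^ 2 * M
          ≤ 8 * (ε * δ ^ 2 / (16 * (M + 1))) / δ ^ 2 * (M + 1) := by gcongr; linarith
        _ = ε / 2 := by field_simp; norm_num
    linarith

/-- The Jensen gap vanishes at the boundary exactly when the energy measure is a vanishing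
Carleson measure. -/
lemma jensenGap_iff (hW : IsMatrixWeight W) :
    (CircleIntegrable (logDet W) 0 1 ∧
      ∀ ε : ℝ, 0 < ε → ∃ r < 1, ∀ z : ℂ, r < ‖z‖ → ‖z‖ < 1 → jensenGap W z ≤ ε) ↔
    IsVanishingCarleson (energyMeasure W) := by
  constructor
  · rintro ⟨hL, hlim⟩
    rw [isVanishingCarleson_iff]
    intro ε hε
    obtain ⟨r, hr1, hr⟩ := hlim (ε / (81 * (4 * π))) (by positivity)
    -- the inner corner of a Carleson square over a short arc is close to the boundary
    refine ⟨min (1 - r) 1, by simp [hr1], fun a h h0 h1 => ?_⟩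
    have h1' : h < 1 := h1.trans_le (min_le_right _ _)
    have hhr : h < 1 - r := h1.trans_le (min_le_left _ _)
    refine (measure_carlesonSquare_le _ h0 h1').trans ?_
    have hn : ‖circleMap 0 (1 - h) (2 * π * a)‖ = 1 - h := by
      rw [norm_circleMap_zero, abs_of_pos (by linarith)]
    have hn1 : ‖circleMap 0 (1 - h) (2 * π * a)‖ < 1 := by linarith
    rw [← hW.energyAt_eq hn1]
    have h2 := hr (circleMap 0 (1 - h) (2 * π * a)) (by linarith) hn1
    calc _ ≤ ENNReal.ofReal (81 * h) * ENNReal.ofReal (4 * π * (ε / (81 * (4 * π)))) := by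
          gcongr
          refine (hW.energyAt_le_jensenGap hL hn1).trans (ENNReal.ofReal_le_ofReal ?_)
          gcongr
      _ = ENNReal.ofReal (ε * h) := by
          rw [← ENNReal.ofReal_mul (by positivity)]
          congr 1
          field_simp
  · intro h
    obtain ⟨hfin, hlim⟩ := hW.tendsto_energyAt h
    have hL := hW.circleIntegrable_logDet (hfin 0 (by simp))
    refine ⟨hL, fun ε hε => ?_⟩
    obtain ⟨r, hr1, hr⟩ := hlim (ε / (40 * 13 ^ 4 + 2)) (by positivity)
    refine ⟨r, hr1, fun z hz hz1 => (hW.jensenGap_le_energyAt hL hz1 (hfin z hz1)).trans ?_⟩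
    have h1 := hr z hz hz1
    rw [le_div_iff₀ (by norm_num)] at h1
    linarith

lemma isVanishingCarleson_energyMeasure_iff (hW : IsMatrixWeight W) :
    IsVanishingCarleson (energyMeasure W) ↔
      IsVanishingCarleson (gradMeasure W 1) ∧ IsVanishingCarleson (gradMeasure W Complex.I) :=
  ⟨fun h => ⟨h.mono (hW.gradMeasure_le 1 (Or.inl rfl)),
    h.mono (hW.gradMeasure_le Complex.I (Or.inr rfl))⟩,
    fun h => (h.1.smul_add h.2 (by positivity : (0 : ℝ) ≤ d ^ 2)).mono hW.le_gradMeasure⟩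

lemma det_mul_exp_eq (hW : IsMatrixWeight W) {z : ℂ} (hz : z ∈ ball (0 : ℂ) 1) :
    (harmonicExt W z).det.re * Real.exp (-harmonicExt (logDet W) z) =
      Real.exp (jensenGap W z) := by
  rw [jensenGap, hW.logDetRe_herglotzInt hz, sub_eq_add_neg, Real.exp_add,
    Real.exp_log (hW.harmonicExt_posDef hz).det_re_pos]

end IsMatrixWeight

lemma neBot_comap_norm_nhdsLT : (comap (fun z : ℂ => ‖z‖) (𝓝[<] (1 : ℝ))).NeBot := by
  refine comap_neBot fun t ht => ?_
  have h0 : ∀ᶠ r in 𝓝[<] (1 : ℝ), 0 < r := nhdsWithin_le_nhds (Ioi_mem_nhds one_pos)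
  obtain ⟨r, hr, hr0⟩ := (Filter.inter_mem ht h0 |> Filter.nonempty_of_mem)
  exact ⟨(r : ℂ), by rwa [Complex.norm_real, Real.norm_of_nonneg (le_of_lt hr0)]⟩

lemma eventually_comap_norm_nhdsLT {p : ℂ → Prop} :
    (∀ᶠ z in comap (fun z : ℂ => ‖z‖) (𝓝[<] (1 : ℝ)), p z) ↔
      ∃ r < 1, ∀ z : ℂ, r < ‖z‖ → ‖z‖ < 1 → p z := by
  rw [((nhdsLT_basis (1 : ℝ)).comap fun z : ℂ => ‖z‖).eventually_iff]
  exact ⟨fun ⟨r, hr, h⟩ => ⟨r, hr, fun z h1 h2 => h ⟨h1, h2⟩⟩,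
    fun ⟨r, hr, h⟩ => ⟨r, hr, fun z hz => h z hz.1 hz.2⟩⟩

/-- For a function that is nonnegative near the boundary, the limit superior of its exponential
is one exactly when the function tends to zero. -/
lemma limsup_exp_eq_one_iff {u : ℂ → ℝ} (hu : ∀ z : ℂ, ‖z‖ < 1 → 0 ≤ u z) :
    limsup (fun z : ℂ => ((Real.exp (u z) : ℝ) : EReal))
        (comap (fun z : ℂ => ‖z‖) (𝓝[<] (1 : ℝ))) = 1 ↔
      ∀ ε : ℝ, 0 < ε → ∃ r < 1, ∀ z : ℂ, r < ‖z‖ → ‖z‖ < 1 → u z ≤ ε := by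
  have := neBot_comap_norm_nhdsLT
  constructor
  · intro h ε hε
    have h1 : limsup (fun z : ℂ => ((Real.exp (u z) : ℝ) : EReal))
        (comap (fun z : ℂ => ‖z‖) (𝓝[<] (1 : ℝ))) < ((Real.exp ε : ℝ) : EReal) := by
      rw [h]
      exact_mod_cast Real.one_lt_exp_iff.2 hε
    obtain ⟨r, hr, H⟩ := eventually_comap_norm_nhdsLT.1 (eventually_lt_of_limsup_lt h1)
    refine ⟨r, hr, fun z h1 h2 => ?_⟩
    have := H z h1 h2
    exact (Real.exp_lt_exp.1 (EReal.coe_lt_coe_iff.1 this)).le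
  · intro h
    refine le_antisymm ?_ ?_
    · refine EReal.le_of_forall_lt_iff_le.1 fun x hx => ?_
      have hx1 : (1 : ℝ) < x := by exact_mod_cast hx
      obtain ⟨r, hr, H⟩ := h (Real.log x) (Real.log_pos hx1)
      refine limsup_le_of_le (h := eventually_comap_norm_nhdsLT.2 ⟨r, hr, fun z h1 h2 => ?_⟩)
      rw [EReal.coe_le_coe_iff, ← Real.le_log_iff_exp_le (by linarith)]
      exact H z h1 h2
    · refine le_limsup_of_frequently_le (Eventually.frequently
        (eventually_comap_norm_nhdsLT.2 ⟨0, one_pos, fun z _ h2 => ?_⟩))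
      have := Real.one_le_exp (hu z h2)
      exact_mod_cast this

end

theorem mainTheorem4 (d : ℕ) (W : ℂ → Matrix (Fin d) (Fin d) ℂ) (hW : IsMatrixWeight W) :
    (CircleIntegrable (logDet W) 0 1 ∧
      limsup (fun z : ℂ =>
          (((harmonicExt W z).det.re * Real.exp (-harmonicExt (logDet W) z) : ℝ) : EReal))
        (comap (fun z : ℂ => ‖z‖) (𝓝[<] (1 : ℝ))) = 1) ↔
    (IsVanishingCarleson (gradMeasure W 1) ∧ IsVanishingCarleson (gradMeasure W Complex.I)) := by
  rw [← hW.isVanishingCarleson_energyMeasure_iff, ← hW.jensenGap_iff]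
  refine and_congr_right fun hL => ?_
  have e : limsup (fun z : ℂ =>
      (((harmonicExt W z).det.re * Real.exp (-harmonicExt (logDet W) z) : ℝ) : EReal))
        (comap (fun z : ℂ => ‖z‖) (𝓝[<] (1 : ℝ))) =
      limsup (fun z : ℂ => ((Real.exp (jensenGap W z) : ℝ) : EReal))
        (comap (fun z : ℂ => ‖z‖) (𝓝[<] (1 : ℝ))) :=
    limsup_congr (eventually_comap_norm_nhdsLT.2 ⟨0, one_pos, fun z _ h2 => by
      rw [hW.det_mul_exp_eq (mem_ball_zero_iff.2 h2)]⟩)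
  rw [e]
  exact limsup_exp_eq_one_iff fun z hz => hW.jensenGap_nonneg hL (mem_ball_zero_iff.2 hz)
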